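/- A knotted trivalent graph (KTG) is a trivalent ribbon-framed graph, possibly with circle components without vertices, whose edges and circles are colored by natural numbers such that the colors $a,b,c$ at each vertex are admissible: $a+b+c$ is even and $|a-b|\le c\le a+b$. Here we consider KTGs drawn without crossings (with the framing of the drawing), each connected piece being recorded up to orientation-preserving homeomorphism of the sphere on which it is drawn; marked points on the edges are disregarded. The theta KTG is the planar graph with two vertices joined by three edges. A triangle move replaces a vertex by a small triangle, one corner on each of the three edges that met there, the three new edges receiving any colors admissible at the corners. A fusion move takes two parallel strands of colors $a,b$ (not separated by other strands), and fuses them along a middle segment into a single edge of some color $c$, with $(a,b,c)$ admissible, creating two vertices with the colors $a,b,c$. Let $D$ be a non-empty diagram of a link $L$, with its crossings divided into twist regions; a twist region is a single crossing with a chosen direction of twisting or a chain of crossings, not closing up, in which consecutive crossings are joined by a bigon and are half twists of the same handedness. For $n\ge 1$ let $L^n_J$ be the skein element obtained from the $n$-blackboard cable of $D$ by replacing each $n$-cabled twist region by a $2n$ Jones–Wenzl projector in the direction of the twisting. It is regarded as a crossingless colored trivalent graph: the $n$ parallel strands between the twist regions become edges (or, for components of $D$ without crossings, circles) of color $n$,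 and each projector becomes an edge of color $2n$ with colors $n,n,2n$ at both ends. Moreover, three $2n$ projectors that are joined in pairs by $n$ parallel strands around a triangular region may be read as a trivalent vertex with the colors $2n,2n,2n$. **Lemma.** For every $n\ge 1$, every such $D$ and division into twist regions, and every such reading of $L^n_J$ as a KTG, there are an admissible triple $(a,b,c)$ and a finite sequence of KTGs without crossings that starts at the theta KTG with edges colored $a,b,c$, ends at $L^n_J$, and in which each KTG arises from the preceding one by a triangle move or by the inverse of a fusion move. In particular no untwisting moves are used. -/

import Mathlib

/-- Number of orbits of a bijection `f` of a finite type. -/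
noncomputable def orbitCount {D : Type} (f : D → D) : ℕ :=
  Nat.card (Quot fun x y => f x = y)

/-- Number of connected components of the map with rotation `σ` and edge involution `α`. -/
noncomputable def componentCount {D : Type} (σ α : D → D) : ℕ :=
  Nat.card (Quot fun x y => σ x = y ∨ α x = y)

/-- A combinatorial map: the orbits of `σ` are the vertices (`σ` is the counterclockwise rotation),
those of `α` the edges, those of `σ ∘ α` the faces.  It is planar when `V - E + F = 2 C`, that is,
when every connected component is drawn on a sphere. -/
def IsPlanarMap {D : Type} (σ α : D → D) : Prop :=
  orbitCount σ + orbitCount (σ ∘ α) = orbitCount α + 2 * componentCount σ α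

/-- Admissible triples of colors. -/
def AdmissibleTriple (a b c : ℕ) : Prop :=
  Even (a + b + c) ∧ a ≤ b + c ∧ b ≤ a + c ∧ c ≤ a + b

/-- A colored trivalent graph with its ribbon (blackboard) framing, given by its darts (half-edges):
`flip` exchanges the two halves of an edge and `next` is the counterclockwise rotation at a vertex.
Besides the trivalent vertices there may be bivalent ones, which are mere marked points on the
strands (so a circle without vertices carries at least one of them); they are immaterial, see
`KTG.Subdivision`.  The graph has a drawing without crossings exactly when it is `KTG.Planar`. -/
structure KTG where
  Dart : Type
  finite_dart : Finite Dart
  next : Dart → Dart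
  flip : Dart → Dart
  color : Dart → ℕ
  flip_flip : ∀ d, flip (flip d) = d
  flip_ne : ∀ d, flip d ≠ d
  next_ne : ∀ d, next d ≠ d
  valence : ∀ d, next (next d) = d ∨ next (next (next d)) = d
  color_flip : ∀ d, color (flip d) = color d
  color_bivalent : ∀ d, next (next d) = d → color (next d) = color d
  admissible : ∀ d, next (next (next d)) = d →
    AdmissibleTriple (color d) (color (next d)) (color (next (next d)))

namespace KTG

/-- The graph can be drawn without crossings. -/
def Planar (Γ : KTG) : Prop := IsPlanarMap Γ.next Γ.flip

/-- Isomorphism of colored ribbon graphs (preserving the rotation). -/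
def Iso (Γ Γ' : KTG) : Prop :=
  ∃ e : Γ.Dart ≃ Γ'.Dart, (∀ d, e (Γ.next d) = Γ'.next (e d)) ∧
    (∀ d, e (Γ.flip d) = Γ'.flip (e d)) ∧ ∀ d, Γ'.color (e d) = Γ.color d

/-- `Γ'` arises from `Γ` by placing a marked point (a bivalent vertex, with the two darts `p`, `q`)
on the edge `{x, flip x}`. -/
def Subdivision (Γ Γ' : KTG) : Prop :=
  ∃ (ι : Γ.Dart → Γ'.Dart) (x : Γ.Dart) (p q : Γ'.Dart),
    Function.Injective ι ∧ (∀ y, y ∈ Set.range ι ↔ y ≠ p ∧ y ≠ q) ∧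
    Γ'.flip (ι x) = p ∧ Γ'.next p = q ∧ Γ'.next q = p ∧ Γ'.flip q = ι (Γ.flip x) ∧
    (∀ d, d ≠ x → d ≠ Γ.flip x → Γ'.flip (ι d) = ι (Γ.flip d)) ∧
    (∀ d, Γ'.next (ι d) = ι (Γ.next d)) ∧
    (∀ d, Γ'.color (ι d) = Γ.color d)

/-- One elementary change of presentation of the same embedded colored graph. -/
def SameGraph (Γ Γ' : KTG) : Prop :=
  Iso Γ Γ' ∨ Subdivision Γ Γ' ∨ Subdivision Γ' Γ

/-- `Γ'` arises from `Γ` by replacing the trivalent vertex with the darts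
`x`, `next x`, `next (next x)` by a triangle.  At the `i`-th corner of the triangle the darts are, in
counterclockwise order, the old dart, `s i` (towards the next corner) and `t i` (towards the previous
one). -/
def IsTriangleMove (Γ Γ' : KTG) (ι : Γ.Dart → Γ'.Dart) (x : Γ.Dart)
    (s t : Fin 3 → Γ'.Dart) : Prop :=
  Γ.next (Γ.next (Γ.next x)) = x ∧
  Function.Bijective (Sum.elim ι (Sum.elim s t)) ∧
  (∀ i : Fin 3, Γ'.next (ι (Γ.next^[(i : ℕ)] x)) = s i ∧ Γ'.next (s i) = t i ∧
    Γ'.next (t i) = ι (Γ.next^[(i : ℕ)] x) ∧ Γ'.flip (s i) = t (i + 1)) ∧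
  (∀ d, Γ'.flip (ι d) = ι (Γ.flip d)) ∧
  (∀ d, (∀ i : Fin 3, d ≠ Γ.next^[(i : ℕ)] x) → Γ'.next (ι d) = ι (Γ.next d)) ∧
  (∀ d, Γ'.color (ι d) = Γ.color d)

/-- The triangle move; the colors of the three new edges are arbitrary, subject to admissibility
at the corners. -/
def TriangleMove (Γ Γ' : KTG) : Prop :=
  ∃ ι x s t, IsTriangleMove Γ Γ' ι x s t

/-- The fusion move: two parallel strands of `Γ`, passing through the marked points `{a, d}` (on the
right) and `{b, c}` (on the left), are fused along a new edge `{p, q}` of `Γ'`, of arbitrary color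
subject to admissibility.  The darts at the upper end of the new edge are, counterclockwise,
`p` (downwards), `a`, `b`; at its lower end they are `q` (upwards), `c`, `d`. -/
def FusionMove (Γ Γ' : KTG) : Prop :=
  ∃ (ι : Γ.Dart → Γ'.Dart) (a b c d : Γ.Dart) (p q : Γ'.Dart),
    Function.Injective ι ∧ (∀ y, y ∈ Set.range ι ↔ y ≠ p ∧ y ≠ q) ∧
    Γ.next a = d ∧ Γ.next d = a ∧ Γ.next b = c ∧ Γ.next c = b ∧
    Γ'.next p = ι a ∧ Γ'.next (ι a) = ι b ∧ Γ'.next (ι b) = p ∧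
    Γ'.next q = ι c ∧ Γ'.next (ι c) = ι d ∧ Γ'.next (ι d) = q ∧
    Γ'.flip p = q ∧
    (∀ x, Γ'.flip (ι x) = ι (Γ.flip x)) ∧
    (∀ x, x ≠ a → x ≠ b → x ≠ c → x ≠ d → Γ'.next (ι x) = ι (Γ.next x)) ∧
    (∀ x, Γ'.color (ι x) = Γ.color x)

/-- One step: no change of the embedded graph, a triangle move, or the inverse of a fusion move,
between graphs without crossings. -/
def Step (Γ Γ' : KTG) : Prop :=
  Γ.Planar ∧ Γ'.Planar ∧ (SameGraph Γ Γ' ∨ TriangleMove Γ Γ' ∨ FusionMove Γ' Γ)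

/-- `Γ'` is obtained from `Γ` by a finite sequence of triangle moves and inverses of fusion moves. -/
def Generates (Γ Γ' : KTG) : Prop := Relation.ReflTransGen Step Γ Γ'

/-- The planar theta graph with edges colored `a`, `b`, `c`: the dart `(i, v)` is the half of the
`i`-th edge at the vertex `v`. -/
def theta (a b c : ℕ) (h : AdmissibleTriple a b c) : KTG where
  Dart := Fin 3 × Bool
  finite_dart := inferInstance
  next d := (if d.2 then d.1 + 1 else d.1 + 2, d.2)
  flip d := (d.1, !d.2)
  color d := ![a, b, c] d.1
  flip_flip d := by simp
  flip_ne d := by rcases d with ⟨i, v⟩; cases v <;> simp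
  next_ne := by decide
  valence := by decide
  color_flip d := rfl
  color_bivalent d hd := absurd hd (by revert d; decide)
  admissible d _ := by
    obtain ⟨⟨k, hk⟩, l, m⟩ := h
    rcases d with ⟨i, v⟩
    have e : Even (a + b + c) := ⟨k, hk⟩
    fin_cases i <;> cases v <;>
      simp [AdmissibleTriple, Nat.even_add] at e ⊢ <;> refine ⟨by tauto, ?_, ?_, ?_⟩ <;> omega

end KTG

/-- A link diagram on the sphere (each connected piece of it, see `IsPlanarMap`), as a plane map
whose vertices are the crossings (valence 4) and marked points on the strands (valence 2, so that
circles without crossings are allowed).  The strands run straight through a crossing, from `d` to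
`next (next d)`; `isOver d` says that the strand of `d` is the overstrand. -/
structure LinkDiagram where
  Dart : Type
  finite_dart : Finite Dart
  next : Dart → Dart
  flip : Dart → Dart
  isOver : Dart → Bool
  flip_flip : ∀ d, flip (flip d) = d
  flip_ne : ∀ d, flip d ≠ d
  next_ne : ∀ d, next d ≠ d
  valence : ∀ d, next (next (next (next d))) = d
  isOver_next : ∀ d, next (next d) ≠ d → isOver (next d) = !isOver d
  planar : IsPlanarMap next flip

namespace LinkDiagram

/-- The dart `d` issues from a crossing (and not from a marked point). -/
def AtCrossing (L : LinkDiagram) (d : L.Dart) : Prop := L.next (L.next d) ≠ d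

/-- A decomposition of the crossings of a diagram into twist regions.  `side` splits the four darts at
each crossing into two ends of two neighboring darts each: the crossing is a half twist of the two
strands that run from one end to the other.  An end is named by its first dart `e` in
counterclockwise order, the other one being `next e`.  `joined e` says that the twist region
continues at this end: the two darts there bound a bigon, at whose other corner is the end
`flip (next e)` of the following crossing, with a half twist of the same handedness.
`pos` numbers the crossings along a twist region, so that the region does not close up.
A crossing none of whose ends is joined is a twist region by itself. -/
structure TwistRegions (L : LinkDiagram) where
  side : L.Dart → Bool
  joined : L.Dart → Prop
  pos : L.Dart → ℕ
  side_opposite : ∀ d, L.AtCrossing d → side (L.next (L.next d)) = !side d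
  pos_next : ∀ d, L.AtCrossing d → pos (L.next d) = pos d
  joined_crossing : ∀ e, joined e → L.AtCrossing e
  joined_first : ∀ e, joined e → side (L.next e) = side e
  joined_bigon : ∀ e, joined e → L.next (L.flip (L.next e)) = L.flip e
  joined_symm : ∀ e, joined e → joined (L.flip (L.next e))
  joined_side : ∀ e, joined e → side (L.flip (L.next e)) = !side e
  joined_over : ∀ e, joined e → L.isOver (L.flip (L.next e)) = L.isOver e
  joined_pos : ∀ e, joined e → side e = true → pos (L.flip (L.next e)) = pos e + 1

theorem atCrossing_next {L : LinkDiagram} {d : L.Dart} (h : L.AtCrossing d) :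
    L.AtCrossing (L.next d) := by
  intro h'
  have := congrArg (fun x => L.next (L.next (L.next x))) h'
  simp only [L.valence] at this
  exact h this

theorem atCrossing_of_next {L : LinkDiagram} {d : L.Dart} (h : L.AtCrossing (L.next d)) :
    L.AtCrossing d := fun h' => h (congrArg L.next h')

namespace TwistRegions

variable {L : LinkDiagram} (T : L.TwistRegions)

/-- `e` is the first dart of an end of a crossing. -/
def IsEnd (e : L.Dart) : Prop := L.AtCrossing e ∧ T.side (L.next e) = T.side e

/-- `d` does not lie inside a twist region. -/
def Outer (d : L.Dart) : Prop :=
  ¬ T.joined d ∧ ¬ T.joined (L.next (L.next (L.next d)))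

variable {T}

theorem isEnd_opp {e : L.Dart} (h : T.IsEnd e) : T.IsEnd (L.next (L.next e)) := by
  refine ⟨atCrossing_next (atCrossing_next h.1), ?_⟩
  rw [T.side_opposite _ (atCrossing_next h.1), T.side_opposite _ h.1, h.2]

theorem not_isEnd_next {e : L.Dart} (h : T.IsEnd e) : ¬ T.IsEnd (L.next e) := by
  intro h'
  have h1 := h'.2
  rw [T.side_opposite _ h.1, h.2] at h1
  cases hs : T.side e <;> simp [hs] at h1

theorem not_isEnd_prev {e : L.Dart} (h : T.IsEnd e) :
    ¬ T.IsEnd (L.next (L.next (L.next e))) :=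
  not_isEnd_next (isEnd_opp h)

theorem isEnd_prev {d : L.Dart} (hc : L.AtCrossing d) (h : ¬ T.IsEnd d) :
    T.IsEnd (L.next (L.next (L.next d))) := by
  refine ⟨atCrossing_next (atCrossing_next (atCrossing_next hc)), ?_⟩
  have h1 : T.side (L.next d) ≠ T.side d := fun e => h ⟨hc, e⟩
  rw [L.valence, T.side_opposite _ (atCrossing_next hc)]
  cases ha : T.side d <;> cases hb : T.side (L.next d) <;> simp_all

theorem joined_isEnd {e : L.Dart} (h : T.joined e) : T.IsEnd e :=
  ⟨T.joined_crossing e h, T.joined_first e h⟩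

theorem outer_flip {d : L.Dart} (h : T.Outer d) : T.Outer (L.flip d) := by
  constructor
  · intro hj
    apply h.2
    have hb := T.joined_bigon _ hj
    have hs := T.joined_symm _ hj
    rw [L.flip_flip] at hb
    rw [← hb, L.valence]
    exact hs
  · intro hj
    apply h.1
    have hs := T.joined_symm _ hj
    rw [L.valence, L.flip_flip] at hs
    exact hs

theorem outer_next {d : L.Dart} (h : T.Outer d) (hd : ¬ (L.AtCrossing d ∧ ¬ T.IsEnd d)) :
    T.Outer (L.next d) := by
  refine ⟨fun hj => ?_, by rw [L.valence]; exact h.1⟩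
  have he := joined_isEnd hj
  have hc := atCrossing_of_next he.1
  exact not_isEnd_next (T := T) (by_contra fun hne => hd ⟨hc, hne⟩) he

theorem outer_of_isEnd {e : L.Dart} (he : T.IsEnd e) (h : ¬ T.joined e) : T.Outer e :=
  ⟨h, fun hj => not_isEnd_prev he (joined_isEnd hj)⟩

variable (T)

open Classical in
/-- The rotation of the graph `limitGraph` below. -/
noncomputable def limitNext :
    {d // T.Outer d} ⊕ {e // T.IsEnd e} → {d // T.Outer d} ⊕ {e // T.IsEnd e}
  | Sum.inl d =>
      if h : L.AtCrossing d.1 ∧ ¬ T.IsEnd d.1 then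
        Sum.inr ⟨L.next (L.next (L.next d.1)), isEnd_prev h.1 h.2⟩
      else Sum.inl ⟨L.next d.1, outer_next d.2 h⟩
  | Sum.inr e =>
      if h : T.joined e.1 then Sum.inr ⟨L.flip (L.next e.1), joined_isEnd (T.joined_symm _ h)⟩
      else Sum.inl ⟨e.1, outer_of_isEnd e.2 h⟩

variable {T}

theorem limitNext_outer {d : {d // T.Outer d}} (h : ¬ (L.AtCrossing d.1 ∧ ¬ T.IsEnd d.1)) :
    T.limitNext (Sum.inl d) = Sum.inl ⟨L.next d.1, outer_next d.2 h⟩ := by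
  simp only [limitNext, dif_neg h]

theorem limitNext_second {d : {d // T.Outer d}} (h : L.AtCrossing d.1 ∧ ¬ T.IsEnd d.1) :
    T.limitNext (Sum.inl d) =
      Sum.inr ⟨L.next (L.next (L.next d.1)), isEnd_prev h.1 h.2⟩ := by
  simp only [limitNext, dif_pos h]

theorem limitNext_joined {e : {e // T.IsEnd e}} (h : T.joined e.1) :
    T.limitNext (Sum.inr e) =
      Sum.inr ⟨L.flip (L.next e.1), joined_isEnd (T.joined_symm _ h)⟩ := by
  simp only [limitNext, dif_pos h]

theorem limitNext_free {e : {e // T.IsEnd e}} (h : ¬ T.joined e.1) :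
    T.limitNext (Sum.inr e) = Sum.inl ⟨e.1, outer_of_isEnd e.2 h⟩ := by
  simp only [limitNext, dif_neg h]

/-- A marked point of the diagram stays a bivalent vertex. -/
theorem limitNext_marked {d : {d // T.Outer d}} (h : ¬ L.AtCrossing d.1) :
    T.limitNext (Sum.inl d) ≠ Sum.inl d ∧
    T.limitNext (T.limitNext (Sum.inl d)) = Sum.inl d ∧
    ∃ d', T.limitNext (Sum.inl d) = Sum.inl d' := by
  have h1 : ¬ (L.AtCrossing d.1 ∧ ¬ T.IsEnd d.1) := fun x => h x.1
  have h2 : ¬ (L.AtCrossing (L.next d.1) ∧ ¬ T.IsEnd (L.next d.1)) :=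
    fun x => h (atCrossing_of_next x.1)
  rw [limitNext_outer h1]
  refine ⟨?_, ?_, _, rfl⟩
  · intro e
    exact L.next_ne d.1 (congrArg Subtype.val (Sum.inl.inj e))
  · rw [limitNext_outer h2]
    congr 1
    exact Subtype.ext (not_not.mp h)

/-- A joined end gives a bivalent vertex. -/
theorem limitNext_joined_two {e : {e // T.IsEnd e}} (h : T.joined e.1) :
    T.limitNext (Sum.inr e) ≠ Sum.inr e ∧
    T.limitNext (T.limitNext (Sum.inr e)) = Sum.inr e ∧
    ∃ e', T.limitNext (Sum.inr e) = Sum.inr e' := by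
  rw [limitNext_joined h]
  refine ⟨?_, ?_, _, rfl⟩
  · intro e'
    have h1 := T.joined_side _ h
    have h2 : L.flip (L.next e.1) = e.1 := congrArg Subtype.val (Sum.inr.inj e')
    rw [h2] at h1
    cases hs : T.side e.1 <;> simp [hs] at h1
  · rw [limitNext_joined (T.joined_symm _ h)]
    congr 1
    apply Subtype.ext
    simp only [T.joined_bigon _ h, L.flip_flip]

/-- A free end gives a trivalent vertex. -/
theorem limitNext_free_three {e : {e // T.IsEnd e}} (h : ¬ T.joined e.1) :
    ∃ d d' : {d // T.Outer d}, T.limitNext (Sum.inr e) = Sum.inl d ∧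
      T.limitNext (Sum.inl d) = Sum.inl d' ∧ T.limitNext (Sum.inl d') = Sum.inr e ∧
      d ≠ d' := by
  have h1 : ¬ (L.AtCrossing e.1 ∧ ¬ T.IsEnd e.1) := fun x => x.2 e.2
  refine ⟨⟨e.1, outer_of_isEnd e.2 h⟩,
    ⟨L.next e.1, outer_next (outer_of_isEnd e.2 h) h1⟩, limitNext_free h, ?_, ?_, ?_⟩
  · rw [limitNext_outer h1]
  · rw [limitNext_second ⟨atCrossing_next e.2.1, not_isEnd_next e.2⟩]
    congr 1
    exact Subtype.ext (L.valence e.1)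
  · intro he
    exact L.next_ne e.1 (congrArg Subtype.val he).symm

/-- Every vertex is of one of the three kinds above. -/
theorem limitNext_cases (x : {d // T.Outer d} ⊕ {e // T.IsEnd e}) :
    (∃ d, x = Sum.inl d ∧ ¬ L.AtCrossing d.1) ∨ (∃ e, x = Sum.inr e ∧ T.joined e.1) ∨
    (∃ e : {e // T.IsEnd e}, ¬ T.joined e.1 ∧ (x = Sum.inr e ∨ x = T.limitNext (Sum.inr e) ∨
      x = T.limitNext (T.limitNext (Sum.inr e)))) := by
  rcases x with d | e
  · by_cases hc : L.AtCrossing d.1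
    · right; right
      by_cases he : T.IsEnd d.1
      · exact ⟨⟨d.1, he⟩, d.2.1, Or.inr (Or.inl (by rw [limitNext_free (e := ⟨d.1, he⟩) d.2.1]))⟩
      · refine ⟨⟨_, isEnd_prev hc he⟩, d.2.2, Or.inr (Or.inr ?_)⟩
        rw [limitNext_free (e := ⟨_, isEnd_prev hc he⟩) d.2.2,
          limitNext_outer (fun x => x.2 (isEnd_prev hc he))]
        congr 1
        exact Subtype.ext (L.valence d.1).symm
    · exact Or.inl ⟨d, rfl, hc⟩
  · by_cases hj : T.joined e.1
    · exact Or.inr (Or.inl ⟨e, rfl, hj⟩)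
    · exact Or.inr (Or.inr ⟨e, hj, Or.inl rfl⟩)

variable (T)

/-- The skein element obtained from the `n`-cable of the diagram by replacing each twist region by a
`2n` Jones-Wenzl projector, as a colored trivalent graph: the `n`-cabled strands outside the twist
regions become edges of color `n`, and the projector of a twist region becomes an edge of color `2n`
(along the direction of twisting) whose two endpoints have the colors `n, n, 2n`.
The darts `Sum.inr e` are the halves of the edges of color `2n`, one edge for each crossing; where
two crossings follow each other in a twist region, these edges are joined end to end at a marked
point, so that each twist region contributes one edge of color `2n`. -/
noncomputable def limitGraph (n : ℕ) : KTG where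
  Dart := {d // T.Outer d} ⊕ {e // T.IsEnd e}
  finite_dart := by
    have := L.finite_dart
    infer_instance
  next := T.limitNext
  flip
    | Sum.inl d => Sum.inl ⟨L.flip d.1, outer_flip d.2⟩
    | Sum.inr e => Sum.inr ⟨L.next (L.next e.1), isEnd_opp e.2⟩
  color
    | Sum.inl _ => n
    | Sum.inr _ => 2 * n
  flip_flip := by
    rintro (d | e)
    · simp [L.flip_flip]
    · simp [L.valence]
  flip_ne := by
    rintro (d | e) h
    · exact L.flip_ne d.1 (congrArg Subtype.val (Sum.inl.inj h))
    · exact e.2.1 (congrArg Subtype.val (Sum.inr.inj h))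
  next_ne x := by
    rcases limitNext_cases x with ⟨d, rfl, h⟩ | ⟨e, rfl, h⟩ | ⟨e, h, hx⟩
    · exact (limitNext_marked h).1
    · exact (limitNext_joined_two h).1
    · obtain ⟨d, d', h1, h2, h3, hne⟩ := limitNext_free_three h
      rcases hx with rfl | rfl | rfl
      · simp [h1]
      · simpa [h1, h2] using hne.symm
      · simp [h1, h2, h3]
  valence x := by
    rcases limitNext_cases x with ⟨d, rfl, h⟩ | ⟨e, rfl, h⟩ | ⟨e, h, hx⟩
    · exact Or.inl (limitNext_marked h).2.1
    · exact Or.inl (limitNext_joined_two h).2.1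
    · obtain ⟨d, d', h1, h2, h3, hne⟩ := limitNext_free_three h
      right
      rcases hx with rfl | rfl | rfl <;> simp [h1, h2, h3]
  color_flip := by rintro (d | e) <;> rfl
  color_bivalent x hx2 := by
    rcases limitNext_cases x with ⟨d, rfl, h⟩ | ⟨e, rfl, h⟩ | ⟨e, h, hx⟩
    · obtain ⟨d', h'⟩ := (limitNext_marked h).2.2
      rw [h']
    · obtain ⟨d', h'⟩ := (limitNext_joined_two h).2.2
      rw [h']
    · obtain ⟨d, d', h1, h2, h3, hne⟩ := limitNext_free_three h
      exfalso
      rcases hx with rfl | rfl | rfl <;> simp [h1, h2, h3] at hx2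
      exact hne hx2
  admissible x hx3 := by
    rcases limitNext_cases x with ⟨d, rfl, h⟩ | ⟨e, rfl, h⟩ | ⟨e, h, hx⟩
    · rw [(limitNext_marked h).2.1] at hx3
      exact absurd hx3 (limitNext_marked h).1
    · rw [(limitNext_joined_two h).2.1] at hx3
      exact absurd hx3 (limitNext_joined_two h).1
    · obtain ⟨d, d', h1, h2, h3, hne⟩ := limitNext_free_three h
      rcases hx with rfl | rfl | rfl <;> simp only [h1, h2, h3] <;>
        refine ⟨⟨2 * n, by ring⟩, ?_, ?_, ?_⟩ <;> omega

end TwistRegions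

end LinkDiagram

namespace KTG

/-- Three `2n` projectors, joined in pairs by `n` parallel strands around a triangle, are by definition
a trivalent vertex with the colors `2n, 2n, 2n`: `Γ` with the triangle and `Γ'` with the vertex show
the same skein element. -/
def VertexReading (n : ℕ) (Γ Γ' : KTG) : Prop :=
  ∃ ι x s t, IsTriangleMove Γ' Γ ι x s t ∧
    (∀ i : Fin 3, Γ'.color (Γ'.next^[(i : ℕ)] x) = 2 * n) ∧ ∀ i : Fin 3, Γ.color (s i) = n

end KTG

/-- `Γ` is a way of reading the skein element given by `T.limitGraph n` as a knotted trivalent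
graph: some (possibly none, possibly all) of the arrangements of three `2n` projectors around a
triangle are read as trivalent vertices. -/
def LinkDiagram.TwistRegions.LimitReading {L : LinkDiagram} (T : L.TwistRegions) (n : ℕ)
    (Γ : KTG) : Prop :=
  Relation.ReflTransGen (fun Γ₁ Γ₂ => KTG.SameGraph Γ₁ Γ₂ ∨ KTG.VertexReading n Γ₁ Γ₂)
    (T.limitGraph n) Γ

/-!
All colors of the limit graph are `n` or `2 * n`, and this survives every reading of it.  For three
colors between `n` and `2 * n` (`KTG.Banded`) the triangle inequalities hold automatically, so such a
triple is admissible as soon as its sum is even (`KTG.admissible_of_band`), and a color of the right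
parity can always be found, because the band contains two consecutive numbers.  Hence every change
of the uncolored graph that is made below can be colored within the band, and the theorem follows
from the general fact `KTG.generated_of_planar`: a non-empty planar graph with colors in the band is
generated from a theta graph.

That fact is proved backwards, by simplifying the graph with fusions and with contractions of
triangles.

* A Whitehead move (an edge joining two vertices is turned by a quarter) is a fusion followed by the
  contraction of a triangle (`KTG.IsWhitehead.generates`).
* A connected graph without marked points (`KTG.Regular`) has at least two faces, by the Euler formula.
  Starting from a single face, take a union of faces that is neither empty nor everything; a suitable
  Whitehead move lowers its number of darts, unless the graph has a face with a single side
  (`KTG.Regular.generated_of_invariant`).  Such a face is enlarged by a Whitehead move to one with two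
  sides.  Then the graph is a theta, or a further Whitehead move gives a triangle, which is contracted.
  The induction is on the number of darts (`KTG.Regular.generated`).
* A circle without vertices comes from a dumbbell (`KTG.generated_of_circle`), other marked points are
  erased, and two components are connected by fusing a strand of one with a strand of the other
  (`KTG.exists_fusion_of_components`).

Planarity is followed through all moves by counting vertices, edges, faces and components as classes
of darts.  The same kind of count shows that the limit graph is planar
(`LinkDiagram.TwistRegions.limitGraph_planar`): a crossing is replaced by an edge with two endpoints,
and where two crossings of a twist region follow each other, a bigon is lost.
-/

/-! ### Counting classes of a relation -/

/-- `f` induces a bijection from the classes of `r` to `X`, with inverse `g`. -/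
theorem card_quot_eq {D X : Type} {r : D → D → Prop} (f : D → X) (g : X → Quot r)
    (hf : ∀ a b, r a b → f a = f b) (hgf : ∀ a, g (f a) = Quot.mk r a)
    (hfg : ∀ x, Quot.lift f hf (g x) = x) : Nat.card (Quot r) = Nat.card X :=
  Nat.card_congr ⟨Quot.lift f hf, g, by rintro ⟨a⟩; exact hgf a, hfg⟩

theorem card_quot_congr {D D' : Type} {r : D → D → Prop} {r' : D' → D' → Prop}
    (f : D → D') (g : D' → D)
    (hf : ∀ a b, r a b → Quot.mk r' (f a) = Quot.mk r' (f b))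
    (hg : ∀ a b, r' a b → Quot.mk r (g a) = Quot.mk r (g b))
    (hgf : ∀ a, Quot.mk r (g (f a)) = Quot.mk r a)
    (hfg : ∀ a, Quot.mk r' (f (g a)) = Quot.mk r' a) :
    Nat.card (Quot r) = Nat.card (Quot r') :=
  card_quot_eq (fun a => Quot.mk r' (f a)) (Quot.lift (fun a => Quot.mk r (g a)) hg) hf hgf
    (by rintro ⟨a⟩; exact hfg a)

/-- Identifying two distinct classes lowers the number of classes by one. -/
theorem card_quot_merge {D : Type} [Finite D] (r : D → D → Prop) (u v : D)
    (h : Quot.mk r u ≠ Quot.mk r v) :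
    Nat.card (Quot r) = Nat.card (Quot fun a b => r a b ∨ (a = u ∧ b = v)) + 1 := by
  classical
  have hfin : Finite (Quot fun a b => r a b ∨ (a = u ∧ b = v)) := inferInstance
  rw [show Nat.card (Quot fun a b => r a b ∨ (a = u ∧ b = v)) + 1 =
    Nat.card ((Quot fun a b => r a b ∨ (a = u ∧ b = v)) ⊕ Unit) by simp [Nat.card_sum]]
  set r' := fun a b => r a b ∨ (a = u ∧ b = v) with hr'
  have key : ∀ a b, r a b → (Quot.mk r a = Quot.mk r b) := fun a b => Quot.sound
  have key' : ∀ a b, r a b → (Quot.mk r' a = Quot.mk r' b) := fun a b h => Quot.sound (Or.inl h)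
  have huv : Quot.mk r' u = Quot.mk r' v := Quot.sound (Or.inr ⟨rfl, rfl⟩)
  refine card_quot_eq
    (fun a => if Quot.mk r a = Quot.mk r v then Sum.inr () else Sum.inl (Quot.mk r' a))
    (Sum.elim (Quot.lift (fun a => if Quot.mk r a = Quot.mk r v then Quot.mk r u else Quot.mk r a)
      ?_) fun _ => Quot.mk r v) ?_ ?_ ?_
  · rintro a b (hab | ⟨rfl, rfl⟩)
    · rw [key a b hab]
    · simp [h]
  · intro a b hab
    simp only [key a b hab, key' a b hab]
  · intro a
    by_cases ha : Quot.mk r a = Quot.mk r v <;> simp [ha]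
  · rintro (a | ⟨⟩)
    · rcases a with ⟨a⟩
      by_cases ha : Quot.mk r a = Quot.mk r v
      · have h2 : ∀ q : Quot r, q = Quot.mk r v →
            Quot.lift (Quot.mk r') key' q = Quot.mk r' v := by rintro _ rfl; rfl
        have := h2 _ ha
        simp only [Sum.elim_inl, ha, if_true, if_neg h]
        simp only at this
        rw [this, huv]
      · simp [ha]
    · simp

/-- The orbits of a map. -/
abbrev Orbit {D : Type} (f : D → D) : Type := Quot fun x y => f x = y

/-- The connected components of a map. -/
abbrev Component {D : Type} (σ α : D → D) : Type := Quot fun x y => σ x = y ∨ α x = y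

/-- The orbit of a point. -/
abbrev orb {D : Type} (f : D → D) (x : D) : Orbit f := Quot.mk _ x

/-- The connected component of a point. -/
abbrev comp {D : Type} (σ α : D → D) (x : D) : Component σ α := Quot.mk _ x

theorem orb_apply {D : Type} (f : D → D) (x : D) : orb f (f x) = orb f x := by
  symm
  exact Quot.sound rfl

theorem comp_left {D : Type} (σ α : D → D) (x : D) : comp σ α (σ x) = comp σ α x := by
  symm
  exact Quot.sound (Or.inl rfl)

theorem comp_right {D : Type} (σ α : D → D) (x : D) : comp σ α (α x) = comp σ α x := by
  symm
  exact Quot.sound (Or.inr rfl)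

theorem orbitCount_eq {D X : Type} {φ : D → D} (f : D → X) (g : X → Orbit φ)
    (hf : ∀ a, f (φ a) = f a) (hgf : ∀ a, g (f a) = orb φ a)
    (hfg : ∀ x, ∃ a, g x = orb φ a ∧ f a = x) : orbitCount φ = Nat.card X :=
  card_quot_eq f g (by rintro a _ rfl; exact (hf a).symm) hgf
    (fun x => by obtain ⟨a, h1, h2⟩ := hfg x; rw [h1]; exact h2)

theorem orbitCount_congr {D D' : Type} {φ : D → D} {φ' : D' → D'} (f : D → D') (g : D' → D)
    (hf : ∀ a, orb φ' (f (φ a)) = orb φ' (f a)) (hg : ∀ a, orb φ (g (φ' a)) = orb φ (g a))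
    (hgf : ∀ a, orb φ (g (f a)) = orb φ a) (hfg : ∀ a, orb φ' (f (g a)) = orb φ' a) :
    orbitCount φ = orbitCount φ' :=
  card_quot_congr f g (by rintro a _ rfl; exact (hf a).symm) (by rintro a _ rfl; exact (hg a).symm)
    hgf hfg

theorem componentCount_congr {D D' : Type} {σ α : D → D} {σ' α' : D' → D'} (f : D → D')
    (g : D' → D)
    (hf : ∀ a, comp σ' α' (f (σ a)) = comp σ' α' (f a))
    (hf' : ∀ a, comp σ' α' (f (α a)) = comp σ' α' (f a))
    (hg : ∀ a, comp σ α (g (σ' a)) = comp σ α (g a))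
    (hg' : ∀ a, comp σ α (g (α' a)) = comp σ α (g a))
    (hgf : ∀ a, comp σ α (g (f a)) = comp σ α a)
    (hfg : ∀ a, comp σ' α' (f (g a)) = comp σ' α' a) :
    componentCount σ α = componentCount σ' α' :=
  card_quot_congr f g (by rintro a _ (rfl | rfl); exacts [(hf a).symm, (hf' a).symm])
    (by rintro a _ (rfl | rfl); exacts [(hg a).symm, (hg' a).symm]) hgf hfg

/-- Every orbit of a map without fixed points has at least two elements. -/
theorem two_mul_orbitCount_le {D : Type} [Finite D] {f : D → D} (hf : ∀ d, f d ≠ d) :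
    2 * orbitCount f ≤ Nat.card D := by
  have : Nat.card (Orbit f × Bool) ≤ Nat.card D := by
    apply Nat.card_le_card_of_injective
      (fun q : Orbit f × Bool => if q.2 then q.1.out else f q.1.out)
    have h1 : ∀ q : Orbit f, orb f (f q.out) = q := fun q => by
      rw [orb_apply]; exact Quot.out_eq q
    rintro ⟨q, b⟩ ⟨q', b'⟩ h
    have hq : q = q' := by
      have := congrArg (orb f) h
      cases b <;> cases b' <;> simp only [if_true, if_false, Bool.false_eq_true, h1] at this
      · exact this
      · exact this.trans (Quot.out_eq _)
      · exact (Quot.out_eq _).symm.trans this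
      · exact (Quot.out_eq _).symm.trans (this.trans (Quot.out_eq _))
    subst hq
    cases b <;> cases b' <;> simp at h ⊢
    · exact hf _ h
    · exact hf _ h.symm
  simpa [Nat.card_prod, mul_comm, orbitCount] using this

/-- The orbits of an involution without fixed points are pairs. -/
theorem two_mul_orbitCount_involution {D : Type} [Finite D] {f : D → D} (hf : ∀ d, f d ≠ d)
    (hff : ∀ d, f (f d) = d) : 2 * orbitCount f = Nat.card D := by
  refine le_antisymm (two_mul_orbitCount_le hf) ?_
  have : Nat.card D ≤ Nat.card (Orbit f × Bool) := by
    apply Nat.card_le_card_of_surjective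
      (fun q : Orbit f × Bool => if q.2 then q.1.out else f q.1.out)
    intro d
    have h2 : ∀ x y : D, Relation.EqvGen (fun x y => f x = y) x y → x = y ∨ f x = y := by
      intro x y h
      induction h with
      | rel x y h => exact Or.inr h
      | refl x => exact Or.inl rfl
      | symm x y h ih =>
        rcases ih with rfl | rfl
        · exact Or.inl rfl
        · exact Or.inr (hff _)
      | trans x y z h h' ih ih' =>
        rcases ih with rfl | rfl <;> rcases ih' with rfl | rfl
        · exact Or.inl rfl
        · exact Or.inr rfl
        · exact Or.inr rfl
        · exact Or.inl (hff _).symm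
    rcases h2 (orb f d).out d (Quot.eqvGen_exact (Quot.out_eq _)) with h | h
    · exact ⟨(orb f d, true), by simpa using h⟩
    · exact ⟨(orb f d, false), by simpa using h⟩
  simpa [Nat.card_prod, mul_comm, orbitCount] using this

/-- In a connected map a property that is invariant under both bijections holds everywhere or
nowhere. -/
theorem forall_of_componentCount_eq_one {D : Type} [Finite D] {σ α : D → D}
    (h : componentCount σ α = 1)
    {P : D → Prop} (hσ : ∀ d, P (σ d) ↔ P d) (hα : ∀ d, P (α d) ↔ P d) {x : D} (hx : P x) (y : D) :
    P y := by
  have : Subsingleton (Component σ α) :=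
    (Finite.card_le_one_iff_subsingleton (α := Component σ α)).mp h.le
  have h1 : comp σ α x = comp σ α y := Subsingleton.elim _ _
  have hP : ∀ a b, (σ a = b ∨ α a = b) → P a = P b := by
    rintro a _ (rfl | rfl)
    exacts [propext (hσ a).symm, propext (hα a).symm]
  have h2 : Quot.lift P hP (comp σ α x) = Quot.lift P hP (comp σ α y) := by rw [h1]
  exact cast h2 hx

namespace KTG

/-- The face permutation: `face d` follows `d` along the boundary of a face. -/
def face (Γ : KTG) (d : Γ.Dart) : Γ.Dart := Γ.next (Γ.flip d)

instance (Γ : KTG) : Finite Γ.Dart := Γ.finite_dart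

/-- The number of connected components. -/
noncomputable def components (Γ : KTG) : ℕ := componentCount Γ.next Γ.flip

theorem planar_iff (Γ : KTG) : Γ.Planar ↔
    orbitCount Γ.next + orbitCount Γ.face = orbitCount Γ.flip + 2 * Γ.components := Iff.rfl

theorem two_mul_edges (Γ : KTG) : 2 * orbitCount Γ.flip = Nat.card Γ.Dart :=
  two_mul_orbitCount_involution Γ.flip_ne Γ.flip_flip

theorem next_injective (Γ : KTG) : Function.Injective Γ.next := by
  have h6 : ∀ d, Γ.next (Γ.next (Γ.next (Γ.next (Γ.next (Γ.next d))))) = d := by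
    intro d
    rcases Γ.valence d with h | h
    · simp only [h]
    · simp only [h]
  intro a b h
  rw [← h6 a, ← h6 b, h]

theorem flip_injective (Γ : KTG) : Function.Injective Γ.flip := by
  intro a b h
  rw [← Γ.flip_flip a, ← Γ.flip_flip b, h]

theorem face_injective (Γ : KTG) : Function.Injective Γ.face :=
  Γ.next_injective.comp Γ.flip_injective

/-! ### Changes of presentation -/

theorem Iso.symm {Γ Γ' : KTG} : Iso Γ Γ' → Iso Γ' Γ := by
  rintro ⟨e, h1, h2, h3⟩
  refine ⟨e.symm, fun d => ?_, fun d => ?_, fun d => ?_⟩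
  · apply e.injective; simp [h1]
  · apply e.injective; simp [h2]
  · rw [← h3]; simp

theorem Iso.components_eq {Γ Γ' : KTG} : Iso Γ Γ' → Γ.components = Γ'.components := by
  rintro ⟨e, h1, h2, h3⟩
  have h1' : ∀ d, e.symm (Γ'.next d) = Γ.next (e.symm d) := fun d => by
    apply e.injective; simp [h1]
  have h2' : ∀ d, e.symm (Γ'.flip d) = Γ.flip (e.symm d) := fun d => by
    apply e.injective; simp [h2]
  apply componentCount_congr e e.symm <;> intro d <;>
    simp only [h1, h2, h1', h2', comp_left, comp_right, Equiv.symm_apply_apply,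
      Equiv.apply_symm_apply]

theorem Iso.planar {Γ Γ' : KTG} (h : Iso Γ Γ') (hp : Γ.Planar) : Γ'.Planar := by
  have hc := h.components_eq
  obtain ⟨e, h1, h2, h3⟩ := h
  have h1' : ∀ d, e.symm (Γ'.next d) = Γ.next (e.symm d) := fun d => by
    apply e.injective; simp [h1]
  have h2' : ∀ d, e.symm (Γ'.flip d) = Γ.flip (e.symm d) := fun d => by
    apply e.injective; simp [h2]
  have h4 : ∀ d, e (Γ.face d) = Γ'.face (e d) := fun d => by simp [face, h1, h2]
  have h4' : ∀ d, e.symm (Γ'.face d) = Γ.face (e.symm d) := fun d => by simp [face, h1', h2']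
  have hV : orbitCount Γ.next = orbitCount Γ'.next := by
    apply orbitCount_congr e e.symm <;> intro d <;>
      simp only [h1, h1', orb_apply, Equiv.symm_apply_apply, Equiv.apply_symm_apply]
  have hE : orbitCount Γ.flip = orbitCount Γ'.flip := by
    apply orbitCount_congr e e.symm <;> intro d <;>
      simp only [h2, h2', orb_apply, Equiv.symm_apply_apply, Equiv.apply_symm_apply]
  have hF : orbitCount Γ.face = orbitCount Γ'.face := by
    apply orbitCount_congr e e.symm <;> intro d <;>
      simp only [h4, h4', orb_apply, Equiv.symm_apply_apply, Equiv.apply_symm_apply]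
  rw [planar_iff] at hp ⊢
  rw [← hV, ← hE, ← hF, ← hc, hp]

section Subdivision

variable {Γ Γ' : KTG}

/-- `Subdivision` with its data made explicit and with the consequences that determine the rotation
and the edges of the larger graph completely. -/
structure IsSubdivision (Γ Γ' : KTG) (ι : Γ.Dart → Γ'.Dart) (x : Γ.Dart) (p q : Γ'.Dart) :
    Prop where
  injective : Function.Injective ι
  ne_p : ∀ d, ι d ≠ p
  ne_q : ∀ d, ι d ≠ q
  p_ne_q : p ≠ q
  cases : ∀ y, y = p ∨ y = q ∨ ∃ d, y = ι d
  flip_x : Γ'.flip (ι x) = p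
  flip_p : Γ'.flip p = ι x
  next_p : Γ'.next p = q
  next_q : Γ'.next q = p
  flip_q : Γ'.flip q = ι (Γ.flip x)
  flip_x' : Γ'.flip (ι (Γ.flip x)) = q
  flip_other : ∀ d, d ≠ x → d ≠ Γ.flip x → Γ'.flip (ι d) = ι (Γ.flip d)
  next_eq : ∀ d, Γ'.next (ι d) = ι (Γ.next d)
  color_eq : ∀ d, Γ'.color (ι d) = Γ.color d
  color_p : Γ'.color p = Γ.color x
  color_q : Γ'.color q = Γ.color x

theorem Subdivision.exists_isSubdivision (h : Subdivision Γ Γ') :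
    ∃ ι x p q, IsSubdivision Γ Γ' ι x p q := by
  obtain ⟨ι, x, p, q, hι, hr, h1, h2, h3, h4, h5, h6, h7⟩ := h
  refine ⟨ι, x, p, q, hι, fun d h => ((hr p).mp ⟨d, h⟩).1 rfl, fun d h => ((hr q).mp ⟨d, h⟩).2 rfl,
    fun h => Γ'.next_ne p (h2.trans h.symm), fun y => ?_, h1, by rw [← h1, Γ'.flip_flip], h2, h3, h4,
    by rw [← h4, Γ'.flip_flip], h5, h6, h7, by rw [← h1, Γ'.color_flip, h7],
    by rw [← Γ'.color_flip, h4, h7, Γ.color_flip]⟩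
  by_cases hy : y = p; · exact Or.inl hy
  by_cases hy' : y = q; · exact Or.inr (Or.inl hy')
  obtain ⟨d, hd⟩ := (hr y).mpr ⟨hy, hy'⟩
  exact Or.inr (Or.inr ⟨d, hd.symm⟩)

theorem IsSubdivision.subdivision {ι : Γ.Dart → Γ'.Dart} {x : Γ.Dart} {p q : Γ'.Dart}
    (h : IsSubdivision Γ Γ' ι x p q) : Subdivision Γ Γ' := by
  refine ⟨ι, x, p, q, h.injective, fun y => ⟨?_, fun hy => ?_⟩, h.flip_x, h.next_p, h.next_q,
    h.flip_q, h.flip_other, h.next_eq, h.color_eq⟩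
  · rintro ⟨d, rfl⟩; exact ⟨h.ne_p d, h.ne_q d⟩
  · rcases h.cases y with rfl | rfl | ⟨d, rfl⟩
    exacts [absurd rfl hy.1, absurd rfl hy.2, ⟨d, rfl⟩]

/-- A function on the darts of the larger graph may be prescribed on the old darts and on the two new
ones. -/
theorem IsSubdivision.exists_lift {ι : Γ.Dart → Γ'.Dart} {x : Γ.Dart} {p q : Γ'.Dart}
    (h : IsSubdivision Γ Γ' ι x p q) {X : Type} (F : Γ.Dart → X) (P Q : X) :
    ∃ f : Γ'.Dart → X, (∀ d, f (ι d) = F d) ∧ f p = P ∧ f q = Q := by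
  classical
  refine ⟨fun y => if y = p then P else if h : ∃ d, ι d = y then F h.choose else Q,
    fun d => ?_, by simp, ?_⟩
  · have hd : ∃ d', ι d' = ι d := ⟨d, rfl⟩
    simp only [h.ne_p, if_false, dif_pos hd]
    exact congrArg F (h.injective hd.choose_spec)
  · simp [h.p_ne_q.symm, h.ne_q]

theorem IsSubdivision.card_eq {ι : Γ.Dart → Γ'.Dart} {x : Γ.Dart} {p q : Γ'.Dart}
    (h : IsSubdivision Γ Γ' ι x p q) : Nat.card Γ'.Dart = Nat.card Γ.Dart + 2 := by
  have e : Function.Bijective (Sum.elim ι (fun b : Bool => if b then p else q)) := by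
    constructor
    · rintro (a | a) (b | b) hab
      · exact congrArg _ (h.injective hab)
      · cases b <;> simp [h.ne_p, h.ne_q] at hab
      · cases a <;> simp [(h.ne_p _).symm, (h.ne_q _).symm] at hab
      · cases a <;> cases b <;> simp [h.p_ne_q, h.p_ne_q.symm] at hab ⊢
    · intro y
      rcases h.cases y with rfl | rfl | ⟨d, rfl⟩
      exacts [⟨Sum.inr true, by simp⟩, ⟨Sum.inr false, by simp⟩, ⟨Sum.inl d, rfl⟩]
  rw [← Nat.card_congr (Equiv.ofBijective _ e), Nat.card_sum]
  simp

/-- Erasing the marked point maps components to components. -/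
theorem IsSubdivision.exists_comp_lift {ι : Γ.Dart → Γ'.Dart} {x : Γ.Dart} {p q : Γ'.Dart}
    (h : IsSubdivision Γ Γ' ι x p q) : ∃ f : Γ'.Dart → Γ.Dart, (∀ d, f (ι d) = d) ∧ f p = x ∧ f q = x ∧
      ∀ y z, comp Γ'.next Γ'.flip y = comp Γ'.next Γ'.flip z →
        comp Γ.next Γ.flip (f y) = comp Γ.next Γ.flip (f z) := by
  obtain ⟨-, -, -, -, hcase, h1, h1', h2, h3, h4, h4', h5, h6, -, -, -⟩ := id h
  obtain ⟨f, hf, hfp, hfq⟩ := h.exists_lift id x x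
  simp only [id] at hf
  have hl : ∀ u v, (Γ'.next u = v ∨ Γ'.flip u = v) →
      comp Γ.next Γ.flip (f u) = comp Γ.next Γ.flip (f v) := by
    rintro y _ (rfl | rfl)
    · rcases hcase y with rfl | rfl | ⟨d, rfl⟩
      · rw [h2, hfp, hfq]
      · rw [h3, hfp, hfq]
      · rw [h6, hf, hf, comp_left]
    · rcases hcase y with rfl | rfl | ⟨d, rfl⟩
      · rw [h1', hfp, hf]
      · rw [h4, hf, hfq, comp_right]
      · by_cases hd : d = x
        · rw [hd, h1, hf, hfp]
        by_cases hd' : d = Γ.flip x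
        · rw [hd', h4', hf, hfq, comp_right]
        rw [h5 d hd hd', hf, hf, comp_right]
  exact ⟨f, hf, hfp, hfq, fun y z hyz => congrArg (Quot.lift (fun u => comp Γ.next Γ.flip (f u)) hl) hyz⟩

theorem Subdivision.components_eq (h : Subdivision Γ Γ') : Γ'.components = Γ.components := by
  classical
  obtain ⟨ι, x, p, q, h⟩ := h.exists_isSubdivision
  obtain ⟨f, hf, hfp, hfq, hlift⟩ := h.exists_comp_lift
  have hpx : comp Γ'.next Γ'.flip p = comp Γ'.next Γ'.flip (ι x) := by
    rw [← h.flip_x, comp_right]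
  have hqx : comp Γ'.next Γ'.flip q = comp Γ'.next Γ'.flip (ι x) := by
    rw [← h.next_p, comp_left, hpx]
  refine componentCount_congr f ι (fun y => hlift _ _ (comp_left _ _ _))
    (fun y => hlift _ _ (comp_right _ _ _)) ?_ ?_ ?_ ?_
  · intro d; rw [← h.next_eq, comp_left]
  · intro d
    by_cases hd : d = x
    · rw [hd, ← h.flip_q, comp_right, hqx]
    by_cases hd' : d = Γ.flip x
    · rw [hd', Γ.flip_flip, ← h.flip_q, comp_right, hqx]
    rw [← h.flip_other d hd hd', comp_right]
  · intro y
    rcases h.cases y with rfl | rfl | ⟨d, rfl⟩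
    · rw [hfp, hpx]
    · rw [hfq, hqx]
    · rw [hf]
  · intro d; rw [hf]

/-- A marked point adds one vertex and one edge. -/
theorem Subdivision.planar_iff (h : Subdivision Γ Γ') : Γ'.Planar ↔ Γ.Planar := by
  have hC := h.components_eq
  obtain ⟨ι, x, p, q, h⟩ := h.exists_isSubdivision
  have hD := h.card_eq
  obtain ⟨-, -, -, -, hcase, h1, h1', h2, h3, h4, h4', h5, h6, -, -, -⟩ := id h
  have hE : orbitCount Γ'.flip = orbitCount Γ.flip + 1 := by
    have := Γ.two_mul_edges
    have := Γ'.two_mul_edges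
    omega
  have hV : orbitCount Γ'.next = orbitCount Γ.next + 1 := by
    have : Nat.card (Orbit Γ.next ⊕ Unit) = orbitCount Γ.next + 1 := by
      simp [Nat.card_sum, orbitCount]
    rw [← this]
    obtain ⟨f, hf, hfp, hfq⟩ := h.exists_lift (X := Orbit Γ.next ⊕ Unit) (fun d => Sum.inl (orb Γ.next d))
      (Sum.inr ()) (Sum.inr ())
    refine orbitCount_eq f (Sum.elim (Quot.lift (fun d => orb Γ'.next (ι d)) ?_)
      fun _ => orb Γ'.next p) ?_ ?_ ?_
    · rintro d _ rfl
      rw [← h6, orb_apply]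
    · intro y
      rcases hcase y with rfl | rfl | ⟨d, rfl⟩
      · rw [h2, hfp, hfq]
      · rw [h3, hfp, hfq]
      · rw [h6, hf, hf, orb_apply]
    · intro y
      rcases hcase y with rfl | rfl | ⟨d, rfl⟩
      · rw [hfp]; rfl
      · rw [hfq, ← h2, orb_apply]; rfl
      · rw [hf]; rfl
    · rintro (d | ⟨⟩)
      · rcases d with ⟨d⟩
        exact ⟨ι d, rfl, hf d⟩
      · exact ⟨p, rfl, hfp⟩
  have hF : orbitCount Γ'.face = orbitCount Γ.face := by
    obtain ⟨f, hf, hfp, hfq⟩ := h.exists_lift id (Γ.flip x) x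
    simp only [id] at hf
    have fx : Γ'.face (ι x) = q := by simp only [face, h1, h2]
    have fq : Γ'.face q = ι (Γ.face x) := by simp only [face, h4, h6]
    have fx' : Γ'.face (ι (Γ.flip x)) = p := by simp only [face, h4', h3]
    have fp : Γ'.face p = ι (Γ.face (Γ.flip x)) := by simp only [face, h1', h6, Γ.flip_flip]
    have fd : ∀ d, d ≠ x → d ≠ Γ.flip x → Γ'.face (ι d) = ι (Γ.face d) := by
      intro d hd hd'; simp only [face, h5 d hd hd', h6]
    refine orbitCount_congr f ι ?_ ?_ ?_ ?_
    · intro y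
      rcases hcase y with rfl | rfl | ⟨d, rfl⟩
      · rw [fp, hfp, hf, orb_apply]
      · rw [fq, hfq, hf, orb_apply]
      · by_cases hd : d = x
        · rw [hd, fx, hf, hfq]
        by_cases hd' : d = Γ.flip x
        · rw [hd', fx', hf, hfp]
        rw [fd d hd hd', hf, hf, orb_apply]
    · intro d
      by_cases hd : d = x
      · rw [hd, ← fq, orb_apply, ← fx, orb_apply]
      by_cases hd' : d = Γ.flip x
      · rw [hd', ← fp, orb_apply, ← fx', orb_apply]
      rw [← fd d hd hd', orb_apply]
    · intro y
      rcases hcase y with rfl | rfl | ⟨d, rfl⟩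
      · rw [hfp, ← fx', orb_apply]
      · rw [hfq, ← fx, orb_apply]
      · rw [hf]
    · intro d; rw [hf]
  rw [KTG.planar_iff, KTG.planar_iff, hC, hE, hV, hF]
  omega

end Subdivision

end KTG

namespace KTG

/-! ### The triangle move preserves planarity -/

/-- A function on the darts of the larger graph may be prescribed on the old darts and on the sides
of the triangle. -/
theorem IsTriangleMove.exists_lift {Γ Γ' : KTG} {ι : Γ.Dart → Γ'.Dart} {x : Γ.Dart}
    {s t : Fin 3 → Γ'.Dart} (h : IsTriangleMove Γ Γ' ι x s t) {X : Type} (F : Γ.Dart → X)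
    (S T : Fin 3 → X) : ∃ f : Γ'.Dart → X,
      (∀ d, f (ι d) = F d) ∧ (∀ i, f (s i) = S i) ∧ ∀ i, f (t i) = T i := by
  let e := Equiv.ofBijective _ h.2.1
  have he : ∀ z, e.symm (Sum.elim ι (Sum.elim s t) z) = z :=
    fun z => Equiv.ofBijective_symm_apply_apply _ h.2.1 z
  exact ⟨fun y => Sum.elim F (Sum.elim S T) (e.symm y), fun d => congrArg _ (he (Sum.inl d)),
    fun i => congrArg _ (he (Sum.inr (Sum.inl i))), fun i => congrArg _ (he (Sum.inr (Sum.inr i)))⟩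

theorem IsTriangleMove.cases {Γ Γ' : KTG} {ι : Γ.Dart → Γ'.Dart} {x : Γ.Dart}
    {s t : Fin 3 → Γ'.Dart} (h : IsTriangleMove Γ Γ' ι x s t) (y : Γ'.Dart) :
    (∃ d, y = ι d) ∨ y = s 0 ∨ y = s 1 ∨ y = s 2 ∨ y = t 0 ∨ y = t 1 ∨ y = t 2 := by
  obtain ⟨d | i | i, rfl⟩ := h.2.1.2 y
  · exact Or.inl ⟨d, rfl⟩
  · fin_cases i <;> simp
  · fin_cases i <;> simp

/-- The corners of a triangle move, one by one. -/
theorem IsTriangleMove.corners {Γ Γ' : KTG} {ι : Γ.Dart → Γ'.Dart} {x : Γ.Dart}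
    {s t : Fin 3 → Γ'.Dart} (h : IsTriangleMove Γ Γ' ι x s t) :
    (Γ'.next (ι x) = s 0 ∧ Γ'.next (s 0) = t 0 ∧ Γ'.next (t 0) = ι x ∧ Γ'.flip (s 0) = t 1) ∧
    (Γ'.next (ι (Γ.next x)) = s 1 ∧ Γ'.next (s 1) = t 1 ∧ Γ'.next (t 1) = ι (Γ.next x) ∧
      Γ'.flip (s 1) = t 2) ∧
    (Γ'.next (ι (Γ.next (Γ.next x))) = s 2 ∧ Γ'.next (s 2) = t 2 ∧
      Γ'.next (t 2) = ι (Γ.next (Γ.next x)) ∧ Γ'.flip (s 2) = t 0) :=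
  ⟨h.2.2.1 0, h.2.2.1 1, h.2.2.1 2⟩

theorem IsTriangleMove.next_other {Γ Γ' : KTG} {ι : Γ.Dart → Γ'.Dart} {x : Γ.Dart}
    {s t : Fin 3 → Γ'.Dart} (h : IsTriangleMove Γ Γ' ι x s t) (d : Γ.Dart) (h0 : d ≠ x)
    (h1 : d ≠ Γ.next x) (h2 : d ≠ Γ.next (Γ.next x)) : Γ'.next (ι d) = ι (Γ.next d) := by
  apply h.2.2.2.2.1
  intro i
  fin_cases i
  exacts [h0, h1, h2]

/-- A triangle move adds two vertices, three edges and one face. -/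
theorem IsTriangleMove.invariants {Γ Γ' : KTG} {ι : Γ.Dart → Γ'.Dart} {x : Γ.Dart}
    {s t : Fin 3 → Γ'.Dart} (h : IsTriangleMove Γ Γ' ι x s t) :
    Γ'.components = Γ.components ∧ (Γ'.Planar ↔ Γ.Planar) ∧
      Nat.card Γ'.Dart = Nat.card Γ.Dart + 6 := by
  classical
  obtain ⟨⟨a0, b0, c0, e0⟩, ⟨a1, b1, c1, e1⟩, ⟨a2, b2, c2, e2⟩⟩ := h.corners
  have hn' := h.next_other
  have hcase := h.cases
  obtain ⟨hx, hb, -, hfl, -, -⟩ := id h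
  have e0' : Γ'.flip (t 1) = s 0 := by rw [← e0, Γ'.flip_flip]
  have e1' : Γ'.flip (t 2) = s 1 := by rw [← e1, Γ'.flip_flip]
  have e2' : Γ'.flip (t 0) = s 2 := by rw [← e2, Γ'.flip_flip]
  have n01 : Γ.next x ≠ x := Γ.next_ne x
  have n12 : Γ.next (Γ.next x) ≠ Γ.next x := Γ.next_ne _
  have n02 : Γ.next (Γ.next x) ≠ x := by
    intro h
    apply Γ.next_ne x
    rw [h] at hx
    exact hx
  have hD : Nat.card Γ'.Dart = Nat.card Γ.Dart + 6 := by
    rw [← Nat.card_congr (Equiv.ofBijective _ hb), Nat.card_sum, Nat.card_sum]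
    simp
  have hE : orbitCount Γ'.flip = orbitCount Γ.flip + 3 := by
    have := Γ.two_mul_edges
    have := Γ'.two_mul_edges
    omega
  have hC : Γ'.components = Γ.components := by
    obtain ⟨f, hf, hs, ht⟩ := h.exists_lift id ![x, Γ.next x, Γ.next (Γ.next x)]
      ![x, Γ.next x, Γ.next (Γ.next x)]
    simp only [id] at hf
    have hs0 := hs 0
    have hs1 := hs 1
    have hs2 := hs 2
    have ht0 := ht 0
    have ht1 := ht 1
    have ht2 := ht 2
    simp only [Matrix.cons_val] at hs0 hs1 hs2 ht0 ht1 ht2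
    have k0 : comp Γ'.next Γ'.flip (s 0) = comp Γ'.next Γ'.flip (ι x) := by rw [← a0, comp_left]
    have k1 : comp Γ'.next Γ'.flip (s 1) = comp Γ'.next Γ'.flip (ι (Γ.next x)) := by
      rw [← a1, comp_left]
    have k2 : comp Γ'.next Γ'.flip (s 2) = comp Γ'.next Γ'.flip (ι (Γ.next (Γ.next x))) := by
      rw [← a2, comp_left]
    have l0 : comp Γ'.next Γ'.flip (t 0) = comp Γ'.next Γ'.flip (ι x) := by rw [← c0, comp_left]
    have l1 : comp Γ'.next Γ'.flip (t 1) = comp Γ'.next Γ'.flip (ι (Γ.next x)) := by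
      rw [← c1, comp_left]
    have l2 : comp Γ'.next Γ'.flip (t 2) = comp Γ'.next Γ'.flip (ι (Γ.next (Γ.next x))) := by
      rw [← c2, comp_left]
    have m0 : comp Γ'.next Γ'.flip (ι (Γ.next x)) = comp Γ'.next Γ'.flip (ι x) := by
      rw [← l1, ← k0, ← e0, comp_right]
    have m1 : comp Γ'.next Γ'.flip (ι (Γ.next (Γ.next x))) = comp Γ'.next Γ'.flip (ι (Γ.next x)) := by
      rw [← l2, ← k1, ← e1, comp_right]
    have r0 := comp_left Γ.next Γ.flip x
    have r1 := comp_left Γ.next Γ.flip (Γ.next x)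
    refine componentCount_congr f ι ?_ ?_ ?_ ?_ ?_ ?_
    · intro y
      rcases hcase y with ⟨d, rfl⟩ | rfl | rfl | rfl | rfl | rfl | rfl
      · by_cases h0 : d = x
        · rw [h0, a0, hf, hs0]
        by_cases h1 : d = Γ.next x
        · rw [h1, a1, hf, hs1]
        by_cases h2 : d = Γ.next (Γ.next x)
        · rw [h2, a2, hf, hs2]
        rw [hn' d h0 h1 h2, hf, hf, comp_left]
      all_goals simp only [b0, b1, b2, c0, c1, c2, hf, hs0, hs1, hs2, ht0, ht1, ht2]
    · intro y
      rcases hcase y with ⟨d, rfl⟩ | rfl | rfl | rfl | rfl | rfl | rfl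
      · rw [hfl, hf, hf, comp_right]
      all_goals simp only [e0, e1, e2, e0', e1', e2', hs0, hs1, hs2, ht0, ht1, ht2, r0, r1]
    · intro d
      by_cases h0 : d = x
      · rw [h0, m0]
      by_cases h1 : d = Γ.next x
      · rw [h1, m1]
      by_cases h2 : d = Γ.next (Γ.next x)
      · rw [h2, hx, m1, m0]
      rw [← hn' d h0 h1 h2, comp_left]
    · intro d
      rw [← hfl, comp_right]
    · intro y
      rcases hcase y with ⟨d, rfl⟩ | rfl | rfl | rfl | rfl | rfl | rfl
      · rw [hf]
      all_goals simp only [hs0, hs1, hs2, ht0, ht1, ht2, k0, k1, k2, l0, l1, l2]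
    · intro d; rw [hf]
  have hV : orbitCount Γ'.next = orbitCount Γ.next + 2 := by
    have : Nat.card (Orbit Γ.next ⊕ Bool) = orbitCount Γ.next + 2 := by
      simp [Nat.card_sum, orbitCount]
    rw [← this]
    obtain ⟨f, hf, hs, ht⟩ := h.exists_lift (X := Orbit Γ.next ⊕ Bool)
      (fun d => if d = Γ.next x then Sum.inr false else if d = Γ.next (Γ.next x) then Sum.inr true
        else Sum.inl (orb Γ.next d))
      ![Sum.inl (orb Γ.next x), Sum.inr false, Sum.inr true]
      ![Sum.inl (orb Γ.next x), Sum.inr false, Sum.inr true]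
    have hs0 := hs 0
    have hs1 := hs 1
    have hs2 := hs 2
    have ht0 := ht 0
    have ht1 := ht 1
    have ht2 := ht 2
    have hf0 := hf x
    have hf1 := hf (Γ.next x)
    have hf2 := hf (Γ.next (Γ.next x))
    simp only [Matrix.cons_val, n01.symm, n02.symm, n12, if_true, if_false]
      at hs0 hs1 hs2 ht0 ht1 ht2 hf0 hf1 hf2
    have hnd : ∀ d, d ≠ x → d ≠ Γ.next x → d ≠ Γ.next (Γ.next x) →
        Γ.next d ≠ x ∧ Γ.next d ≠ Γ.next x ∧ Γ.next d ≠ Γ.next (Γ.next x) := by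
      intro d h0 h1 h2
      refine ⟨fun h => h2 (Γ.next_injective (h.trans hx.symm)), fun h => h0 (Γ.next_injective h),
        fun h => h1 (Γ.next_injective h)⟩
    have k0 : orb Γ'.next (s 0) = orb Γ'.next (ι x) := by rw [← a0, orb_apply]
    have k1 : orb Γ'.next (s 1) = orb Γ'.next (ι (Γ.next x)) := by rw [← a1, orb_apply]
    have k2 : orb Γ'.next (s 2) = orb Γ'.next (ι (Γ.next (Γ.next x))) := by rw [← a2, orb_apply]
    have l0 : orb Γ'.next (t 0) = orb Γ'.next (ι x) := by rw [← c0, orb_apply]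
    have l1 : orb Γ'.next (t 1) = orb Γ'.next (ι (Γ.next x)) := by rw [← c1, orb_apply]
    have l2 : orb Γ'.next (t 2) = orb Γ'.next (ι (Γ.next (Γ.next x))) := by rw [← c2, orb_apply]
    -- the corner of `x` takes the place of the old vertex, the other two corners are new
    refine orbitCount_eq f (Sum.elim (Quot.lift (fun d => if d = Γ.next x then orb Γ'.next (ι x) else
        if d = Γ.next (Γ.next x) then orb Γ'.next (ι x) else orb Γ'.next (ι d)) ?_)
      fun b => if b then orb Γ'.next (s 2) else orb Γ'.next (s 1)) ?_ ?_ ?_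
    · rintro d _ rfl
      by_cases h0 : d = x
      · simp [h0, n01.symm, n02.symm]
      by_cases h1 : d = Γ.next x
      · simp [h1]
      by_cases h2 : d = Γ.next (Γ.next x)
      · simp [h2, hx, n12, n01.symm, n02.symm]
      obtain ⟨m0, m1, m2⟩ := hnd d h0 h1 h2
      simp only [h1, h2, m1, m2, if_false]
      rw [← hn' d h0 h1 h2, orb_apply]
    · intro y
      rcases hcase y with ⟨d, rfl⟩ | rfl | rfl | rfl | rfl | rfl | rfl
      · by_cases h0 : d = x
        · rw [h0, a0, hf0, hs0]
        by_cases h1 : d = Γ.next x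
        · rw [h1, a1, hf1, hs1]
        by_cases h2 : d = Γ.next (Γ.next x)
        · rw [h2, a2, hf2, hs2]
        obtain ⟨m0, m1, m2⟩ := hnd d h0 h1 h2
        rw [hn' d h0 h1 h2, hf, hf]
        simp only [h1, h2, m1, m2, if_false, orb_apply]
      all_goals simp only [b0, b1, b2, c0, c1, c2, hf0, hf1, hf2, hs0, hs1, hs2, ht0, ht1, ht2]
    · intro y
      rcases hcase y with ⟨d, rfl⟩ | rfl | rfl | rfl | rfl | rfl | rfl
      · by_cases h1 : d = Γ.next x
        · rw [h1, hf1]; simp [k1]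
        by_cases h2 : d = Γ.next (Γ.next x)
        · rw [h2, hf2]; simp [k2]
        rw [hf]
        simp [h1, h2]
      all_goals simp [hs0, hs1, hs2, ht0, ht1, ht2, n01.symm, n02.symm, k0, k1, k2, l0, l1, l2]
    · rintro (d | b)
      · rcases d with ⟨d⟩
        by_cases h1 : d = Γ.next x
        · refine ⟨ι x, by simp [h1], ?_⟩
          rw [hf0, h1, ← orb_apply]
        by_cases h2 : d = Γ.next (Γ.next x)
        · refine ⟨ι x, by simp [h2], ?_⟩
          rw [hf0, h2, ← orb_apply, ← orb_apply]
        refine ⟨ι d, by simp [h1, h2], ?_⟩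
        rw [hf]
        simp [h1, h2]
      · cases b
        · exact ⟨s 1, rfl, hs1⟩
        · exact ⟨s 2, rfl, hs2⟩
  have hF : orbitCount Γ'.face = orbitCount Γ.face + 1 := by
    have : Nat.card (Orbit Γ.face ⊕ Unit) = orbitCount Γ.face + 1 := by
      simp [Nat.card_sum, orbitCount]
    rw [← this]
    obtain ⟨f, hf, hs, ht⟩ := h.exists_lift (X := Orbit Γ.face ⊕ Unit)
      (fun d => Sum.inl (orb Γ.face d))
      ![Sum.inl (orb Γ.face (Γ.next x)), Sum.inl (orb Γ.face (Γ.next (Γ.next x))),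
        Sum.inl (orb Γ.face x)] ![Sum.inr (), Sum.inr (), Sum.inr ()]
    -- the darts `t i` run around the inside of the triangle, the darts `s i` along the outside
    have hs0 := hs 0
    have hs1 := hs 1
    have hs2 := hs 2
    have ht0 := ht 0
    have ht1 := ht 1
    have ht2 := ht 2
    simp only [Matrix.cons_val] at hs0 hs1 hs2 ht0 ht1 ht2
    have fs0 : Γ'.face (s 0) = ι (Γ.next x) := by simp only [face, e0, c1]
    have fs1 : Γ'.face (s 1) = ι (Γ.next (Γ.next x)) := by simp only [face, e1, c2]
    have fs2 : Γ'.face (s 2) = ι x := by simp only [face, e2, c0]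
    have ft0 : Γ'.face (t 0) = t 2 := by simp only [face, e2', b2]
    have ft1 : Γ'.face (t 1) = t 0 := by simp only [face, e0', b0]
    have ft2 : Γ'.face (t 2) = t 1 := by simp only [face, e1', b1]
    have g0 : ∀ d, Γ.flip d = x → Γ'.face (ι d) = s 0 ∧ Γ.face d = Γ.next x := by
      intro d h
      exact ⟨by simp only [face, hfl, h, a0], by simp only [face, h]⟩
    have g1 : ∀ d, Γ.flip d = Γ.next x → Γ'.face (ι d) = s 1 ∧ Γ.face d = Γ.next (Γ.next x) := by
      intro d h
      exact ⟨by simp only [face, hfl, h, a1], by simp only [face, h]⟩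
    have g2 : ∀ d, Γ.flip d = Γ.next (Γ.next x) → Γ'.face (ι d) = s 2 ∧ Γ.face d = x := by
      intro d h
      exact ⟨by simp only [face, hfl, h, a2], by simp only [face, h, hx]⟩
    have g3 : ∀ d, Γ.flip d ≠ x → Γ.flip d ≠ Γ.next x → Γ.flip d ≠ Γ.next (Γ.next x) →
        Γ'.face (ι d) = ι (Γ.face d) := by
      intro d h0 h1 h2
      simp only [face, hfl, hn' _ h0 h1 h2]
    refine orbitCount_eq f (Sum.elim (Quot.lift (fun d => orb Γ'.face (ι d)) ?_)
      fun _ => orb Γ'.face (t 0)) ?_ ?_ ?_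
    · rintro d _ rfl
      by_cases h0 : Γ.flip d = x
      · rw [(g0 d h0).2, ← fs0, orb_apply, ← (g0 d h0).1, orb_apply]
      by_cases h1 : Γ.flip d = Γ.next x
      · rw [(g1 d h1).2, ← fs1, orb_apply, ← (g1 d h1).1, orb_apply]
      by_cases h2 : Γ.flip d = Γ.next (Γ.next x)
      · rw [(g2 d h2).2, ← fs2, orb_apply, ← (g2 d h2).1, orb_apply]
      rw [← g3 d h0 h1 h2, orb_apply]
    · intro y
      rcases hcase y with ⟨d, rfl⟩ | rfl | rfl | rfl | rfl | rfl | rfl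
      · by_cases h0 : Γ.flip d = x
        · rw [(g0 d h0).1, hs0, hf, ← orb_apply _ d, (g0 d h0).2]
        by_cases h1 : Γ.flip d = Γ.next x
        · rw [(g1 d h1).1, hs1, hf, ← orb_apply _ d, (g1 d h1).2]
        by_cases h2 : Γ.flip d = Γ.next (Γ.next x)
        · rw [(g2 d h2).1, hs2, hf, ← orb_apply _ d, (g2 d h2).2]
        rw [g3 d h0 h1 h2, hf, hf, orb_apply]
      all_goals simp only [fs0, fs1, fs2, ft0, ft1, ft2, hf, hs0, hs1, hs2, ht0, ht1, ht2]
    · intro y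
      rcases hcase y with ⟨d, rfl⟩ | rfl | rfl | rfl | rfl | rfl | rfl
      · rw [hf]; rfl
      · rw [hs0]; simp only [Sum.elim_inl]; rw [← fs0, orb_apply]
      · rw [hs1]; simp only [Sum.elim_inl]; rw [← fs1, orb_apply]
      · rw [hs2]; simp only [Sum.elim_inl]; rw [← fs2, orb_apply]
      · rw [ht0]; rfl
      · rw [ht1]; simp only [Sum.elim_inr]; rw [← ft1, orb_apply]
      · rw [ht2]; simp only [Sum.elim_inr]; rw [← ft0, orb_apply]
    · rintro (d | ⟨⟩)
      · rcases d with ⟨d⟩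
        exact ⟨ι d, rfl, hf d⟩
      · exact ⟨t 0, rfl, ht0⟩
  refine ⟨hC, ?_, hD⟩
  rw [KTG.planar_iff, KTG.planar_iff, hC, hE, hV, hF]
  omega

end KTG

namespace KTG

/-! ### Placing and removing marked points, blowing up and contracting -/

open Classical in
/-- Place a marked point on the edge of `x`: its dart `Sum.inr false` faces `x`, and its dart
`Sum.inr true` faces the dart that was opposite to `x`. -/
noncomputable def subdivide (Γ : KTG) (x : Γ.Dart) : KTG where
  Dart := Γ.Dart ⊕ Bool
  finite_dart := inferInstance
  next
    | Sum.inl d => Sum.inl (Γ.next d)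
    | Sum.inr b => Sum.inr !b
  flip
    | Sum.inl d => if d = x then Sum.inr false else if d = Γ.flip x then Sum.inr true
        else Sum.inl (Γ.flip d)
    | Sum.inr b => Sum.inl (if b then Γ.flip x else x)
  color
    | Sum.inl d => Γ.color d
    | Sum.inr _ => Γ.color x
  flip_flip := by
    have h1 := Γ.flip_ne
    have h2 := Γ.flip_flip
    rintro (d | b)
    · grind
    · cases b <;> grind
  flip_ne := by
    have h1 := Γ.flip_ne
    rintro (d | b)
    · grind
    · simp
  next_ne := by
    rintro (d | b)
    · simpa using Γ.next_ne d
    · simp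
  valence := by
    rintro (d | b)
    · simpa using Γ.valence d
    · simp
  color_flip := by
    have h1 := Γ.color_flip
    rintro (d | b)
    · grind
    · cases b <;> simp [h1]
  color_bivalent := by
    rintro (d | b) h
    · exact Γ.color_bivalent d (Sum.inl.inj h)
    · rfl
  admissible := by
    rintro (d | b) h
    · exact Γ.admissible d (Sum.inl.inj h)
    · simp at h

theorem exists_isSubdivision (Γ : KTG) (x : Γ.Dart) :
    ∃ (Γ' : KTG) (ι : Γ.Dart → Γ'.Dart) (p q : Γ'.Dart), IsSubdivision Γ Γ' ι x p q := by
  have hf := Γ.flip_flip x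
  have hf' := Γ.flip_ne x
  refine ⟨Γ.subdivide x, Sum.inl, Sum.inr false, Sum.inr true, Sum.inl_injective,
    fun _ => Sum.inl_ne_inr, fun _ => Sum.inl_ne_inr, fun h => by simpa using Sum.inr_injective h,
    ?_, by simp [subdivide], rfl, rfl, rfl, rfl, by simp [subdivide, hf'], ?_, fun _ => rfl, fun _ => rfl,
    rfl, rfl⟩
  · rintro (d | b)
    · exact Or.inr (Or.inr ⟨d, rfl⟩)
    · cases b
      exacts [Or.inl rfl, Or.inr (Or.inl rfl)]
  · intro d h1 h2
    simp [subdivide, h1, h2]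

/-- A marked point that is not the only one on a circle can be removed. -/
theorem exists_subdivision (Γ : KTG) (p : Γ.Dart) (hp : Γ.next (Γ.next p) = p)
    (hne : Γ.flip p ≠ Γ.next p) : ∃ Γ₀ : KTG, Subdivision Γ₀ Γ ∧
      (∀ d, ∃ d', Γ₀.color d = Γ.color d') ∧ Nat.card Γ₀.Dart < Nat.card Γ.Dart := by
  classical
  have h1 := Γ.flip_ne
  have h2 := Γ.flip_flip
  have h3 := Γ.next_ne
  have h4 := Γ.next_injective
  have h5 := Γ.color_flip
  have h6 := Γ.color_bivalent
  set q := Γ.next p with hq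
  have hpq : q ≠ p := h3 p
  have hfq : Γ.flip q ≠ p := fun h => hne (by rw [← h, h2])
  have hn : ∀ d, d ≠ p ∧ d ≠ q → Γ.next d ≠ p ∧ Γ.next d ≠ q := by
    rintro d ⟨hd, hd'⟩
    exact ⟨fun h => hd' (h4 (h.trans hp.symm)), fun h => hd (h4 h)⟩
  -- the two edges that meet at the marked point become one
  let fl : Γ.Dart → Γ.Dart := fun d =>
    if Γ.flip d = p then Γ.flip q else if Γ.flip d = q then Γ.flip p else Γ.flip d
  have hfl : ∀ d, d ≠ p ∧ d ≠ q → fl d ≠ p ∧ fl d ≠ q := by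
    rintro d ⟨hd, hd'⟩
    simp only [fl]
    split_ifs with h h'
    · exact ⟨hfq, h1 q⟩
    · exact ⟨h1 p, hne⟩
    · exact ⟨h, h'⟩
  let Γ₀ : KTG :=
    { Dart := {d // d ≠ p ∧ d ≠ q}
      finite_dart := inferInstance
      next := fun d => ⟨Γ.next d.1, hn d.1 d.2⟩
      flip := fun d => ⟨fl d.1, hfl d.1 d.2⟩
      color := fun d => Γ.color d.1
      flip_flip := by
        rintro ⟨d, hd, hd'⟩
        apply Subtype.ext
        simp only [fl]
        grind
      flip_ne := by
        rintro ⟨d, hd, hd'⟩ h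
        have := congrArg Subtype.val h
        simp only [fl] at this
        grind
      next_ne := fun d h => h3 d.1 (congrArg Subtype.val h)
      valence := by
        rintro ⟨d, hd⟩
        rcases Γ.valence d with h | h
        · exact Or.inl (Subtype.ext h)
        · exact Or.inr (Subtype.ext h)
      color_flip := by
        rintro ⟨d, hd, hd'⟩
        have h7 := h6 p hp
        have h8 := h5 p
        have h9 := h5 q
        have h10 := h5 d
        simp only [fl]
        split_ifs with h h'
        · rw [h] at h10; rw [h9, h7, h10]
        · rw [h'] at h10; rw [h8, ← h7, h10]
        · exact h10
      color_bivalent := fun d hd => h6 d.1 (congrArg Subtype.val hd)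
      admissible := fun d hd => Γ.admissible d.1 (congrArg Subtype.val hd) }
  refine ⟨Γ₀, ⟨Subtype.val, ⟨Γ.flip p, h1 p, hne⟩, p, q, Subtype.val_injective, ?_, ?_, rfl, hp, ?_,
    ?_, fun _ => rfl, fun _ => rfl⟩, fun d => ⟨d.1, rfl⟩, ?_⟩
  · intro y
    exact ⟨by rintro ⟨d, rfl⟩; exact d.2, fun h => ⟨⟨y, h⟩, rfl⟩⟩
  · exact h2 p
  · simp only [Γ₀, fl, h2, if_true]
  · rintro ⟨d, hd, hd'⟩ hx hx'
    simp only [Γ₀, fl, h2, if_true, ne_eq, Subtype.mk.injEq] at hx hx' ⊢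
    have e1 : Γ.flip d ≠ p := fun h => hx (by rw [← h, h2])
    have e2 : Γ.flip d ≠ q := fun h => hx' (by rw [← h, h2])
    simp [e1, e2]
  · exact Finite.card_subtype_lt (x := p) (by simp)

/-- A triangular face whose three corners are distinct can be contracted to a vertex; `t i` is the dart
of the face at the corner `i`, and `next (t i)` the dart that leaves the triangle there. -/
theorem exists_triangleMove (Γ : KTG) (t : Fin 3 → Γ.Dart) (ht : Function.Injective t)
    (hcub : ∀ d, Γ.next (Γ.next (Γ.next d)) = d)
    (hface : ∀ i, Γ.face (t (i + 1)) = t i) (hflip : ∀ i j, Γ.flip (t i) ≠ t j)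
    (hadm : ∀ i, AdmissibleTriple (Γ.color (Γ.next (t i))) (Γ.color (Γ.next (t (i + 1))))
      (Γ.color (Γ.next (t (i + 2))))) :
    ∃ (Γ₀ : KTG) (ι : Γ₀.Dart → Γ.Dart) (x : Γ₀.Dart) (s : Fin 3 → Γ.Dart),
      IsTriangleMove Γ₀ Γ ι x s t ∧ ∀ d, Γ₀.next (Γ₀.next (Γ₀.next d)) = d := by
  classical
  have h1 := Γ.flip_ne
  have h2 := Γ.flip_flip
  have h3 := Γ.next_ne
  have h4 := Γ.next_injective
  have h5 := Γ.color_flip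
  have hsum : ∀ i : Fin 3, i + 2 + 1 = i := by decide
  let s : Fin 3 → Γ.Dart := fun i => Γ.flip (t (i + 1))
  let o : Fin 3 → Γ.Dart := fun i => Γ.next (t i)
  have hs : Function.Injective s := fun i j h => by
    simpa using ht (Γ.flip_injective h)
  have ho : Function.Injective o := fun i j h => ht (h4 h)
  have hst : ∀ i j, s i ≠ t j := fun i j => hflip (i + 1) j
  have nst : ∀ i, Γ.next (s i) = t i := hface
  have nto : ∀ i, Γ.next (t i) = o i := fun i => rfl
  have nos : ∀ i, Γ.next (o i) = s i := fun i => by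
    rw [← nto, ← nst, hcub]
  have hot : ∀ i j, o i ≠ t j := fun i j h => by
    rw [← nto, ← nst j] at h
    exact hst _ _ (h4 h).symm
  have hos : ∀ i j, o i ≠ s j := fun i j h => by
    rw [← nos j, ← nto i] at h
    exact hot _ _ (h4 h).symm
  have fst : ∀ i, Γ.flip (s i) = t (i + 1) := fun i => h2 _
  have fts : ∀ i, Γ.flip (t i) = s (i + 2) := fun i => by
    rw [← hsum i, ← fst, h2, hsum]
  let P : Γ.Dart → Prop := fun d => (∀ i, d ≠ s i) ∧ ∀ i, d ≠ t i
  let nx : Γ.Dart → Γ.Dart := fun d => if d = o 0 then o 1 else if d = o 1 then o 2 else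
    if d = o 2 then o 0 else Γ.next d
  have o01 : o 0 ≠ o 1 := fun h => by simpa using ho h
  have o12 : o 1 ≠ o 2 := fun h => by simpa using ho h
  have o02 : o 0 ≠ o 2 := fun h => by simpa using ho h
  have nx0 : nx (o 0) = o 1 := by simp [nx]
  have nx1 : nx (o 1) = o 2 := by simp [nx, o01.symm]
  have nx2 : nx (o 2) = o 0 := by simp [nx, o02.symm, o12.symm]
  have nxd : ∀ d, (∀ i, d ≠ o i) → nx d = Γ.next d := fun d hd => by simp [nx, hd]
  have hPo : ∀ i, P (o i) := fun i => ⟨hos i, hot i⟩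
  have hfin : ∀ d, (d = o 0 ∨ d = o 1 ∨ d = o 2) ∨ ∀ i, d ≠ o i := by
    intro d
    by_cases h : ∀ i, d ≠ o i
    · exact Or.inr h
    · push Not at h
      obtain ⟨i, rfl⟩ := h
      left
      fin_cases i <;> simp
  have hPn : ∀ d, P d → (∀ i, d ≠ o i) → P (Γ.next d) ∧ ∀ i, Γ.next d ≠ o i := by
    intro d hd hdo
    refine ⟨⟨fun i h => ?_, fun i h => ?_⟩, fun i h => ?_⟩
    · rw [← nos] at h; exact hdo _ (h4 h)
    · rw [← nst] at h; exact hd.1 _ (h4 h)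
    · exact hd.2 _ (h4 h)
  have hPnx : ∀ d, P d → P (nx d) := by
    intro d hd
    rcases hfin d with (rfl | rfl | rfl) | hdo
    · rw [nx0]; exact hPo _
    · rw [nx1]; exact hPo _
    · rw [nx2]; exact hPo _
    · rw [nxd d hdo]; exact (hPn d hd hdo).1
  have hPf : ∀ d, P d → P (Γ.flip d) := by
    intro d hd
    refine ⟨fun i h => ?_, fun i h => ?_⟩
    · apply hd.2 (i + 1); rw [← fst, ← h, h2]
    · apply hd.1 (i + 2); rw [← fts, ← h, h2]
  have hcub' : ∀ d, P d → nx (nx (nx d)) = d := by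
    intro d hd
    rcases hfin d with (rfl | rfl | rfl) | hdo
    · rw [nx0, nx1, nx2]
    · rw [nx1, nx2, nx0]
    · rw [nx2, nx0, nx1]
    · obtain ⟨p1, o1⟩ := hPn d hd hdo
      obtain ⟨p2, o2⟩ := hPn _ p1 o1
      rw [nxd d hdo, nxd _ o1, nxd _ o2, hcub]
  have hne' : ∀ d, nx d ≠ d := by
    intro d
    rcases hfin d with (rfl | rfl | rfl) | hdo
    · rw [nx0]; exact o01.symm
    · rw [nx1]; exact o12.symm
    · rw [nx2]; exact o02
    · rw [nxd d hdo]; exact h3 d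
  let Γ₀ : KTG :=
    { Dart := {d // P d}
      finite_dart := inferInstance
      next := fun d => ⟨nx d.1, hPnx d.1 d.2⟩
      flip := fun d => ⟨Γ.flip d.1, hPf d.1 d.2⟩
      color := fun d => Γ.color d.1
      flip_flip := fun d => Subtype.ext (h2 d.1)
      flip_ne := fun d h => h1 d.1 (congrArg Subtype.val h)
      next_ne := fun d h => hne' d.1 (congrArg Subtype.val h)
      valence := fun d => Or.inr (Subtype.ext (hcub' d.1 d.2))
      color_flip := fun d => h5 d.1
      color_bivalent := by
        rintro ⟨d, hd⟩ h
        have e : nx (nx d) = d := congrArg Subtype.val h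
        have e' := hcub' d hd
        rw [e] at e'
        exact absurd e' (hne' d)
      admissible := by
        rintro ⟨d, hd⟩ -
        show AdmissibleTriple (Γ.color d) (Γ.color (nx d)) (Γ.color (nx (nx d)))
        rcases hfin d with (rfl | rfl | rfl) | hdo
        · rw [nx0, nx1]; exact hadm 0
        · rw [nx1, nx2]; exact hadm 1
        · rw [nx2, nx0]; exact hadm 2
        · obtain ⟨p1, o1⟩ := hPn d hd hdo
          rw [nxd d hdo, nxd _ o1]
          exact Γ.admissible d (hcub d) }
  have hiter : ∀ i : Fin 3, ((Γ₀.next^[(i : ℕ)] ⟨o 0, hPo 0⟩ : Γ₀.Dart) : {d // P d}).1 = o i := by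
    intro i
    fin_cases i
    · rfl
    · exact nx0
    · show nx (nx (o 0)) = o 2
      rw [nx0, nx1]
  refine ⟨Γ₀, Subtype.val, ⟨o 0, hPo 0⟩, s, ⟨Subtype.ext (hcub' _ (hPo 0)), ⟨?_, ?_⟩, ?_, fun _ => rfl, ?_,
    fun _ => rfl⟩, fun d => Subtype.ext (hcub' d.1 d.2)⟩
  · rintro (⟨d, hd⟩ | i | i) (⟨d', hd'⟩ | j | j) h
    · simp only [Sum.elim_inl] at h; simp only [h]
    · exact absurd h (hd.1 j)
    · exact absurd h (hd.2 j)
    · exact absurd h.symm (hd'.1 i)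
    · exact congrArg (Sum.inr ∘ Sum.inl) (hs h)
    · exact absurd h (hst i j)
    · exact absurd h.symm (hd'.2 i)
    · exact absurd h.symm (hst j i)
    · exact congrArg (Sum.inr ∘ Sum.inr) (ht h)
  · intro d
    by_cases hd : ∃ i, s i = d
    · obtain ⟨i, rfl⟩ := hd; exact ⟨Sum.inr (Sum.inl i), rfl⟩
    by_cases hd' : ∃ i, t i = d
    · obtain ⟨i, rfl⟩ := hd'; exact ⟨Sum.inr (Sum.inr i), rfl⟩
    push Not at hd hd'
    exact ⟨Sum.inl ⟨d, fun i h => hd i h.symm, fun i h => hd' i h.symm⟩, rfl⟩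
  · intro i
    rw [hiter i]
    exact ⟨nos i, nst i, nto i, fst i⟩
  · rintro ⟨d, hd⟩ h
    refine (nxd d fun i hi => h i (Subtype.ext ?_)).symm
    rw [hiter]
    exact hi

/-- Blow up a trivalent vertex to a triangle.  The new edge from the corner `i` to the corner
`i + 1` is colored `c i`; the three conditions at a corner are cyclic permutations of each other. -/
noncomputable def blowUp (Γ : KTG) (x : Γ.Dart) (hx : Γ.next (Γ.next (Γ.next x)) = x)
    (c : Fin 3 → ℕ)
    (hc : ∀ i : Fin 3, AdmissibleTriple (Γ.color (Γ.next^[(i : ℕ)] x)) (c i) (c (i + 2)) ∧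
      AdmissibleTriple (c i) (c (i + 2)) (Γ.color (Γ.next^[(i : ℕ)] x)) ∧
      AdmissibleTriple (c (i + 2)) (Γ.color (Γ.next^[(i : ℕ)] x)) (c i)) : KTG := by
  classical
  have n01 : Γ.next x ≠ x := Γ.next_ne x
  have n12 : Γ.next (Γ.next x) ≠ Γ.next x := Γ.next_ne _
  have n02 : Γ.next (Γ.next x) ≠ x := fun h => n01 (by rwa [h] at hx)
  exact
  { Dart := Γ.Dart ⊕ (Fin 3 ⊕ Fin 3)
    finite_dart := inferInstance
    next := fun y => match y with
      | Sum.inl d => if d = x then Sum.inr (Sum.inl 0) else if d = Γ.next x then Sum.inr (Sum.inl 1)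
          else if d = Γ.next (Γ.next x) then Sum.inr (Sum.inl 2) else Sum.inl (Γ.next d)
      | Sum.inr (Sum.inl i) => Sum.inr (Sum.inr i)
      | Sum.inr (Sum.inr i) => Sum.inl (Γ.next^[(i : ℕ)] x)
    flip := fun y => match y with
      | Sum.inl d => Sum.inl (Γ.flip d)
      | Sum.inr (Sum.inl i) => Sum.inr (Sum.inr (i + 1))
      | Sum.inr (Sum.inr i) => Sum.inr (Sum.inl (i + 2))
    color := fun y => match y with
      | Sum.inl d => Γ.color d
      | Sum.inr (Sum.inl i) => c i
      | Sum.inr (Sum.inr i) => c (i + 2)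
    flip_flip := by
      rintro (d | i | i)
      · simp [Γ.flip_flip]
      · fin_cases i <;> rfl
      · fin_cases i <;> rfl
    flip_ne := by
      rintro (d | i | i)
      · simpa using Γ.flip_ne d
      · simp
      · simp
    next_ne := by
      rintro (d | i | i)
      · have := Γ.next_ne d
        simp only
        split_ifs <;> simp [this]
      · simp
      · simp
    valence := by
      rintro (d | i | i)
      · by_cases h0 : d = x
        · simp [h0]
        by_cases h1 : d = Γ.next x
        · simp [h1, n01]
        by_cases h2 : d = Γ.next (Γ.next x)
        · simp [h2, n02, n12]
        have := Γ.valence d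
        have m0 : Γ.next d ≠ x := fun h => h2 (Γ.next_injective (h.trans hx.symm))
        have m1 : Γ.next d ≠ Γ.next x := fun h => h0 (Γ.next_injective h)
        have m2 : Γ.next d ≠ Γ.next (Γ.next x) := fun h => h1 (Γ.next_injective h)
        have k0 : Γ.next (Γ.next d) ≠ x := fun h => m2 (Γ.next_injective (h.trans hx.symm))
        have k1 : Γ.next (Γ.next d) ≠ Γ.next x := fun h => m0 (Γ.next_injective h)
        have k2 : Γ.next (Γ.next d) ≠ Γ.next (Γ.next x) := fun h => m1 (Γ.next_injective h)
        simpa [h0, h1, h2, m0, m1, m2, k0, k1, k2] using this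
      · right; fin_cases i <;> simp [n01, n02, n12]
      · right; fin_cases i <;> simp [n01, n02, n12]
    color_flip := by
      rintro (d | i | i)
      · exact Γ.color_flip d
      · fin_cases i <;> rfl
      · rfl
    color_bivalent := by
      rintro (d | i | i) h
      · by_cases h0 : d = x
        · simp [h0] at h
        by_cases h1 : d = Γ.next x
        · simp [h1, n01] at h
        by_cases h2 : d = Γ.next (Γ.next x)
        · simp [h2, n02, n12] at h
        have m0 : Γ.next d ≠ x := fun h => h2 (Γ.next_injective (h.trans hx.symm))
        have m1 : Γ.next d ≠ Γ.next x := fun h => h0 (Γ.next_injective h)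
        have m2 : Γ.next d ≠ Γ.next (Γ.next x) := fun h => h1 (Γ.next_injective h)
        simp only [h0, h1, h2, m0, m1, m2, if_false, Sum.inl.injEq] at h ⊢
        exact Γ.color_bivalent d h
      · simp at h
      · fin_cases i <;> simp [n01, n02, n12] at h
    admissible := by
      have H0 := hc 0
      have H1 := hc 1
      have H2 := hc 2
      simp only [Fin.isValue, Fin.val_zero, Fin.val_one, Fin.val_two, Function.iterate_zero, id,
        Function.iterate_succ, Function.comp, show (0 : Fin 3) + 2 = 2 from rfl,
        show (1 : Fin 3) + 2 = 0 from rfl, show (2 : Fin 3) + 2 = 1 from rfl] at H0 H1 H2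
      rintro (d | i | i) h
      · by_cases h0 : d = x
        · simpa [h0] using H0.1
        by_cases h1 : d = Γ.next x
        · simpa [h1, n01] using H1.1
        by_cases h2 : d = Γ.next (Γ.next x)
        · simpa [h2, n02, n12] using H2.1
        have m0 : Γ.next d ≠ x := fun h => h2 (Γ.next_injective (h.trans hx.symm))
        have m1 : Γ.next d ≠ Γ.next x := fun h => h0 (Γ.next_injective h)
        have m2 : Γ.next d ≠ Γ.next (Γ.next x) := fun h => h1 (Γ.next_injective h)
        have k0 : Γ.next (Γ.next d) ≠ x := fun h => m2 (Γ.next_injective (h.trans hx.symm))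
        have k1 : Γ.next (Γ.next d) ≠ Γ.next x := fun h => m0 (Γ.next_injective h)
        have k2 : Γ.next (Γ.next d) ≠ Γ.next (Γ.next x) := fun h => m1 (Γ.next_injective h)
        simp only [h0, h1, h2, m0, m1, m2, k0, k1, k2, if_false, Sum.inl.injEq] at h ⊢
        exact Γ.admissible d h
      · exact (hc i).2.1
      · fin_cases i
        · simpa [n01, n02, n12] using H0.2.2
        · simpa [n01, n02, n12] using H1.2.2
        · simpa [n01, n02, n12] using H2.2.2 }

theorem isTriangleMove_blowUp (Γ : KTG) (x : Γ.Dart) (hx : Γ.next (Γ.next (Γ.next x)) = x)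
    (c : Fin 3 → ℕ) (hc) : IsTriangleMove Γ (Γ.blowUp x hx c hc) Sum.inl x
      (fun i => Sum.inr (Sum.inl i)) (fun i => Sum.inr (Sum.inr i)) := by
  have n01 : Γ.next x ≠ x := Γ.next_ne x
  have n12 : Γ.next (Γ.next x) ≠ Γ.next x := Γ.next_ne _
  have n02 : Γ.next (Γ.next x) ≠ x := fun h => n01 (by rwa [h] at hx)
  have key : ∀ z : Γ.Dart ⊕ (Fin 3 ⊕ Fin 3), (Sum.elim Sum.inl (Sum.elim
      (fun i => Sum.inr (Sum.inl i)) (fun i => Sum.inr (Sum.inr i))) :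
        Γ.Dart ⊕ (Fin 3 ⊕ Fin 3) → Γ.Dart ⊕ (Fin 3 ⊕ Fin 3)) z = z := by
    rintro (a | a | a) <;> rfl
  refine ⟨hx, ⟨fun a b h => (key a).symm.trans (h.trans (key b)), fun z => ⟨z, key z⟩⟩, ?_,
    fun _ => rfl, ?_, fun _ => rfl⟩
  · intro i
    refine ⟨?_, rfl, rfl, rfl⟩
    fin_cases i <;> simp [blowUp, n01, n02, n12]
  · intro d h
    have h0 := h 0
    have h1 := h 1
    have h2 := h 2
    simp at h0 h1 h2
    simp [blowUp, h0, h1, h2]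

theorem exists_isTriangleMove (Γ : KTG) (x : Γ.Dart) (hx : Γ.next (Γ.next (Γ.next x)) = x)
    (c : Fin 3 → ℕ)
    (hc : ∀ i : Fin 3, AdmissibleTriple (Γ.color (Γ.next^[(i : ℕ)] x)) (c i) (c (i + 2)) ∧
      AdmissibleTriple (c i) (c (i + 2)) (Γ.color (Γ.next^[(i : ℕ)] x)) ∧
      AdmissibleTriple (c (i + 2)) (Γ.color (Γ.next^[(i : ℕ)] x)) (c i)) :
    ∃ (Γ' : KTG) (ι : Γ.Dart → Γ'.Dart) (s t : Fin 3 → Γ'.Dart),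
      IsTriangleMove Γ Γ' ι x s t ∧ ∀ i, Γ'.color (s i) = c i :=
  ⟨_, _, _, _, Γ.isTriangleMove_blowUp x hx c hc, fun _ => rfl⟩

end KTG

/-! ### The Whitehead move -/

theorem AdmissibleTriple.rotate {a b c : ℕ} (h : AdmissibleTriple a b c) :
    AdmissibleTriple b c a := by
  obtain ⟨h1, h2, h3, h4⟩ := h
  refine ⟨by rwa [show b + c + a = a + b + c by ring], by omega, by omega, by omega⟩

theorem AdmissibleTriple.swap {a b c : ℕ} (h : AdmissibleTriple a b c) :
    AdmissibleTriple a c b := by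
  obtain ⟨h1, h2, h3, h4⟩ := h
  refine ⟨by rwa [show a + c + b = a + b + c by ring], by omega, by omega, by omega⟩

namespace KTG

/-- Every vertex is trivalent. -/
def Cubic (Γ : KTG) : Prop := ∀ d, Γ.next (Γ.next (Γ.next d)) = d

/-- The Whitehead move on the edge of `x`: an edge joining two distinct trivalent vertices with the
further darts `e = next x`, `g = next e` at one end and `h = next (flip x)`, `k = next h` at the
other is turned by a quarter, so that its ends meet `k`, `e` and `g`, `h`.  The darts of the two
graphs are matched by `w`. -/
structure IsWhitehead (Γ Γ' : KTG) (w : Γ.Dart ≃ Γ'.Dart) (x : Γ.Dart) : Prop where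
  nonloop : Γ.flip x ≠ Γ.next x
  nonloop' : Γ.flip x ≠ Γ.next (Γ.next x)
  flip_eq : ∀ d, Γ'.flip (w d) = w (Γ.flip d)
  next_x : Γ'.next (w x) = w (Γ.next (Γ.next (Γ.flip x)))
  next_k : Γ'.next (w (Γ.next (Γ.next (Γ.flip x)))) = w (Γ.next x)
  next_e : Γ'.next (w (Γ.next x)) = w x
  next_x' : Γ'.next (w (Γ.flip x)) = w (Γ.next (Γ.next x))
  next_g : Γ'.next (w (Γ.next (Γ.next x))) = w (Γ.next (Γ.flip x))
  next_h : Γ'.next (w (Γ.next (Γ.flip x))) = w (Γ.flip x)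
  next_other : ∀ d, d ≠ x → d ≠ Γ.next x → d ≠ Γ.next (Γ.next x) → d ≠ Γ.flip x →
    d ≠ Γ.next (Γ.flip x) → d ≠ Γ.next (Γ.next (Γ.flip x)) → Γ'.next (w d) = w (Γ.next d)
  color_eq : ∀ d, d ≠ x → d ≠ Γ.flip x → Γ'.color (w d) = Γ.color d

/-- The six darts at the ends of an edge with distinct ends are distinct. -/
theorem Cubic.six_darts {Γ : KTG} (hc : Γ.Cubic) {x : Γ.Dart} (h1 : Γ.flip x ≠ Γ.next x)
    (h2 : Γ.flip x ≠ Γ.next (Γ.next x)) :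
    [x, Γ.next x, Γ.next (Γ.next x), Γ.flip x, Γ.next (Γ.flip x),
      Γ.next (Γ.next (Γ.flip x))].Nodup := by
  have hi := Γ.next_injective
  have a1 := Γ.next_ne x
  have a2 := Γ.next_ne (Γ.next x)
  have a3 := Γ.flip_ne x
  have a4 := hc x
  have a5 := hc (Γ.flip x)
  have a6 := Γ.next_ne (Γ.flip x)
  have a7 := Γ.next_ne (Γ.next (Γ.flip x))
  have hi' : ∀ {a b}, Γ.next a = Γ.next b → a = b := fun h => hi h
  simp only [List.nodup_cons, List.mem_cons, List.not_mem_nil, or_false, not_or, not_false_eq_true,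
    List.nodup_nil, and_true]
  refine ⟨⟨a1.symm, ?_, a3.symm, ?_, ?_⟩, ⟨a2.symm, h1.symm, ?_, ?_⟩, ⟨h2.symm, ?_, ?_⟩,
    ⟨a6.symm, ?_⟩, a7.symm⟩
  · intro h; apply a1; rw [← h] at a4; exact a4
  · intro h; apply h2; apply hi'; rw [← h, a4]
  · intro h; apply h1; apply hi'; apply hi'; rw [← h, a4]
  · intro h; exact a3 (hi' h).symm
  · intro h; exact h2 (by rw [h, a5])
  · intro h; exact h1 (hi' h).symm
  · intro h; exact a3 (hi' (hi' h)).symm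
  · intro h; rw [← h] at a5; exact a6 a5

open Classical in
/-- The Whitehead move on an edge with distinct ends exists; `c` is the color of the turned edge. -/
theorem exists_isWhitehead {Γ : KTG} (hc : Γ.Cubic) {x : Γ.Dart} (h1 : Γ.flip x ≠ Γ.next x)
    (h2 : Γ.flip x ≠ Γ.next (Γ.next x)) (c : ℕ)
    (ha : AdmissibleTriple c (Γ.color (Γ.next x)) (Γ.color (Γ.next (Γ.next (Γ.flip x)))))
    (hb : AdmissibleTriple c (Γ.color (Γ.next (Γ.next x))) (Γ.color (Γ.next (Γ.flip x)))) :
    ∃ (Γ' : KTG) (w : Γ.Dart ≃ Γ'.Dart), IsWhitehead Γ Γ' w x ∧ Γ'.Cubic ∧ Γ'.color (w x) = c := by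
  have six := hc.six_darts h1 h2
  have hi := Γ.next_injective
  have hx' := hc (Γ.flip x)
  have hx := hc x
  generalize he : Γ.next x = e at *
  generalize hg : Γ.next e = g at *
  generalize hy : Γ.flip x = y at *
  generalize hh : Γ.next y = h at *
  generalize hk : Γ.next h = k at *
  simp only [List.nodup_cons, List.mem_cons, List.not_mem_nil, or_false, not_or, not_false_eq_true,
    List.nodup_nil, and_true] at six
  simp only [← ne_eq] at six
  obtain ⟨⟨xe, xg, xy, xh, xk⟩, ⟨eg, ey, eh, ek⟩, ⟨gy, gh, gk⟩, ⟨yh, yk⟩, hk'⟩ := six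
  let nx : Γ.Dart → Γ.Dart := fun d => if d = x then k else if d = k then e else if d = e then x
    else if d = y then g else if d = g then h else if d = h then y else Γ.next d
  have nxx : nx x = k := by simp [nx]
  have nxk : nx k = e := by simp [nx, xk.symm]
  have nxe : nx e = x := by simp [nx, xe.symm, ek]
  have nxy : nx y = g := by simp [nx, xy.symm, ey.symm, yk]
  have nxg : nx g = h := by simp [nx, xg.symm, eg.symm, gy, gk]
  have nxh : nx h = y := by simp [nx, xh.symm, eh.symm, gh.symm, yh.symm, hk']
  have nxd : ∀ d, d ≠ x → d ≠ e → d ≠ g → d ≠ y → d ≠ h → d ≠ k → nx d = Γ.next d := by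
    intro d a b c d' e' f'
    simp [nx, a, b, c, d', e', f']
  have hcase : ∀ d, d = x ∨ d = e ∨ d = g ∨ d = y ∨ d = h ∨ d = k ∨
      (d ≠ x ∧ d ≠ e ∧ d ≠ g ∧ d ≠ y ∧ d ≠ h ∧ d ≠ k) := by
    intro d; tauto
  have hpres : ∀ d, (d ≠ x ∧ d ≠ e ∧ d ≠ g ∧ d ≠ y ∧ d ≠ h ∧ d ≠ k) →
      (Γ.next d ≠ x ∧ Γ.next d ≠ e ∧ Γ.next d ≠ g ∧ Γ.next d ≠ y ∧ Γ.next d ≠ h ∧ Γ.next d ≠ k) := by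
    rintro d ⟨a1, a2, a3, a4, a5, a6⟩
    refine ⟨fun q => a3 (hi (q.trans hx.symm)), fun q => a1 (hi (q.trans he.symm)),
      fun q => a2 (hi (q.trans hg.symm)), fun q => a6 (hi (q.trans hx'.symm)),
      fun q => a4 (hi (q.trans hh.symm)), fun q => a5 (hi (q.trans hk.symm))⟩
  have hcub : ∀ d, nx (nx (nx d)) = d := by
    intro d
    rcases hcase d with rfl | rfl | rfl | rfl | rfl | rfl | hd
    · rw [nxx, nxk, nxe]
    · rw [nxe, nxx, nxk]
    · rw [nxg, nxh, nxy]
    · rw [nxy, nxg, nxh]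
    · rw [nxh, nxy, nxg]
    · rw [nxk, nxe, nxx]
    · have hd1 := hpres _ hd
      have hd2 := hpres _ hd1
      obtain ⟨a1, a2, a3, a4, a5, a6⟩ := hd
      obtain ⟨b1, b2, b3, b4, b5, b6⟩ := hd1
      obtain ⟨c1, c2, c3, c4, c5, c6⟩ := hd2
      rw [nxd d a1 a2 a3 a4 a5 a6, nxd _ b1 b2 b3 b4 b5 b6, nxd _ c1 c2 c3 c4 c5 c6, hc]
  have hne : ∀ d, nx d ≠ d := by
    intro d
    rcases hcase d with rfl | rfl | rfl | rfl | rfl | rfl | ⟨a1, a2, a3, a4, a5, a6⟩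
    · rw [nxx]; exact xk.symm
    · rw [nxe]; exact xe
    · rw [nxg]; exact gh.symm
    · rw [nxy]; exact gy
    · rw [nxh]; exact yh
    · rw [nxk]; exact ek
    · rw [nxd d a1 a2 a3 a4 a5 a6]; exact Γ.next_ne d
  let col : Γ.Dart → ℕ := fun d => if d = x ∨ d = y then c else Γ.color d
  have colx : col x = c := by simp [col]
  have coly : col y = c := by simp [col]
  have cold : ∀ d, d ≠ x → d ≠ y → col d = Γ.color d := by
    intro d hd hd'; simp [col, hd, hd']
  have hyx : Γ.flip y = x := by rw [← hy, Γ.flip_flip]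
  let Γ' : KTG :=
    { Dart := Γ.Dart
      finite_dart := inferInstance
      next := nx
      flip := Γ.flip
      color := col
      flip_flip := Γ.flip_flip
      flip_ne := Γ.flip_ne
      next_ne := hne
      valence := fun d => Or.inr (hcub d)
      color_flip := by
        intro d
        by_cases h1 : d = x
        · rw [h1, hy, colx, coly]
        by_cases h2 : d = y
        · rw [h2, hyx, colx, coly]
        rw [cold d h1 h2, cold, Γ.color_flip]
        · intro q; apply h2; rw [← hy, ← q, Γ.flip_flip]
        · intro q; apply h1; rw [← hyx, ← q, Γ.flip_flip]
      color_bivalent := by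
        intro d hd
        have := hcub d
        rw [hd] at this
        exact absurd this (hne d)
      admissible := by
        intro d _
        have ce := cold e xe.symm ey
        have cg := cold g xg.symm gy
        have ch := cold h xh.symm yh.symm
        have ck := cold k xk.symm yk.symm
        rcases hcase d with rfl | rfl | rfl | rfl | rfl | rfl | hd
        · rw [nxx, nxk, colx, ce, ck]; exact ha.swap
        · rw [nxe, nxx, colx, ce, ck]; exact ha.swap.rotate.rotate
        · rw [nxg, nxh, coly, cg, ch]; exact hb.rotate
        · rw [nxy, nxg, coly, cg, ch]; exact hb
        · rw [nxh, nxy, coly, cg, ch]; exact hb.rotate.rotate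
        · rw [nxk, nxe, colx, ce, ck]; exact ha.swap.rotate
        · have hd1 := hpres _ hd
          have hd2 := hpres _ hd1
          obtain ⟨a1, a2, a3, a4, a5, a6⟩ := hd
          obtain ⟨b1, b2, b3, b4, b5, b6⟩ := hd1
          obtain ⟨c1, c2, c3, c4, c5, c6⟩ := hd2
          rw [nxd d a1 a2 a3 a4 a5 a6, nxd _ b1 b2 b3 b4 b5 b6, cold _ a1 a4, cold _ b1 b4,
            cold _ c1 c4]
          exact Γ.admissible d (hc d) }
  refine ⟨Γ', Equiv.refl _, ?_, hcub, colx⟩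
  constructor <;> simp only [hy, he, hg, hh, hk, Equiv.refl_apply]
  · exact h1
  · exact h2
  · exact fun _ => rfl
  · exact nxx
  · exact nxk
  · exact nxe
  · exact nxy
  · exact nxg
  · exact nxh
  · exact nxd
  · exact cold

/-- A Whitehead move changes neither the number of components nor planarity. -/
theorem IsWhitehead.invariants {Γ Γ' : KTG} (hc : Γ.Cubic) {w : Γ.Dart ≃ Γ'.Dart} {x : Γ.Dart}
    (hw : IsWhitehead Γ Γ' w x) :
    Γ'.components = Γ.components ∧ (Γ'.Planar ↔ Γ.Planar) := by
  classical
  obtain ⟨h1, h2, hfl, hnx, hnk, hne, hny, hng, hnh, hnd, -⟩ := hw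
  have six := hc.six_darts h1 h2
  have hi := Γ.next_injective
  have hx' := hc (Γ.flip x)
  have hx := hc x
  generalize he : Γ.next x = e at *
  generalize hg : Γ.next e = g at *
  generalize hy : Γ.flip x = y at *
  generalize hh : Γ.next y = h at *
  generalize hk : Γ.next h = k at *
  simp only [List.nodup_cons, List.mem_cons, List.not_mem_nil, or_false, not_or, not_false_eq_true,
    List.nodup_nil, and_true] at six
  simp only [← ne_eq] at six
  obtain ⟨⟨xe, xg, xy, xh, xk⟩, ⟨eg, ey, eh, ek⟩, ⟨gy, gh, gk⟩, ⟨yh, yk⟩, hk'⟩ := six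
  have hcase : ∀ d, d = x ∨ d = e ∨ d = g ∨ d = y ∨ d = h ∨ d = k ∨
      (d ≠ x ∧ d ≠ e ∧ d ≠ g ∧ d ≠ y ∧ d ≠ h ∧ d ≠ k) := by
    intro d; tauto
  have hpres : ∀ d, (d ≠ x ∧ d ≠ e ∧ d ≠ g ∧ d ≠ y ∧ d ≠ h ∧ d ≠ k) →
      (Γ.next d ≠ x ∧ Γ.next d ≠ e ∧ Γ.next d ≠ g ∧ Γ.next d ≠ y ∧ Γ.next d ≠ h ∧ Γ.next d ≠ k) := by
    rintro d ⟨a1, a2, a3, a4, a5, a6⟩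
    refine ⟨fun q => a3 (hi (q.trans hx.symm)), fun q => a1 (hi (q.trans he.symm)),
      fun q => a2 (hi (q.trans hg.symm)), fun q => a6 (hi (q.trans hx'.symm)),
      fun q => a4 (hi (q.trans hh.symm)), fun q => a5 (hi (q.trans hk.symm))⟩
  have hsurj : ∀ y', ∃ d, w d = y' := w.surjective
  have hws : ∀ d, w.symm (w d) = d := w.symm_apply_apply
  have hyx : Γ.flip y = x := by rw [← hy, Γ.flip_flip]
  have hC : Γ'.components = Γ.components := by
    have k1 : comp Γ'.next Γ'.flip (w k) = comp Γ'.next Γ'.flip (w x) := by rw [← hnx, comp_left]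
    have k2 : comp Γ'.next Γ'.flip (w e) = comp Γ'.next Γ'.flip (w x) := by
      rw [← hnk, comp_left, k1]
    have k3 : comp Γ'.next Γ'.flip (w y) = comp Γ'.next Γ'.flip (w x) := by
      rw [← hy, ← hfl, comp_right]
    have k4 : comp Γ'.next Γ'.flip (w g) = comp Γ'.next Γ'.flip (w x) := by
      rw [← hny, comp_left, k3]
    have k5 : comp Γ'.next Γ'.flip (w h) = comp Γ'.next Γ'.flip (w x) := by
      rw [← hng, comp_left, k4]
    have l1 : comp Γ.next Γ.flip e = comp Γ.next Γ.flip x := by rw [← he, comp_left]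
    have l2 : comp Γ.next Γ.flip g = comp Γ.next Γ.flip x := by rw [← hg, comp_left, l1]
    have l3 : comp Γ.next Γ.flip y = comp Γ.next Γ.flip x := by rw [← hy, comp_right]
    have l4 : comp Γ.next Γ.flip h = comp Γ.next Γ.flip x := by rw [← hh, comp_left, l3]
    have l5 : comp Γ.next Γ.flip k = comp Γ.next Γ.flip x := by rw [← hk, comp_left, l4]
    symm
    refine componentCount_congr w w.symm ?_ ?_ ?_ ?_ ?_ ?_
    · intro d
      rcases hcase d with rfl | rfl | rfl | rfl | rfl | rfl | ⟨a1, a2, a3, a4, a5, a6⟩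
      · rw [he, k2]
      · rw [hg, k2, k4]
      · rw [hx, k4]
      · rw [hh, k3, k5]
      · rw [hk, k5, k1]
      · rw [hx', k3, k1]
      · rw [← hnd d a1 a2 a3 a4 a5 a6, comp_left]
    · intro d
      rw [← hfl, comp_right]
    · intro d'
      obtain ⟨d, rfl⟩ := hsurj d'
      rcases hcase d with rfl | rfl | rfl | rfl | rfl | rfl | ⟨a1, a2, a3, a4, a5, a6⟩
      · rw [hnx, hws, hws, l5]
      · rw [hne, hws, hws, l1]
      · rw [hng, hws, hws, l2, l4]
      · rw [hny, hws, hws, l2, l3]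
      · rw [hnh, hws, hws, l4, l3]
      · rw [hnk, hws, hws, l1, l5]
      · rw [hnd d a1 a2 a3 a4 a5 a6, hws, hws, comp_left]
    · intro d'
      obtain ⟨d, rfl⟩ := hsurj d'
      rw [hfl, hws, hws, comp_right]
    · intro d; rw [hws]
    · intro d; rw [w.apply_symm_apply]
  refine ⟨hC, ?_⟩
  have hE : orbitCount Γ'.flip = orbitCount Γ.flip := by
    have := Γ.two_mul_edges
    have := Γ'.two_mul_edges
    have := Nat.card_congr w
    omega
  -- the old vertices are `{x, e, g}` and `{y, h, k}`, the new ones `{x, e, k}` and `{y, g, h}`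
  have hV : orbitCount Γ'.next = orbitCount Γ.next := by
    have k1 : orb Γ'.next (w k) = orb Γ'.next (w x) := by rw [← hnx, orb_apply]
    have k2 : orb Γ'.next (w e) = orb Γ'.next (w x) := by rw [← hnk, orb_apply, k1]
    have k3 : orb Γ'.next (w g) = orb Γ'.next (w y) := by rw [← hny, orb_apply]
    have k4 : orb Γ'.next (w h) = orb Γ'.next (w y) := by rw [← hng, orb_apply, k3]
    have l1 : orb Γ.next e = orb Γ.next x := by rw [← he, orb_apply]
    have l2 : orb Γ.next g = orb Γ.next x := by rw [← hg, orb_apply, l1]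
    have l3 : orb Γ.next h = orb Γ.next y := by rw [← hh, orb_apply]
    have l4 : orb Γ.next k = orb Γ.next y := by rw [← hk, orb_apply, l3]
    obtain ⟨f, f1, f2, f3, f4, f5, f6, f7⟩ : ∃ f : Γ.Dart → Γ.Dart, f x = x ∧ f e = x ∧ f g = x ∧
        f y = y ∧ f h = y ∧ f k = y ∧
        ∀ d, d ≠ x → d ≠ e → d ≠ g → d ≠ y → d ≠ h → d ≠ k → f d = d := by
      refine ⟨fun d => if d = e ∨ d = g then x else if d = h ∨ d = k then y else d, ?_⟩
      simp only [xe, xg, xh, xk, eg, gh.symm, gk.symm, eh.symm, ek.symm, ey.symm, gy.symm, yh, yk,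
        true_or, or_true, or_self, if_true, if_false, true_and]
      intro d a1 a2 a3 a4 a5 a6
      simp [a2, a3, a5, a6]
    obtain ⟨f', g1, g2, g3, g4, g5, g6, g7⟩ : ∃ f : Γ.Dart → Γ.Dart, f x = x ∧ f e = x ∧ f k = x ∧
        f y = y ∧ f h = y ∧ f g = y ∧
        ∀ d, d ≠ x → d ≠ e → d ≠ g → d ≠ y → d ≠ h → d ≠ k → f d = d := by
      refine ⟨fun d => if d = e ∨ d = k then x else if d = h ∨ d = g then y else d, ?_⟩
      simp only [xe, xg, xh, xk, ek, hk', gh.symm, gk, eh.symm, eg.symm, ey.symm, gy.symm, yh, yk,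
        true_or, or_true, or_self, if_true, if_false, true_and]
      intro d a1 a2 a3 a4 a5 a6
      simp [a2, a3, a5, a6]
    symm
    refine orbitCount_congr (fun d => w (f d)) (fun d => f' (w.symm d)) ?_ ?_ ?_ ?_
    · intro d
      rcases hcase d with rfl | rfl | rfl | rfl | rfl | rfl | hd
      · simp only [he, f1, f2]
      · simp only [hg, f2, f3]
      · simp only [hx, f1, f3]
      · simp only [hh, f4, f5]
      · simp only [hk, f5, f6]
      · simp only [hx', f4, f6]
      · obtain ⟨b1, b2, b3, b4, b5, b6⟩ := hpres d hd
        obtain ⟨a1, a2, a3, a4, a5, a6⟩ := hd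
        simp only [f7 _ a1 a2 a3 a4 a5 a6, f7 _ b1 b2 b3 b4 b5 b6]
        rw [← hnd d a1 a2 a3 a4 a5 a6, orb_apply]
    · intro d'
      obtain ⟨d, rfl⟩ := hsurj d'
      rcases hcase d with rfl | rfl | rfl | rfl | rfl | rfl | hd
      · simp only [hnx, hws, g1, g3]
      · simp only [hne, hws, g1, g2]
      · simp only [hng, hws, g5, g6]
      · simp only [hny, hws, g4, g6]
      · simp only [hnh, hws, g4, g5]
      · simp only [hnk, hws, g2, g3]
      · obtain ⟨b1, b2, b3, b4, b5, b6⟩ := hpres d hd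
        obtain ⟨a1, a2, a3, a4, a5, a6⟩ := hd
        simp only [hnd d a1 a2 a3 a4 a5 a6, hws, g7 _ a1 a2 a3 a4 a5 a6, g7 _ b1 b2 b3 b4 b5 b6,
          orb_apply]
    · intro d
      rcases hcase d with rfl | rfl | rfl | rfl | rfl | rfl | ⟨a1, a2, a3, a4, a5, a6⟩
      · simp only [hws, f1, g1]
      · simp only [hws, f2, g1, l1]
      · simp only [hws, f3, g1, l2]
      · simp only [hws, f4, g4]
      · simp only [hws, f5, g4, l3]
      · simp only [hws, f6, g4, l4]
      · simp only [hws, f7 _ a1 a2 a3 a4 a5 a6, g7 _ a1 a2 a3 a4 a5 a6]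
    · intro d'
      obtain ⟨d, rfl⟩ := hsurj d'
      rcases hcase d with rfl | rfl | rfl | rfl | rfl | rfl | ⟨a1, a2, a3, a4, a5, a6⟩
      · simp only [hws, g1, f1]
      · simp only [hws, g2, f1, k2]
      · simp only [hws, g6, f4, k3]
      · simp only [hws, g4, f4]
      · simp only [hws, g5, f4, k4]
      · simp only [hws, g3, f1, k1]
      · simp only [hws, f7 _ a1 a2 a3 a4 a5 a6, g7 _ a1 a2 a3 a4 a5 a6]
  have hF : orbitCount Γ'.face = orbitCount Γ.face := by
    have hff := Γ.flip_flip
    -- `x` and `flip x` move to other faces, so each is represented by its successor on the old face;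
    -- all other darts stay in their faces
    obtain ⟨f, f1, f2, f3⟩ : ∃ f : Γ.Dart → Γ.Dart, f x = h ∧ f y = e ∧
        ∀ d, d ≠ x → d ≠ y → f d = d := by
      refine ⟨fun d => if d = x then h else if d = y then e else d, by simp, by simp [xy.symm], ?_⟩
      intro d a b; simp [a, b]
    obtain ⟨f', g1, g2, g3⟩ : ∃ f : Γ.Dart → Γ.Dart, f x = g ∧ f y = k ∧
        ∀ d, d ≠ x → d ≠ y → f d = d := by
      refine ⟨fun d => if d = x then g else if d = y then k else d, by simp, by simp [xy.symm], ?_⟩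
      intro d a b; simp [a, b]
    have fe := f3 e xe.symm ey
    have fg := f3 g xg.symm gy
    have fh := f3 h xh.symm yh.symm
    have fk := f3 k xk.symm yk.symm
    have ge := g3 e xe.symm ey
    have gg := g3 g xg.symm gy
    have gh' := g3 h xh.symm yh.symm
    have gk' := g3 k xk.symm yk.symm
    have hF : ∀ d, Γ'.face (w d) = Γ'.next (w (Γ.flip d)) := fun d => by rw [face, hfl]
    have hcF : ∀ d, d = x ∨ d = y ∨ d ≠ x ∧ d ≠ y ∧ (Γ.flip d = e ∨ Γ.flip d = g ∨
        Γ.flip d = h ∨ Γ.flip d = k ∨ (Γ.flip d ≠ x ∧ Γ.flip d ≠ e ∧ Γ.flip d ≠ g ∧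
          Γ.flip d ≠ y ∧ Γ.flip d ≠ h ∧ Γ.flip d ≠ k)) := by
      intro d
      by_cases a : d = x; · exact Or.inl a
      by_cases b : d = y; · exact Or.inr (Or.inl b)
      have a' : Γ.flip d ≠ x := fun q => b (by rw [← hy, ← q, hff])
      have b' : Γ.flip d ≠ y := fun q => a (by rw [← hyx, ← q, hff])
      have := hcase (Γ.flip d)
      tauto
    have Fx : Γ'.face (w x) = w g := by rw [hF, hy, hny]
    have Fy : Γ'.face (w y) = w k := by rw [hF, hyx, hnx]
    have fx : Γ.face x = h := by rw [face, hy, hh]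
    have fy : Γ.face y = e := by rw [face, hyx, he]
    symm
    refine orbitCount_congr (fun d => w (f d)) (fun d => f' (w.symm d)) ?_ ?_ ?_ ?_
    · intro d
      rcases hcF d with rfl | rfl | ⟨a, b, q | q | q | q | hd⟩
      · simp only [fx, f1, fh]
      · simp only [fy, f2, fe]
      · simp only [face, q, hg, fg, f3 d a b]
        rw [← orb_apply _ (w d), hF, q, hne, ← Fx, orb_apply]
      · simp only [face, q, hx, f1, f3 d a b]
        rw [← orb_apply _ (w d), hF, q, hng]
      · simp only [face, q, hk, fk, f3 d a b]
        rw [← orb_apply _ (w d), hF, q, hnh, ← Fy, orb_apply]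
      · simp only [face, q, hx', f2, f3 d a b]
        rw [← orb_apply _ (w d), hF, q, hnk]
      · obtain ⟨b1, b2, b3, b4, b5, b6⟩ := hpres _ hd
        obtain ⟨a1, a2, a3, a4, a5, a6⟩ := hd
        simp only [face, f3 d a b, f3 _ b1 b4]
        rw [← orb_apply _ (w d), hF, hnd _ a1 a2 a3 a4 a5 a6]
    · intro d'
      obtain ⟨d, rfl⟩ := hsurj d'
      rcases hcF d with rfl | rfl | ⟨a, b, q | q | q | q | hd⟩
      · simp only [Fx, hws, g1, gg]
      · simp only [Fy, hws, g2, gk']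
      · simp only [hF, q, hne, hws, g1, g3 d a b]
        rw [← orb_apply _ d, face, q, hg]
      · simp only [hF, q, hng, hws, gh', g3 d a b]
        rw [← orb_apply _ d, face, q, hx, ← fx, orb_apply]
      · simp only [hF, q, hnh, hws, g2, g3 d a b]
        rw [← orb_apply _ d, face, q, hk]
      · simp only [hF, q, hnk, hws, ge, g3 d a b]
        rw [← orb_apply _ d, face, q, hx', ← fy, orb_apply]
      · obtain ⟨b1, b2, b3, b4, b5, b6⟩ := hpres _ hd
        obtain ⟨a1, a2, a3, a4, a5, a6⟩ := hd
        simp only [hF, hnd _ a1 a2 a3 a4 a5 a6, hws, g3 d a b, g3 _ b1 b4]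
        rw [← orb_apply _ d, face]
    · intro d
      by_cases a : d = x
      · simp only [a, f1, hws, gh']; rw [← fx, orb_apply]
      by_cases b : d = y
      · simp only [b, f2, hws, ge]; rw [← fy, orb_apply]
      simp only [f3 d a b, hws, g3 d a b]
    · intro d'
      obtain ⟨d, rfl⟩ := hsurj d'
      by_cases a : d = x
      · simp only [a, hws, g1, fg]; rw [← Fx, orb_apply]
      by_cases b : d = y
      · simp only [b, hws, g2, fk]; rw [← Fy, orb_apply]
      simp only [f3 d a b, hws, g3 d a b]
  rw [KTG.planar_iff, KTG.planar_iff, hC, hE, hV, hF]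

end KTG

namespace KTG

/-- A Whitehead move, read backwards, is a triangle move followed by the inverse of a fusion: fusing
the strands of `e` and `k`, which lie on one side of the edge of `x`, cuts off a triangle with that
edge as one side, and contracting the triangle gives the turned edge. -/
theorem IsWhitehead.generates {Γ Γ' : KTG} (hc : Γ.Cubic) (hc' : Γ'.Cubic)
    {w : Γ.Dart ≃ Γ'.Dart} {x : Γ.Dart} (hw : IsWhitehead Γ Γ' w x) (hp : Γ.Planar) :
    Generates Γ' Γ := by
  classical
  have hp' : Γ'.Planar := (hw.invariants hc).2.mpr hp
  obtain ⟨h1, h2, hfl, hnx, hnk, hne, hny, hng, hnh, hnd, hcol⟩ := hw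
  have six := hc.six_darts h1 h2
  have hi := Γ.next_injective
  have hx' := hc (Γ.flip x)
  have hx := hc x
  have cx : Γ.color (Γ.flip x) = Γ.color x := Γ.color_flip x
  generalize he : Γ.next x = e at *
  generalize hg : Γ.next e = g at *
  generalize hy : Γ.flip x = y at *
  generalize hh : Γ.next y = h at *
  generalize hk : Γ.next h = k at *
  simp only [List.nodup_cons, List.mem_cons, List.not_mem_nil, or_false, not_or, not_false_eq_true,
    List.nodup_nil, and_true] at six
  simp only [← ne_eq] at six
  obtain ⟨⟨xe, xg, xy, xh, xk⟩, ⟨eg, ey, eh, ek⟩, ⟨gy, gh, gk⟩, ⟨yh, yk⟩, hk'⟩ := six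
  have hff := Γ.flip_flip
  have hyx : Γ.flip y = x := by rw [← hy, hff]
  have fe : Γ.flip e ≠ x ∧ Γ.flip e ≠ y ∧ Γ.flip e ≠ e :=
    ⟨fun q => ey (by rw [← hy, ← q, hff]), fun q => xe (by rw [← hyx, ← q, hff]), Γ.flip_ne e⟩
  have fk : Γ.flip k ≠ x ∧ Γ.flip k ≠ y ∧ Γ.flip k ≠ k :=
    ⟨fun q => yk (by rw [← hy, ← q, hff]), fun q => xk (by rw [← hyx, ← q, hff]), Γ.flip_ne k⟩
  -- `Γ₂` carries marked points on the strands to be fused; fusing them gives `Γ₃`, which is also a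
  -- blow-up of `Γ'`
  obtain ⟨Γ₁, j₁, p₁, q₁, hs₁⟩ := exists_isSubdivision Γ e
  obtain ⟨Γ₂, j₂, p₂, q₂, hs₂⟩ := exists_isSubdivision Γ₁ (j₁ k)
  obtain ⟨Γ₃, ι, s, t, ht, hcs⟩ := exists_isTriangleMove Γ' (w y) (hc' _)
    ![Γ.color e, Γ.color x, Γ.color k] (by
      have n1 := Γ'.admissible (w x) (hc' _)
      have n2 := Γ.admissible x (hc _)
      have n3 := Γ.admissible y (hc _)
      rw [hnx, hnk, hcol k xk.symm yk.symm, hcol e xe.symm ey] at n1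
      rw [he, hg] at n2
      rw [hh, hk, cx] at n3
      have cy : Γ'.color (w y) = Γ'.color (w x) := by rw [← hy, ← hfl, Γ'.color_flip]
      have cg : Γ'.color (w g) = Γ.color g := hcol g xg.symm gy
      have ch : Γ'.color (w h) = Γ.color h := hcol h xh.symm yh.symm
      intro i
      fin_cases i
      · refine ⟨?_, ?_, ?_⟩ <;>
          simp only [Fin.isValue, Fin.zero_eta, Function.iterate_zero, id,
            Matrix.cons_val, show (0 : Fin 3) + 2 = 2 from rfl, cy]
        exacts [n1.swap, n1.swap.rotate, n1.rotate.swap]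
      · refine ⟨?_, ?_, ?_⟩ <;>
          simp only [Fin.isValue, Fin.mk_one, Function.iterate_one, hny, cg,
            Matrix.cons_val, show (1 : Fin 3) + 2 = 0 from rfl]
        exacts [n2.rotate.rotate, n2, n2.rotate]
      · refine ⟨?_, ?_, ?_⟩ <;>
          simp only [Fin.isValue, Fin.reduceFinMk, Function.iterate_succ,
            Function.iterate_zero, Function.comp, id, hny, hng, ch,
            Matrix.cons_val, show (2 : Fin 3) + 2 = 1 from rfl]
        exacts [n3.rotate, n3.rotate.rotate, n3])
  have hp₁ : Γ₁.Planar := hs₁.subdivision.planar_iff.mpr hp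
  have hp₂ : Γ₂.Planar := hs₂.subdivision.planar_iff.mpr hp₁
  have hp₃ : Γ₃.Planar := ht.invariants.2.1.mpr hp'
  suffices hfus : FusionMove Γ₂ Γ₃ by
    have s₁ : Step Γ' Γ₃ := ⟨hp', hp₃, Or.inr (Or.inl ⟨_, _, _, _, ht⟩)⟩
    have s₂ : Step Γ₃ Γ₂ := ⟨hp₃, hp₂, Or.inr (Or.inr hfus)⟩
    have s₃ : Step Γ₂ Γ₁ := ⟨hp₂, hp₁, Or.inl (Or.inr (Or.inr hs₂.subdivision))⟩
    have s₄ : Step Γ₁ Γ := ⟨hp₁, hp, Or.inl (Or.inr (Or.inr hs₁.subdivision))⟩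
    exact .tail (.tail (.tail (.single s₁) s₂) s₃) s₄
  obtain ⟨⟨a0, b0, c0, e0⟩, ⟨na1, b1, c1, e1⟩, ⟨na2, b2, c2, e2⟩⟩ := ht.corners
  have hn3 := ht.next_other
  rw [hny] at na1 c1 na2 c2 hn3
  rw [hng] at na2 c2 hn3
  have hcs0 := hcs 0
  have hcs1 := hcs 1
  have hcs2 := hcs 2
  simp only [Matrix.cons_val] at hcs0 hcs1 hcs2
  have hct1 : Γ₃.color (t 1) = Γ.color e := by rw [← e0, Γ₃.color_flip, hcs0]
  have hct2 : Γ₃.color (t 2) = Γ.color x := by rw [← e1, Γ₃.color_flip, hcs1]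
  have hct0 : Γ₃.color (t 0) = Γ.color k := by rw [← e2, Γ₃.color_flip, hcs2]
  have e0' : Γ₃.flip (t 1) = s 0 := by rw [← e0, Γ₃.flip_flip]
  have e1' : Γ₃.flip (t 2) = s 1 := by rw [← e1, Γ₃.flip_flip]
  have e2' : Γ₃.flip (t 0) = s 2 := by rw [← e2, Γ₃.flip_flip]
  have fl3 : ∀ d, Γ₃.flip (ι (w d)) = ι (w (Γ.flip d)) := fun d => by
    rw [ht.2.2.2.1, hfl]
  have col3 : ∀ d, d ≠ x → d ≠ y → Γ₃.color (ι (w d)) = Γ.color d := fun d h h' => by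
    rw [ht.2.2.2.2.2, hcol d h h']
  have nx3 : ∀ d, d ≠ y → d ≠ g → d ≠ h → Γ₃.next (ι (w d)) = ι (Γ'.next (w d)) := fun d h h' h'' =>
    hn3 _ (fun q => h (w.injective q)) (fun q => h' (w.injective q)) (fun q => h'' (w.injective q))
  -- `κ` embeds the darts of `Γ₂` into those of `Γ₃`: the old darts `x`, `e`, `y`, `k` become sides of
  -- the triangle, and the marked points supply the darts that leave it
  obtain ⟨ρ, r1, r2, r3, r4, r5⟩ : ∃ ρ : Γ.Dart → Γ₃.Dart, ρ x = s 1 ∧ ρ e = t 1 ∧ ρ y = t 2 ∧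
      ρ k = s 2 ∧ ∀ d, d ≠ x → d ≠ e → d ≠ y → d ≠ k → ρ d = ι (w d) := by
    refine ⟨fun d => if d = x then s 1 else if d = e then t 1 else if d = y then t 2 else
      if d = k then s 2 else ι (w d), by simp, by simp [xe.symm], by simp [xy.symm, ey.symm],
      by simp [xk.symm, ek.symm, yk.symm], ?_⟩
    intro d a b c d'
    simp [a, b, c, d']
  obtain ⟨κ₁, k1, k2, k3⟩ := hs₁.exists_lift ρ (s 0) (ι (w e))
  obtain ⟨κ, k4, k5, k6⟩ := hs₂.exists_lift κ₁ (t 0) (ι (w k))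
  have kk : ∀ d, κ (j₂ (j₁ d)) = ρ d := fun d => by rw [k4, k1]
  have kp : κ (j₂ p₁) = s 0 := by rw [k4, k2]
  have kq : κ (j₂ q₁) = ι (w e) := by rw [k4, k3]
  have hcase : ∀ y', y' = p₂ ∨ y' = q₂ ∨ y' = j₂ p₁ ∨ y' = j₂ q₁ ∨ ∃ d, y' = j₂ (j₁ d) := by
    intro y'
    rcases hs₂.cases y' with h | h | ⟨d, rfl⟩
    · exact Or.inl h
    · exact Or.inr (Or.inl h)
    · rcases hs₁.cases d with rfl | rfl | ⟨d, rfl⟩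
      · simp
      · simp
      · exact Or.inr (Or.inr (Or.inr (Or.inr ⟨d, rfl⟩)))
  have hcaseD : ∀ d, d = x ∨ d = e ∨ d = y ∨ d = k ∨ (d ≠ x ∧ d ≠ e ∧ d ≠ y ∧ d ≠ k) := by
    intro d; tauto
  obtain ⟨lam, l1, l2, l3⟩ := ht.exists_lift (fun d => if d = w e then j₂ q₁ else if d = w k then q₂
    else j₂ (j₁ (w.symm d))) ![j₂ p₁, j₂ (j₁ x), j₂ (j₁ k)] ![p₂, j₂ (j₁ e), j₂ (j₁ y)]
  have lw : ∀ d, d ≠ e → d ≠ k → lam (ι (w d)) = j₂ (j₁ d) := by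
    intro d h h'
    simp [l1, h, h']
  have le : lam (ι (w e)) = j₂ q₁ := by simp [l1]
  have lk : lam (ι (w k)) = q₂ := by simp [l1, ek.symm]
  have ls0 := l2 0
  have ls1 := l2 1
  have ls2 := l2 2
  have lt0 := l3 0
  have lt1 := l3 1
  have lt2 := l3 2
  simp only [Matrix.cons_val] at ls0 ls1 ls2 lt0 lt1 lt2
  have hlam : ∀ y', lam (κ y') = y' := by
    intro y'
    rcases hcase y' with rfl | rfl | rfl | rfl | ⟨d, rfl⟩
    · rw [k5, lt0]
    · rw [k6, lk]
    · rw [kp, ls0]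
    · rw [kq, le]
    · rw [kk]
      rcases hcaseD d with rfl | rfl | rfl | rfl | ⟨a1, a2, a3, a4⟩
      · rw [r1, ls1]
      · rw [r2, lt1]
      · rw [r3, lt2]
      · rw [r4, ls2]
      · rw [r5 d a1 a2 a3 a4, lw d a2 a4]
  have hinj : Function.Injective κ := Function.LeftInverse.injective hlam
  have hιw : ∀ d d', ι (w d) = ι (w d') → d = d' := fun d d' h =>
    w.injective (Sum.inl.inj (ht.2.1.1 (a₁ := Sum.inl (w d)) (a₂ := Sum.inl (w d')) h))
  have hιs : ∀ d i, ι (w d) ≠ s i := fun d i h => by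
    have := ht.2.1.1 (a₁ := Sum.inl (w d)) (a₂ := Sum.inr (Sum.inl i)) h
    simp at this
  have hιt : ∀ d i, ι (w d) ≠ t i := fun d i h => by
    have := ht.2.1.1 (a₁ := Sum.inl (w d)) (a₂ := Sum.inr (Sum.inr i)) h
    simp at this
  have hnotmem : ∀ y', κ y' ≠ ι (w x) ∧ κ y' ≠ ι (w y) := by
    intro y'
    rcases hcase y' with rfl | rfl | rfl | rfl | ⟨d, rfl⟩
    · rw [k5]; exact ⟨(hιt _ _).symm, (hιt _ _).symm⟩
    · rw [k6]; exact ⟨fun q => xk.symm (hιw _ _ q), fun q => yk.symm (hιw _ _ q)⟩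
    · rw [kp]; exact ⟨(hιs _ _).symm, (hιs _ _).symm⟩
    · rw [kq]; exact ⟨fun q => xe.symm (hιw _ _ q), fun q => ey (hιw _ _ q)⟩
    · rw [kk]
      rcases hcaseD d with rfl | rfl | rfl | rfl | ⟨a1, a2, a3, a4⟩
      · rw [r1]; exact ⟨(hιs _ _).symm, (hιs _ _).symm⟩
      · rw [r2]; exact ⟨(hιt _ _).symm, (hιt _ _).symm⟩
      · rw [r3]; exact ⟨(hιt _ _).symm, (hιt _ _).symm⟩
      · rw [r4]; exact ⟨(hιs _ _).symm, (hιs _ _).symm⟩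
      · rw [r5 d a1 a2 a3 a4]; exact ⟨fun q => a1 (hιw _ _ q), fun q => a3 (hιw _ _ q)⟩
  have hj₁ : ∀ {a b}, j₁ a = j₁ b → a = b := fun h => hs₁.injective h
  -- `e` and `k` may be the two halves of one edge, which then carries both marked points
  have f2 : ∀ d, d ≠ j₁ k → d ≠ Γ₁.flip (j₁ k) → Γ₂.flip (j₂ d) = j₂ (Γ₁.flip d) := hs₂.flip_other
  have f1 : ∀ d, d ≠ e → d ≠ Γ.flip e → Γ₁.flip (j₁ d) = j₁ (Γ.flip d) := hs₁.flip_other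
  have fk1 : k = Γ.flip e ∧ Γ₁.flip (j₁ k) = q₁ ∨ k ≠ Γ.flip e ∧ Γ₁.flip (j₁ k) = j₁ (Γ.flip k) := by
    by_cases h : k = Γ.flip e
    · exact Or.inl ⟨h, by rw [h, hs₁.flip_x']⟩
    · exact Or.inr ⟨h, f1 k ek.symm h⟩
  refine ⟨κ, q₂, j₂ q₁, j₂ p₁, p₂, ι (w x), ι (w y), hinj, ?_, hs₂.next_q, hs₂.next_p, ?_, ?_, ?_, ?_,
    ?_, ?_, ?_, ?_, ?_, ?_, ?_, ?_⟩
  · intro z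
    constructor
    · rintro ⟨y', rfl⟩
      exact hnotmem y'
    · rintro ⟨z1, z2⟩
      rcases ht.cases z with ⟨d, rfl⟩ | rfl | rfl | rfl | rfl | rfl | rfl
      · obtain ⟨d, rfl⟩ := w.surjective d
        by_cases h1 : d = e
        · exact ⟨_, by rw [kq, h1]⟩
        by_cases h2 : d = k
        · exact ⟨_, by rw [k6, h2]⟩
        exact ⟨_, (kk d).trans (r5 d (fun q => z1 (by rw [q])) h1 (fun q => z2 (by rw [q])) h2)⟩
      exacts [⟨_, kp⟩, ⟨_, (kk x).trans r1⟩, ⟨_, (kk k).trans r4⟩, ⟨_, k5⟩, ⟨_, (kk e).trans r2⟩,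
        ⟨_, (kk y).trans r3⟩]
  · rw [hs₂.next_eq, hs₁.next_q]
  · rw [hs₂.next_eq, hs₁.next_p]
  · rw [k6, nx3 x xy xg xh, hnx]
  · rw [k6, kq, nx3 k yk.symm gk.symm hk'.symm, hnk]
  · rw [kq, nx3 e ey eg eh, hne]
  · rw [kp, a0]
  · rw [kp, k5, b0]
  · rw [k5, c0]
  · rw [fl3, hy]
  · intro y'
    rcases hcase y' with rfl | rfl | rfl | rfl | ⟨d, rfl⟩
    · rw [k5, hs₂.flip_p, kk, e2', r4]
    · rw [k6, hs₂.flip_q, fl3]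
      rcases fk1 with ⟨h, h'⟩ | ⟨h, h'⟩
      · rw [h', kq, h, hff]
      · rw [h', kk, r5 _ fk.1 (fun q => h (by rw [← q, hff])) fk.2.1 fk.2.2]
    · rw [kp, e0, f2 p₁ (hs₁.ne_p k).symm, hs₁.flip_p, kk, r2]
      rcases fk1 with ⟨-, h'⟩ | ⟨-, h'⟩
      · rw [h']; exact hs₁.p_ne_q
      · rw [h']; exact (hs₁.ne_p _).symm
    · rw [kq, fl3]
      rcases fk1 with ⟨h, h'⟩ | ⟨h, h'⟩
      · rw [← h', hs₂.flip_x', k6, h]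
      · rw [f2 q₁ (hs₁.ne_q k).symm (by rw [h']; exact (hs₁.ne_q _).symm), hs₁.flip_q, kk,
          r5 _ fe.1 fe.2.2 fe.2.1 h.symm]
    · rw [kk]
      rcases hcaseD d with rfl | rfl | rfl | rfl | ⟨a1, a2, a3, a4⟩
      · rw [r1, e1, f2, f1 _ xe fe.1.symm, kk, hy, r3]
        · exact fun q => xk (hj₁ q)
        · rcases fk1 with ⟨h, h'⟩ | ⟨h, h'⟩
          · rw [h']; exact hs₁.ne_q _
          · rw [h']; exact fun q => fk.1 (hj₁ q).symm
      · rw [r2, e0', f2, hs₁.flip_x, kp]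
        · exact fun q => ek (hj₁ q)
        · rcases fk1 with ⟨h, h'⟩ | ⟨h, h'⟩
          · rw [h']; exact hs₁.ne_q _
          · rw [h']; exact fun q => h (by rw [hj₁ q, hff])
      · rw [r3, e1', f2, f1 _ ey.symm fe.2.1.symm, kk, hyx, r1]
        · exact fun q => yk (hj₁ q)
        · rcases fk1 with ⟨h, h'⟩ | ⟨h, h'⟩
          · rw [h']; exact hs₁.ne_q _
          · rw [h']; exact fun q => fk.2.1 (hj₁ q).symm
      · rw [r4, e2, hs₂.flip_x, k5]
      · rw [r5 d a1 a2 a3 a4, fl3]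
        by_cases h1 : d = Γ.flip e
        · rw [h1, hff, f2, hs₁.flip_x', kq]
          · rw [← h1]; exact fun q => a4 (hj₁ q)
          · rcases fk1 with ⟨h, h'⟩ | ⟨h, h'⟩
            · exact absurd (h1.trans h.symm) a4
            · rw [h']; exact fun q => ek (Γ.flip_injective (hj₁ q))
        · by_cases h2 : d = Γ.flip k
          · rcases fk1 with ⟨h, h'⟩ | ⟨h, h'⟩
            · rw [h, hff] at h2; exact absurd h2 a2
            · rw [h2, hff, ← h', hs₂.flip_x', k6]
          · rw [f2, f1 d a2 h1, kk, r5]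
            · exact fun q => a3 (by rw [← hy, ← q, hff])
            · exact fun q => h1 (by rw [← q, hff])
            · exact fun q => a1 (by rw [← hyx, ← q, hff])
            · exact fun q => h2 (by rw [← q, hff])
            · exact fun q => a4 (hj₁ q)
            · rcases fk1 with ⟨h, h'⟩ | ⟨h, h'⟩
              · rw [h']; exact hs₁.ne_q _
              · rw [h']; exact fun q => h2 (hj₁ q)
  · intro y' n1 n2 n3 n4
    rcases hcase y' with rfl | rfl | rfl | rfl | ⟨d, rfl⟩
    · exact absurd rfl n4
    · exact absurd rfl n1
    · exact absurd rfl n3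
    · exact absurd rfl n2
    · rw [hs₂.next_eq, hs₁.next_eq, kk, kk]
      rcases hcaseD d with rfl | rfl | rfl | rfl | ⟨a1, a2, a3, a4⟩
      · rw [he, r1, r2, b1]
      · rw [hg, r2, c1, r5 g xg.symm eg.symm gy gk]
      · rw [hh, r3, c2, r5 h xh.symm eh.symm yh.symm hk']
      · rw [hx', r4, r3, b2]
      · rw [r5 d a1 a2 a3 a4]
        by_cases h1 : d = g
        · rw [h1, na1, hx, r1]
        by_cases h2 : d = h
        · rw [h2, na2, hk, r4]
        rw [nx3 d a3 h1 h2, hnd d a1 a2 h1 a3 h2 a4, r5]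
        · exact fun q => h1 (hi (q.trans hx.symm))
        · exact fun q => a1 (hi (q.trans he.symm))
        · exact fun q => a4 (hi (q.trans hx'.symm))
        · exact fun q => h2 (hi (q.trans hk.symm))
  · intro y'
    rcases hcase y' with rfl | rfl | rfl | rfl | ⟨d, rfl⟩
    · rw [k5, hct0, hs₂.color_p, hs₁.color_eq]
    · rw [k6, col3 k xk.symm yk.symm, hs₂.color_q, hs₁.color_eq]
    · rw [kp, hcs0, hs₂.color_eq, hs₁.color_p]
    · rw [kq, col3 e xe.symm ey, hs₂.color_eq, hs₁.color_q]
    · rw [kk, hs₂.color_eq, hs₁.color_eq]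
      rcases hcaseD d with rfl | rfl | rfl | rfl | ⟨a1, a2, a3, a4⟩
      · rw [r1, hcs1]
      · rw [r2, hct1]
      · rw [r3, hct2, cx]
      · rw [r4, hcs2]
      · rw [r5 d a1 a2 a3 a4, col3 d a1 a3]

end KTG

namespace KTG

/-! ### Connected cubic graphs -/

/-- The graph can be generated from a theta graph. -/
def Generated (Γ : KTG) : Prop :=
  ∃ (a b c : ℕ) (h : AdmissibleTriple a b c), Generates (theta a b c h) Γ

theorem Generated.trans {Γ Γ' : KTG} (h : Generated Γ) (h' : Generates Γ Γ') : Generated Γ' := by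
  obtain ⟨a, b, c, habc, h⟩ := h
  exact ⟨a, b, c, habc, Relation.ReflTransGen.trans h h'⟩

theorem Generated.step {Γ Γ' : KTG} (h : Generated Γ) (h' : Step Γ Γ') : Generated Γ' :=
  h.trans (.single h')

/-- All colors lie between `n` and `2 * n`.  For such colors admissibility is a condition on the
parity alone. -/
def Banded (n : ℕ) (Γ : KTG) : Prop := ∀ d, n ≤ Γ.color d ∧ Γ.color d ≤ 2 * n

theorem admissible_of_band {n a b c : ℕ} (ha : n ≤ a ∧ a ≤ 2 * n) (hb : n ≤ b ∧ b ≤ 2 * n)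
    (hc : n ≤ c ∧ c ≤ 2 * n) (h : Even (a + b + c)) : AdmissibleTriple a b c :=
  ⟨h, by omega, by omega, by omega⟩

/-- Connected planar graphs with trivalent vertices only and with colors between `n` and `2 * n`. -/
structure Regular (n : ℕ) (Γ : KTG) : Prop where
  cubic : Γ.Cubic
  banded : Γ.Banded n
  planar : Γ.Planar
  connected : Γ.components = 1

theorem IsWhitehead.face_eq {Γ Γ' : KTG} {w : Γ.Dart ≃ Γ'.Dart} {x : Γ.Dart}
    (hw : IsWhitehead Γ Γ' w x) (d : Γ.Dart) : Γ'.face (w d) = Γ'.next (w (Γ.flip d)) := by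
  rw [face, hw.flip_eq]

/-- In the band the new edge of a Whitehead move can always be colored: its color only has to have the
right parity. -/
theorem Regular.exists_whitehead {n : ℕ} (hn : 1 ≤ n) {Γ : KTG} (hΓ : Regular n Γ) {x : Γ.Dart}
    (h1 : Γ.flip x ≠ Γ.next x) (h2 : Γ.flip x ≠ Γ.next (Γ.next x)) :
    ∃ (Γ' : KTG) (w : Γ.Dart ≃ Γ'.Dart), IsWhitehead Γ Γ' w x ∧ Regular n Γ' ∧
      Generates Γ' Γ ∧ Nat.card Γ'.Dart = Nat.card Γ.Dart := by
  obtain ⟨c, hc, hpar⟩ : ∃ c, (n ≤ c ∧ c ≤ 2 * n) ∧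
      Even (c + Γ.color (Γ.next x) + Γ.color (Γ.next (Γ.next (Γ.flip x)))) := by
    rcases Nat.even_or_odd (n + Γ.color (Γ.next x) + Γ.color (Γ.next (Γ.next (Γ.flip x)))) with h | h
    · exact ⟨n, by omega, h⟩
    · refine ⟨n + 1, by omega, ?_⟩
      rw [Nat.odd_iff] at h
      rw [Nat.even_iff]
      omega
  have hpar' : Even (c + Γ.color (Γ.next (Γ.next x)) + Γ.color (Γ.next (Γ.flip x))) := by
    have e1 := (Γ.admissible x (hΓ.cubic x)).1
    have e2 := (Γ.admissible (Γ.flip x) (hΓ.cubic _)).1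
    rw [Γ.color_flip] at e2
    rw [Nat.even_iff] at *
    omega
  obtain ⟨Γ', w, hw, hcub, hcol⟩ := exists_isWhitehead hΓ.cubic h1 h2 c
    (admissible_of_band hc (hΓ.banded _) (hΓ.banded _) hpar)
    (admissible_of_band hc (hΓ.banded _) (hΓ.banded _) hpar')
  have inv := hw.invariants hΓ.cubic
  refine ⟨Γ', w, hw, ⟨hcub, fun d => ?_, inv.2.mpr hΓ.planar, inv.1.trans hΓ.connected⟩,
    hw.generates hΓ.cubic hcub hΓ.planar, (Nat.card_congr w).symm⟩
  obtain ⟨d, rfl⟩ := w.surjective d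
  by_cases h : d = x
  · rw [h, hcol]; exact hc
  by_cases h' : d = Γ.flip x
  · rw [h', ← hw.flip_eq, Γ'.color_flip, hcol]; exact hc
  rw [hw.color_eq d h h']
  exact hΓ.banded d

section Reduction

variable {n : ℕ} {Γ : KTG}

/-- A graph with a triangular face, whose sides are three different edges, arises from a
smaller one by a triangle move. -/
theorem Regular.generated_of_triangle (hΓ : Regular n Γ)
    (hsmall : ∀ Γ' : KTG, Regular n Γ' → Nat.card Γ'.Dart < Nat.card Γ.Dart → Generated Γ')
    {a b c : Γ.Dart} (fa : Γ.face a = b) (fb : Γ.face b = c) (fc : Γ.face c = a)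
    (hab : a ≠ b) (hbc : b ≠ c) (hac : a ≠ c) (gab : Γ.flip a ≠ b) (gac : Γ.flip a ≠ c)
    (gbc : Γ.flip b ≠ c) : Generated Γ := by
  have hff := Γ.flip_flip
  have gba : Γ.flip b ≠ a := fun h => gab (by rw [← h, hff])
  have gca : Γ.flip c ≠ a := fun h => gac (by rw [← h, hff])
  have gcb : Γ.flip c ≠ b := fun h => gbc (by rw [← h, hff])
  have hcorner : ∀ d, Even (Γ.color d + Γ.color (Γ.next (Γ.face d)) + Γ.color (Γ.face d)) := by
    intro d
    have := (Γ.admissible (Γ.flip d) (hΓ.cubic _)).1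
    rw [Γ.color_flip] at this
    rw [face]
    rwa [add_right_comm]
  have ea := hcorner a
  have eb := hcorner b
  have ec := hcorner c
  rw [fa] at ea
  rw [fb] at eb
  rw [fc] at ec
  obtain ⟨Γ₀, ι, x, s, ht, hcub⟩ := Γ.exists_triangleMove ![a, c, b] (by
      intro i j h
      fin_cases i <;> fin_cases j <;> simp_all) hΓ.cubic (by
      intro i
      fin_cases i
      exacts [fc, fb, fa]) (by
      intro i j
      fin_cases i <;> fin_cases j
      exacts [Γ.flip_ne a, gac, gab, gca, Γ.flip_ne c, gcb, gba, gbc, Γ.flip_ne b]) (by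
      intro i
      refine admissible_of_band (hΓ.banded _) (hΓ.banded _) (hΓ.banded _) ?_
      rw [Nat.even_iff] at *
      fin_cases i
      · show (Γ.color (Γ.next a) + Γ.color (Γ.next c) + Γ.color (Γ.next b)) % 2 = 0
        omega
      · show (Γ.color (Γ.next c) + Γ.color (Γ.next b) + Γ.color (Γ.next a)) % 2 = 0
        omega
      · show (Γ.color (Γ.next b) + Γ.color (Γ.next a) + Γ.color (Γ.next c)) % 2 = 0
        omega)
  obtain ⟨i1, i2, i3⟩ := ht.invariants
  have hp := i2.mp hΓ.planar
  refine (hsmall Γ₀ ⟨hcub, fun d => ?_, hp, i1.symm.trans hΓ.connected⟩ (by omega)).step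
    ⟨hp, hΓ.planar, Or.inr (Or.inl ⟨_, _, _, _, ht⟩)⟩
  rw [← ht.2.2.2.2.2]
  exact hΓ.banded _

/-- A face with two sides can be enlarged to a triangle, unless the graph is a theta graph. -/
theorem Regular.generated_of_bigon (hn : 1 ≤ n) (hΓ : Regular n Γ)
    (hsmall : ∀ Γ' : KTG, Regular n Γ' → Nat.card Γ'.Dart < Nat.card Γ.Dart → Generated Γ')
    {a b : Γ.Dart} (fa : Γ.face a = b) (fb : Γ.face b = a) (hab : a ≠ b) (gab : Γ.flip a ≠ b) :
    Generated Γ := by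
  have hff := Γ.flip_flip
  have hi : ∀ {a b}, Γ.next a = Γ.next b → a = b := fun h => Γ.next_injective h
  have hne := Γ.next_ne
  have hcub := hΓ.cubic
  rw [face] at fa fb
  have gba : Γ.flip b ≠ a := fun h => gab (by rw [← h, hff])
  -- the third darts at the two corners
  have na : Γ.next (Γ.next (Γ.next a)) = a := hcub a
  have nb : Γ.next (Γ.next (Γ.next b)) = b := hcub b
  have ob : Γ.next (Γ.next b) = Γ.flip a := hi (by rw [nb, fa])
  have oa : Γ.next (Γ.next a) = Γ.flip b := hi (by rw [na, fb])
  have k1 : Γ.next b ≠ a := fun h => Γ.flip_ne b (hi (by rw [h, fb]))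
  have k2 : Γ.next b ≠ Γ.flip a := fun h => by
    rw [← h] at ob; exact hne _ ob
  have k3 : Γ.next b ≠ Γ.flip b := fun h => by
    rw [h, fb] at ob; exact Γ.flip_ne a ob.symm
  have l1 : Γ.flip (Γ.next b) ≠ Γ.next (Γ.next b) := by
    rw [ob]; exact fun h => k1 (Γ.flip_injective h)
  have l2 : Γ.flip (Γ.next b) ≠ Γ.next (Γ.next (Γ.next b)) := by
    rw [nb]; exact fun h => k3 (by rw [← h, hff, h])
  by_cases hth : Γ.flip (Γ.next b) = Γ.next a
  · have six := hcub.six_darts l1 l2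
    rw [hth, ob, fa, oa, fb] at six
    have hadm : AdmissibleTriple (Γ.color a) (Γ.color b) (Γ.color (Γ.next a)) := by
      have := Γ.admissible (Γ.flip a) (hcub _)
      rwa [fa, Γ.color_flip, ← Γ.color_flip (Γ.next b), hth] at this
    refine ⟨_, _, _, hadm, .single ?_⟩
    let f : Fin 3 × Bool → Γ.Dart := fun z =>
      if z.2 then ![Γ.flip a, b, Γ.next b] z.1 else ![a, Γ.flip b, Γ.next a] z.1
    have hinj : Function.Injective f := by
      simp only [List.nodup_cons, List.mem_cons, List.not_mem_nil, or_false, not_or,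
        not_false_eq_true, List.nodup_nil, and_true] at six
      simp only [← ne_eq] at six
      obtain ⟨⟨s1, s2, s3, s4, s5⟩, ⟨s6, s7, s8, s9⟩, ⟨s10, s11, s12⟩, ⟨s13, s14⟩, s15⟩ := six
      rintro ⟨i, u⟩ ⟨j, v⟩ h
      fin_cases i <;> fin_cases j <;> cases u <;> cases v <;>
        first
        | rfl
        | exact absurd h (by assumption)
        | exact absurd h.symm (by assumption)
    have hn1 : ∀ z, Γ.next (f z) = f (if z.2 then z.1 + 1 else z.1 + 2, z.2) := by
      rintro ⟨i, u⟩
      fin_cases i <;> cases u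
      exacts [rfl, fa, fb, rfl, oa, ob]
    have hf1 : ∀ z, Γ.flip (f z) = f (z.1, !z.2) := by
      rintro ⟨i, u⟩
      fin_cases i <;> cases u
      exacts [rfl, hff a, hff b, rfl, (by show Γ.flip (Γ.next a) = Γ.next b; rw [← hth, hff]), hth]
    have hsurj : Function.Surjective f := by
      intro y
      refine forall_of_componentCount_eq_one hΓ.connected (P := fun y => ∃ z, f z = y) ?_ ?_
        (x := a) ⟨(0, false), rfl⟩ y
      · intro d
        constructor
        · rintro ⟨z, hz⟩
          refine ⟨(if z.2 then z.1 + 2 else z.1 + 1, z.2), hi ?_⟩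
          rw [hn1, ← hz]
          obtain ⟨i, u⟩ := z
          cases u <;> simp [add_assoc]
        · rintro ⟨z, rfl⟩; exact ⟨_, (hn1 z).symm⟩
      · intro d
        constructor
        · rintro ⟨z, hz⟩
          exact ⟨(z.1, !z.2), by rw [← hf1, hz, hff]⟩
        · rintro ⟨z, rfl⟩; exact ⟨_, (hf1 z).symm⟩
    have hiso : Iso (theta _ _ _ hadm) Γ := by
      refine ⟨Equiv.ofBijective f ⟨hinj, hsurj⟩, fun z => (hn1 z).symm, fun z => (hf1 z).symm, ?_⟩
      rintro ⟨i, u⟩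
      fin_cases i <;> cases u
      exacts [rfl, Γ.color_flip a, Γ.color_flip b, rfl, rfl,
        (by show Γ.color (Γ.next b) = Γ.color (Γ.next a); rw [← hth, Γ.color_flip])]
    exact ⟨hiso.symm.planar hΓ.planar, hΓ.planar, Or.inl (Or.inl hiso)⟩
  · obtain ⟨Γ', w, hw, hr, hg, hcard⟩ := hΓ.exists_whitehead hn l1 l2
    refine Generated.trans ?_ hg
    have hwi : ∀ {u v}, u ≠ v → w u ≠ w v := fun h => w.injective.ne h
    have m1 : Γ.flip b ≠ Γ.next (Γ.flip (Γ.next b)) := fun h => hth (hi (by rw [← h, oa]))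
    have m2 : Γ.flip b ≠ Γ.next (Γ.next (Γ.flip (Γ.next b))) := fun h => by
      have : a = Γ.flip (Γ.next b) := by rw [← fb, h, hcub]
      exact k2 (by rw [this, hff])
    refine hr.generated_of_triangle (fun Γ' hΓ' h => hsmall Γ' hΓ' (by omega))
      (a := w a) (b := w (Γ.next b)) (c := w b) ?_ ?_ ?_ (hwi k1.symm) (hwi (hne b)) (hwi hab) ?_ ?_ ?_
    · rw [hw.face_eq, ← ob, hw.next_e]
    · rw [hw.face_eq, hw.next_x', nb]
    · rw [hw.face_eq, hw.next_other, fb]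
      · exact k3.symm
      · rw [ob]; exact fun h => hab (Γ.flip_injective h).symm
      · rw [nb]; exact Γ.flip_ne b
      · exact fun h => hne b (Γ.flip_injective h).symm
      · exact m1
      · exact m2
    · rw [hw.flip_eq]; exact hwi k2.symm
    · rw [hw.flip_eq]; exact hwi gab
    · rw [hw.flip_eq]; exact hwi (by rwa [nb] at l2)

/-- A face with a single side can be enlarged to a face with two sides. -/
theorem Regular.generated_of_loop (hn : 1 ≤ n) (hΓ : Regular n Γ)
    (hsmall : ∀ Γ' : KTG, Regular n Γ' → Nat.card Γ'.Dart < Nat.card Γ.Dart → Generated Γ')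
    {a : Γ.Dart} (fa : Γ.face a = a) : Generated Γ := by
  have hff := Γ.flip_flip
  have hi : ∀ {a b}, Γ.next a = Γ.next b → a = b := fun h => Γ.next_injective h
  have hne := Γ.next_ne
  have na : Γ.next (Γ.next (Γ.next a)) = a := hΓ.cubic a
  rw [face] at fa
  have oa : Γ.next (Γ.next a) = Γ.flip a := hi (by rw [na, fa])
  have k1 : Γ.next a ≠ Γ.flip a := fun h => by rw [← h] at oa; exact hne _ oa
  obtain ⟨Γ', w, hw, hr, hg, hcard⟩ := hΓ.exists_whitehead hn (x := Γ.next a)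
    (by rw [oa]; exact fun h => hne a (Γ.flip_injective h))
    (by rw [na]; exact fun h => k1 (by rw [← h, hff, h]))
  refine Generated.trans ?_ hg
  refine hr.generated_of_bigon hn (fun Γ' hΓ' h => hsmall Γ' hΓ' (by omega))
    (a := w a) (b := w (Γ.next a)) ?_ ?_ (w.injective.ne (hne a).symm) ?_
  · rw [hw.face_eq, ← oa, hw.next_e]
  · rw [hw.face_eq, hw.next_x', na]
  · rw [hw.flip_eq]; exact w.injective.ne k1.symm

/-- The effect of a Whitehead move on a union `A` of faces: `flip x` leaves the face that contains
`next x`, and `x` the face that contains `next (flip x)`; they are inserted in front of the darts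
`k` and `g` at the two ends. -/
theorem IsWhitehead.exists_invariant {Γ' : KTG} (hc : Γ.Cubic) {w : Γ.Dart ≃ Γ'.Dart} {x : Γ.Dart}
    (hw : IsWhitehead Γ Γ' w x) {A : Set Γ.Dart} (hA : ∀ d, Γ.face d ∈ A ↔ d ∈ A) :
    ∃ A' : Set Γ'.Dart, (∀ d, Γ'.face d ∈ A' ↔ d ∈ A') ∧
      (w x ∈ A' ↔ Γ.next (Γ.next x) ∈ A) ∧
      (w (Γ.flip x) ∈ A' ↔ Γ.next (Γ.next (Γ.flip x)) ∈ A) ∧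
      ∀ d, d ≠ x → d ≠ Γ.flip x → (w d ∈ A' ↔ d ∈ A) := by
  classical
  have hface := hw.face_eq
  obtain ⟨h1, h2, hfl, hnx, hnk, hne, hny, hng, hnh, hnd, -⟩ := hw
  have six := hc.six_darts h1 h2
  have hi := Γ.next_injective
  have hx' := hc (Γ.flip x)
  have hx := hc x
  generalize he : Γ.next x = e at *
  generalize hg : Γ.next e = g at *
  generalize hy : Γ.flip x = y at *
  generalize hh : Γ.next y = h at *
  generalize hk : Γ.next h = k at *
  simp only [List.nodup_cons, List.mem_cons, List.not_mem_nil, or_false, not_or, not_false_eq_true,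
    List.nodup_nil, and_true] at six
  simp only [← ne_eq] at six
  obtain ⟨⟨xe, xg, xy, xh, xk⟩, ⟨eg, ey, eh, ek⟩, ⟨gy, gh, gk⟩, ⟨yh, yk⟩, hk'⟩ := six
  have hff := Γ.flip_flip
  have hyx : Γ.flip y = x := by rw [← hy, hff]
  obtain ⟨Q, q1, q2, q3⟩ : ∃ Q : Γ.Dart → Prop, (Q x ↔ g ∈ A) ∧ (Q y ↔ k ∈ A) ∧
      ∀ d, d ≠ x → d ≠ y → (Q d ↔ d ∈ A) := by
    refine ⟨fun d => if d = x then g ∈ A else if d = y then k ∈ A else d ∈ A, by simp,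
      by simp [xy.symm], ?_⟩
    intro d a b; simp [a, b]
  refine ⟨{d | Q (w.symm d)}, ?_, by simpa using q1, by simpa using q2, fun d a b => by
    simpa using q3 d a b⟩
  intro d'
  obtain ⟨d, rfl⟩ := w.surjective d'
  rw [hface]
  simp only [Set.mem_ofPred_eq, w.symm_apply_apply]
  have hAd := hA d
  rw [face] at hAd
  by_cases a : d = x
  · rw [a, hy, hny, w.symm_apply_apply, q1, q3 g xg.symm gy]
  by_cases b : d = y
  · rw [b, hyx, hnx, w.symm_apply_apply, q2, q3 k xk.symm yk.symm]
  have fx : Γ.flip d ≠ x := fun q => b (by rw [← hy, ← q, hff])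
  have fy : Γ.flip d ≠ y := fun q => a (by rw [← hyx, ← q, hff])
  have Ax : h ∈ A ↔ x ∈ A := by rw [← hA x, face, hy, hh]
  have Ay : e ∈ A ↔ y ∈ A := by rw [← hA y, face, hyx, he]
  rw [q3 d a b]
  by_cases f1 : Γ.flip d = e
  · rw [f1, hg] at hAd; rw [f1, hne, w.symm_apply_apply, q1, hAd]
  by_cases f2 : Γ.flip d = g
  · rw [f2, hx] at hAd; rw [f2, hng, w.symm_apply_apply, q3 h xh.symm yh.symm, Ax, hAd]
  by_cases f3 : Γ.flip d = h
  · rw [f3, hk] at hAd; rw [f3, hnh, w.symm_apply_apply, q2, hAd]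
  by_cases f4 : Γ.flip d = k
  · rw [f4, hx'] at hAd; rw [f4, hnk, w.symm_apply_apply, q3 e xe.symm ey, Ay, hAd]
  rw [hnd _ fx f1 f2 fy f3 f4, w.symm_apply_apply, q3, hAd]
  · exact fun q => f2 (hi (q.trans hx.symm))
  · exact fun q => f4 (hi (q.trans hx'.symm))

/-- Induction on the number of darts in a union `A` of faces, which is neither empty nor everything.
As long as the graph has no face with a single side, some Whitehead move makes `A` smaller. -/
theorem Regular.generated_of_invariant (hn : 1 ≤ n) (N : ℕ)
    (hsmall : ∀ Γ' : KTG, Regular n Γ' → Nat.card Γ'.Dart < N → Generated Γ') (m : ℕ) :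
    ∀ Γ : KTG, Regular n Γ → Nat.card Γ.Dart = N → ∀ A : Set Γ.Dart,
      (∀ d, Γ.face d ∈ A ↔ d ∈ A) → A.Nonempty → A ≠ Set.univ → A.ncard = m → Generated Γ := by
  induction m using Nat.strong_induction_on with
  | _ m ih =>
  intro Γ hΓ hN A hA hne huniv hm
  subst hN
  by_cases hloop : ∃ a, Γ.face a = a
  · obtain ⟨a, ha⟩ := hloop
    exact hΓ.generated_of_loop hn hsmall ha
  push Not at hloop
  have hff := Γ.flip_flip
  have hi : ∀ {a b}, Γ.next a = Γ.next b → a = b := fun h => Γ.next_injective h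
  have hcub := hΓ.cubic
  have nl2 : ∀ x, Γ.flip x ≠ Γ.next (Γ.next x) := by
    intro x h
    apply hloop x
    rw [face, h, hcub]
  have nl1 : ∀ x, Γ.flip x ≠ Γ.next x := by
    intro x h
    apply hloop (Γ.flip x)
    rw [face, hff, h]
  -- by `exists_invariant`, the Whitehead move at `x` makes `A` smaller under these conditions
  have reduce : ∀ x ∈ A, (Γ.next (Γ.next (Γ.flip x)) ∈ A → Γ.flip x ∈ A) →
      (Γ.next (Γ.next x) ∈ A → Γ.flip x ∈ A) →
      ¬ (Γ.next (Γ.next x) ∈ A ∧ Γ.next (Γ.next (Γ.flip x)) ∈ A) → Generated Γ := by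
    intro x hx hx1 hx2 hx3
    obtain ⟨Γ', w, hw, hr, hg, hcard⟩ := hΓ.exists_whitehead hn (nl1 x) (nl2 x)
    obtain ⟨A', hA', a1, a2, a3⟩ := hw.exists_invariant hcub hA
    refine Generated.trans ?_ hg
    have hh : Γ.next (Γ.flip x) ∈ A := (hA x).mpr hx
    have hsix := hcub.six_darts (nl1 x) (nl2 x)
    simp only [List.nodup_cons, List.mem_cons, List.not_mem_nil, or_false, not_or] at hsix
    have hsub : ∀ d, w d ∈ A' → d ∈ A := by
      intro d hd
      by_cases h1 : d = x
      · rwa [h1]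
      by_cases h2 : d = Γ.flip x
      · rw [h2] at hd ⊢; exact hx1 (a2.mp hd)
      exact (a3 d h1 h2).mp hd
    have hlt : A'.ncard < m := by
      rw [← hm, ← Set.ncard_preimage_of_injective_subset_range w.injective (s := A') (by simp)]
      refine Set.ncard_lt_ncard ⟨hsub, fun hsup => hx3 ?_⟩
      have hgA := a1.mp (hsup hx)
      exact ⟨hgA, a2.mp (hsup (hx2 hgA))⟩
    refine ih _ hlt Γ' hr hcard A' hA' ⟨w (Γ.next (Γ.flip x)), ?_⟩ ?_ rfl
    · refine (a3 _ ?_ ?_).mpr hh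
      · exact fun h => hsix.1.2.2.2.1 h.symm
      · exact Γ.next_ne _
    · obtain ⟨y, hy⟩ := (Set.ne_univ_iff_exists_notMem A).mp huniv
      exact fun h => hy (hsub y (h ▸ Set.mem_univ _))
  have prev : ∀ d, Γ.next d ∈ A → Γ.flip d ∈ A := fun d h => by
    rw [← hA, face, hff]; exact h
  by_cases htwo : ∃ x, x ∈ A ∧ Γ.flip x ∈ A
  · -- some edge has both sides in `A`
    by_cases hex : ∃ x, (x ∈ A ∧ Γ.flip x ∈ A) ∧
        ¬ (Γ.next (Γ.next x) ∈ A ∧ Γ.next (Γ.next (Γ.flip x)) ∈ A)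
    · obtain ⟨x, ⟨h1, h2⟩, h3⟩ := hex
      exact reduce x h1 (fun _ => h2) (fun _ => h2) h3
    push Not at hex
    -- otherwise the darts of the edges with both sides in `A` are all the darts
    have hnext : ∀ d, (d ∈ A ∧ Γ.flip d ∈ A) → (Γ.next d ∈ A ∧ Γ.flip (Γ.next d) ∈ A) := by
      intro d hd
      refine ⟨?_, prev _ (hex d hd).1⟩
      have := (hA (Γ.flip d)).mpr hd.2
      rwa [face, hff] at this
    obtain ⟨x, hx⟩ := htwo
    have hall := forall_of_componentCount_eq_one hΓ.connected
      (P := fun d => d ∈ A ∧ Γ.flip d ∈ A) (fun d => ⟨fun h => ?_, hnext d⟩)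
      (fun d => by rw [hff]; exact and_comm) hx
    · exact absurd (Set.eq_univ_of_forall fun d => (hall d).1) huniv
    · have := hnext _ (hnext _ h)
      rwa [hcub] at this
  · -- no edge has both sides in `A`: any side of `A` will do
    push Not at htwo
    obtain ⟨x, hx⟩ := hne
    have hg : Γ.next (Γ.next x) ∉ A := fun h => by
      refine htwo _ h (prev _ ?_)
      rwa [hcub]
    refine reduce x hx (fun h => absurd (prev _ h) (htwo _ ((hA x).mpr hx))) (fun h => absurd h hg)
      (fun h => hg h.1)

/-- A planar graph without vertices of valence one has at least two faces. -/
theorem two_le_faces {Γ : KTG} (hp : Γ.Planar) (hc : Γ.components = 1) :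
    2 ≤ orbitCount Γ.face := by
  have h1 := two_mul_orbitCount_le Γ.next_ne
  have h2 := Γ.two_mul_edges
  rw [planar_iff, hc] at hp
  omega

/-- Strong induction on the number of darts; the initial set of faces is a single face. -/
theorem Regular.generated (hn : 1 ≤ n) : ∀ {Γ : KTG}, Regular n Γ → Generated Γ := by
  suffices ∀ N : ℕ, ∀ Γ : KTG, Regular n Γ → Nat.card Γ.Dart = N → Generated Γ from
    fun {Γ} h => this _ Γ h rfl
  intro N
  induction N using Nat.strong_induction_on with
  | _ N ih =>
  intro Γ hΓ hN
  have h2 := two_le_faces hΓ.planar hΓ.connected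
  have : Nontrivial (Orbit Γ.face) := Finite.one_lt_card_iff_nontrivial.mp h2
  obtain ⟨u, v, huv⟩ := exists_pair_ne (Orbit Γ.face)
  rcases u with ⟨u⟩
  rcases v with ⟨v⟩
  refine Regular.generated_of_invariant hn N (fun Γ' h h' => ih _ h' Γ' h rfl) _ Γ hΓ hN
    {d | orb Γ.face d = orb Γ.face u} (fun d => ?_) ⟨u, rfl⟩ (fun h => huv ?_) rfl
  · simp only [Set.mem_ofPred_eq, orb_apply]
  · have : v ∈ {d | orb Γ.face d = orb Γ.face u} := h ▸ Set.mem_univ v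
    exact this.symm

end Reduction

end KTG

namespace KTG

/-! ### Fusing strands of different components -/

/-- `FusionMove` with its data made explicit. -/
structure IsFusion (Γ Γ' : KTG) (ι : Γ.Dart → Γ'.Dart) (a b c d : Γ.Dart) (p q : Γ'.Dart) :
    Prop where
  injective : Function.Injective ι
  mem_range : ∀ y, y ∈ Set.range ι ↔ y ≠ p ∧ y ≠ q
  old_a : Γ.next a = d
  old_d : Γ.next d = a
  old_b : Γ.next b = c
  old_c : Γ.next c = b
  next_p : Γ'.next p = ι a
  next_a : Γ'.next (ι a) = ι b
  next_b : Γ'.next (ι b) = p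
  next_q : Γ'.next q = ι c
  next_c : Γ'.next (ι c) = ι d
  next_d : Γ'.next (ι d) = q
  flip_p : Γ'.flip p = q
  flip_eq : ∀ x, Γ'.flip (ι x) = ι (Γ.flip x)
  next_other : ∀ x, x ≠ a → x ≠ b → x ≠ c → x ≠ d → Γ'.next (ι x) = ι (Γ.next x)
  color_eq : ∀ x, Γ'.color (ι x) = Γ.color x

theorem IsFusion.fusionMove {Γ Γ' : KTG} {ι : Γ.Dart → Γ'.Dart} {a b c d : Γ.Dart}
    {p q : Γ'.Dart} (h : IsFusion Γ Γ' ι a b c d p q) : FusionMove Γ Γ' := by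
  obtain ⟨h1, h2, h3, h4, h5, h6, h7, h8, h9, h10, h11, h12, h13, h14, h15, h16⟩ := h
  exact ⟨ι, a, b, c, d, p, q, h1, h2, h3, h4, h5, h6, h7, h8, h9, h10, h11, h12, h13, h14, h15, h16⟩

/-- Two strands through different marked points can be fused along an edge of color `e`. -/
theorem exists_isFusion (Γ : KTG) {a b : Γ.Dart} (ha : Γ.next (Γ.next a) = a)
    (hb : Γ.next (Γ.next b) = b) (hab : a ≠ b) (hab' : Γ.next a ≠ b) (e : ℕ)
    (hadm : AdmissibleTriple e (Γ.color a) (Γ.color b)) :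
    ∃ (Γ' : KTG) (ι : Γ.Dart → Γ'.Dart) (p q : Γ'.Dart),
      IsFusion Γ Γ' ι a b (Γ.next b) (Γ.next a) p q ∧ Γ'.color p = e := by
  classical
  have hi := Γ.next_injective
  generalize hd : Γ.next a = d at *
  generalize hc : Γ.next b = c at *
  have ad : a ≠ d := fun h => Γ.next_ne a (hd.trans h.symm)
  have bc : b ≠ c := fun h => Γ.next_ne b (hc.trans h.symm)
  have cd : c ≠ d := fun h => hab (hi (hd.trans (h.symm.trans hc.symm)))
  have ac : a ≠ c := fun h => hab' (by rw [← hb, ← h, hd])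
  have cold : Γ.color d = Γ.color a := by rw [← hd]; exact Γ.color_bivalent a (by rw [hd, ha])
  have colc : Γ.color c = Γ.color b := by rw [← hc]; exact Γ.color_bivalent b (by rw [hc, hb])
  let nx : Γ.Dart ⊕ Bool → Γ.Dart ⊕ Bool := fun y => match y with
    | Sum.inl x => if x = a then Sum.inl b else if x = b then Sum.inr true else
        if x = c then Sum.inl d else if x = d then Sum.inr false else Sum.inl (Γ.next x)
    | Sum.inr u => if u then Sum.inl a else Sum.inl c
  have na : nx (Sum.inl a) = Sum.inl b := by simp [nx]
  have nb : nx (Sum.inl b) = Sum.inr true := by simp [nx, hab.symm]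
  have nc : nx (Sum.inl c) = Sum.inl d := by simp [nx, ac.symm, bc.symm]
  have nd : nx (Sum.inl d) = Sum.inr false := by simp [nx, ad.symm, hab', cd.symm]
  have np : nx (Sum.inr true) = Sum.inl a := rfl
  have nq : nx (Sum.inr false) = Sum.inl c := rfl
  have no : ∀ x, x ≠ a → x ≠ b → x ≠ c → x ≠ d → nx (Sum.inl x) = Sum.inl (Γ.next x) := by
    intro x h1 h2 h3 h4; simp [nx, h1, h2, h3, h4]
  have hcase : ∀ y, y = Sum.inl a ∨ y = Sum.inl b ∨ y = Sum.inl c ∨ y = Sum.inl d ∨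
      y = Sum.inr true ∨ y = Sum.inr false ∨
      ∃ x, (x ≠ a ∧ x ≠ b ∧ x ≠ c ∧ x ≠ d) ∧ y = Sum.inl x := by
    rintro (x | u)
    · by_cases h1 : x = a; · simp [h1]
      by_cases h2 : x = b; · simp [h2]
      by_cases h3 : x = c; · simp [h3]
      by_cases h4 : x = d; · simp [h4]
      simp [h1, h2, h3, h4]
    · cases u <;> simp
  have hpres : ∀ x, (x ≠ a ∧ x ≠ b ∧ x ≠ c ∧ x ≠ d) →
      (Γ.next x ≠ a ∧ Γ.next x ≠ b ∧ Γ.next x ≠ c ∧ Γ.next x ≠ d) := by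
    rintro x ⟨h1, h2, h3, h4⟩
    exact ⟨fun h => h4 (hi (h.trans ha.symm)), fun h => h3 (hi (h.trans hb.symm)),
      fun h => h2 (hi (h.trans hc.symm)), fun h => h1 (hi (h.trans hd.symm))⟩
  let Γ' : KTG :=
    { Dart := Γ.Dart ⊕ Bool
      finite_dart := inferInstance
      next := nx
      flip := Sum.map Γ.flip not
      color := Sum.elim Γ.color fun _ => e
      flip_flip := by rintro (x | u) <;> simp [Γ.flip_flip]
      flip_ne := by
        rintro (x | u)
        · simpa using Γ.flip_ne x
        · simp
      next_ne := by
        intro y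
        rcases hcase y with rfl | rfl | rfl | rfl | rfl | rfl | ⟨x, ⟨h1, h2, h3, h4⟩, rfl⟩
        · rw [na]; simpa using hab.symm
        · rw [nb]; simp
        · rw [nc]; simpa using cd.symm
        · rw [nd]; simp
        · rw [np]; simp
        · rw [nq]; simp
        · rw [no x h1 h2 h3 h4]; simpa using Γ.next_ne x
      valence := by
        intro y
        rcases hcase y with rfl | rfl | rfl | rfl | rfl | rfl | ⟨x, hx, rfl⟩
        · right; rw [na, nb, np]
        · right; rw [nb, np, na]
        · right; rw [nc, nd, nq]
        · right; rw [nd, nq, nc]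
        · right; rw [np, na, nb]
        · right; rw [nq, nc, nd]
        · obtain ⟨k1, k2, k3, k4⟩ := hpres x hx
          obtain ⟨l1, l2, l3, l4⟩ := hpres _ (hpres x hx)
          obtain ⟨h1, h2, h3, h4⟩ := hx
          rw [no x h1 h2 h3 h4, no _ k1 k2 k3 k4, no _ l1 l2 l3 l4]
          simpa using Γ.valence x
      color_flip := by
        rintro (x | u)
        · exact Γ.color_flip x
        · rfl
      color_bivalent := by
        intro y hy
        rcases hcase y with rfl | rfl | rfl | rfl | rfl | rfl | ⟨x, hx, rfl⟩
        · rw [na, nb] at hy; simp at hy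
        · rw [nb, np] at hy; exact absurd (Sum.inl.inj hy) hab
        · rw [nc, nd] at hy; simp at hy
        · rw [nd, nq] at hy; exact absurd (Sum.inl.inj hy) cd
        · rw [np, na] at hy; simp at hy
        · rw [nq, nc] at hy; simp at hy
        · obtain ⟨k1, k2, k3, k4⟩ := hpres x hx
          obtain ⟨h1, h2, h3, h4⟩ := hx
          rw [no x h1 h2 h3 h4, no _ k1 k2 k3 k4] at hy
          rw [no x h1 h2 h3 h4]
          exact Γ.color_bivalent x (Sum.inl.inj hy)
      admissible := by
        intro y hy
        rcases hcase y with rfl | rfl | rfl | rfl | rfl | rfl | ⟨x, hx, rfl⟩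
        · rw [na, nb]; exact hadm.rotate
        · rw [nb, np]; exact hadm.rotate.rotate
        · rw [nc, nd]
          show AdmissibleTriple (Γ.color c) (Γ.color d) e
          rw [colc, cold]; exact hadm.rotate.swap.rotate.rotate
        · rw [nd, nq]
          show AdmissibleTriple (Γ.color d) e (Γ.color c)
          rw [colc, cold]; exact hadm.swap.rotate.rotate
        · rw [np, na]; exact hadm
        · rw [nq, nc]
          show AdmissibleTriple e (Γ.color c) (Γ.color d)
          rw [colc, cold]; exact hadm.swap
        · obtain ⟨k1, k2, k3, k4⟩ := hpres x hx
          obtain ⟨l1, l2, l3, l4⟩ := hpres _ (hpres x hx)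
          obtain ⟨h1, h2, h3, h4⟩ := hx
          rw [no x h1 h2 h3 h4, no _ k1 k2 k3 k4, no _ l1 l2 l3 l4] at hy
          rw [no x h1 h2 h3 h4, no _ k1 k2 k3 k4]
          exact Γ.admissible x (Sum.inl.inj hy) }
  refine ⟨Γ', Sum.inl, Sum.inr true, Sum.inr false, ⟨Sum.inl_injective, ?_, hd, ha, hc, hb, np, na,
    nb, nq, nc, nd, rfl, fun _ => rfl, no, fun _ => rfl⟩, rfl⟩
  rintro (x | u)
  · exact ⟨fun _ => ⟨Sum.inl_ne_inr, Sum.inl_ne_inr⟩, fun _ => ⟨x, rfl⟩⟩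
  · refine ⟨fun ⟨_, h⟩ => absurd h Sum.inl_ne_inr, fun h => ?_⟩
    cases u
    · exact absurd rfl h.2
    · exact absurd rfl h.1

/-- Fusing strands of different components of a planar graph connects these components in a planar
way: the numbers of faces and of components both drop by one. -/
theorem IsFusion.invariants {Γ Γ' : KTG} {ι : Γ.Dart → Γ'.Dart} {a b c d : Γ.Dart}
    {p q : Γ'.Dart} (h : IsFusion Γ Γ' ι a b c d p q)
    (hab : comp Γ.next Γ.flip a ≠ comp Γ.next Γ.flip b) :
    Γ.components = Γ'.components + 1 ∧ (Γ.Planar → Γ'.Planar) := by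
  classical
  obtain ⟨hι, hr, oa, od, ob, oc, np, na, nb, nq, nc, nd, fp, fl, no, -⟩ := h
  have fq : Γ'.flip q = p := by rw [← fp, Γ'.flip_flip]
  have hff := Γ.flip_flip
  have hpq : p ≠ q := fun h => Γ'.flip_ne p (fp.trans h.symm)
  have ιp : ∀ x, ι x ≠ p := fun x h => ((hr p).mp ⟨x, h⟩).1 rfl
  have ιq : ∀ x, ι x ≠ q := fun x h => ((hr q).mp ⟨x, h⟩).2 rfl
  have hcase : ∀ y, y = p ∨ y = q ∨ ∃ x, y = ι x := by
    intro y
    by_cases hy : y = p; · exact Or.inl hy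
    by_cases hy' : y = q; · exact Or.inr (Or.inl hy')
    obtain ⟨d, hd⟩ := (hr y).mpr ⟨hy, hy'⟩
    exact Or.inr (Or.inr ⟨d, hd.symm⟩)
  have cda : comp Γ.next Γ.flip d = comp Γ.next Γ.flip a := by rw [← oa, comp_left]
  have ccb : comp Γ.next Γ.flip c = comp Γ.next Γ.flip b := by rw [← ob, comp_left]
  have nab : a ≠ b := fun h => hab (by rw [h])
  have nac : a ≠ c := fun h => hab (by rw [h, ccb])
  have ndb : d ≠ b := fun h => hab (by rw [← h, cda])
  have ndc : d ≠ c := fun h => hab (by rw [← cda, h, ccb])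
  have nad : a ≠ d := fun h => Γ.next_ne a (oa.trans h.symm)
  have nbc : b ≠ c := fun h => Γ.next_ne b (ob.trans h.symm)
  have hxcase : ∀ x, x = a ∨ x = b ∨ x = c ∨ x = d ∨ (x ≠ a ∧ x ≠ b ∧ x ≠ c ∧ x ≠ d) := by
    intro x; tauto
  have hfun : ∀ {X : Type} (F : Γ.Dart → X) (P Q : X),
      ∃ f : Γ'.Dart → X, (∀ d, f (ι d) = F d) ∧ f p = P ∧ f q = Q := by
    intro X F P Q
    refine ⟨fun y => if y = p then P else if h : ∃ d, ι d = y then F h.choose else Q,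
      fun d => ?_, by simp, ?_⟩
    · have hd : ∃ d', ι d' = ι d := ⟨d, rfl⟩
      simp only [ιp, if_false, dif_pos hd]
      exact congrArg F (hι hd.choose_spec)
    · simp [hpq.symm, ιq]
  have hD : Nat.card Γ'.Dart = Nat.card Γ.Dart + 2 := by
    have e : Function.Bijective (Sum.elim ι (fun b : Bool => if b then p else q)) := by
      constructor
      · rintro (a | a) (b | b) hab
        · exact congrArg _ (hι hab)
        · cases b <;> simp [ιp, ιq] at hab
        · cases a <;> simp [(ιp _).symm, (ιq _).symm] at hab
        · cases a <;> cases b <;> simp [hpq, hpq.symm] at hab ⊢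
      · intro y
        rcases hcase y with rfl | rfl | ⟨d, rfl⟩
        exacts [⟨Sum.inr true, by simp⟩, ⟨Sum.inr false, by simp⟩, ⟨Sum.inl d, rfl⟩]
    rw [← Nat.card_congr (Equiv.ofBijective _ e), Nat.card_sum]
    simp
  have hE : orbitCount Γ'.flip = orbitCount Γ.flip + 1 := by
    have := Γ.two_mul_edges
    have := Γ'.two_mul_edges
    omega
  have hC : Γ.components = Γ'.components + 1 := by
    refine (card_quot_merge _ a b hab).trans (congrArg (· + 1) ?_)
    obtain ⟨f, f1, f2, f3⟩ := hfun id a a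
    simp only [id] at f1
    set r : Γ.Dart → Γ.Dart → Prop :=
      fun x y => (Γ.next x = y ∨ Γ.flip x = y) ∨ (x = a ∧ y = b) with hr
    have rn : ∀ x, Quot.mk r (Γ.next x) = Quot.mk r x := fun x => by
      symm; exact Quot.sound (Or.inl (Or.inl rfl))
    have rf : ∀ x, Quot.mk r (Γ.flip x) = Quot.mk r x := fun x => by
      symm; exact Quot.sound (Or.inl (Or.inr rfl))
    have rb : Quot.mk r b = Quot.mk r a := by
      symm; exact Quot.sound (Or.inr ⟨rfl, rfl⟩)
    have rd : Quot.mk r d = Quot.mk r a := by rw [← oa, rn]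
    have rc : Quot.mk r c = Quot.mk r a := by rw [← ob, rn, rb]
    have sa : comp Γ'.next Γ'.flip (ι a) = comp Γ'.next Γ'.flip p := by rw [← np, comp_left]
    have sb : comp Γ'.next Γ'.flip (ι b) = comp Γ'.next Γ'.flip p := by rw [← na, comp_left, sa]
    have sq : comp Γ'.next Γ'.flip q = comp Γ'.next Γ'.flip p := by rw [← fp, comp_right]
    have sc : comp Γ'.next Γ'.flip (ι c) = comp Γ'.next Γ'.flip p := by rw [← nq, comp_left, sq]
    have sd : comp Γ'.next Γ'.flip (ι d) = comp Γ'.next Γ'.flip p := by rw [← nc, comp_left, sc]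
    refine card_quot_congr ι f ?_ ?_ ?_ ?_
    · rintro x _ ((rfl | rfl) | ⟨rfl, rfl⟩)
      · rcases hxcase x with rfl | rfl | rfl | rfl | ⟨h1, h2, h3, h4⟩
        · rw [oa]; exact sa.trans sd.symm
        · rw [ob]; exact sb.trans sc.symm
        · rw [oc]; exact sc.trans sb.symm
        · rw [od]; exact sd.trans sa.symm
        · rw [← no x h1 h2 h3 h4]; exact (comp_left _ _ _).symm
      · rw [← fl]; exact (comp_right _ _ _).symm
      · exact sa.trans sb.symm
    · rintro y _ (rfl | rfl)
      · rcases hcase y with rfl | rfl | ⟨x, rfl⟩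
        · rw [np, f1, f2]
        · rw [nq, f1, f3, rc]
        · rcases hxcase x with rfl | rfl | rfl | rfl | ⟨h1, h2, h3, h4⟩
          · rw [na, f1, f1, rb]
          · rw [nb, f1, f2, rb]
          · rw [nc, f1, f1, rc, rd]
          · rw [nd, f1, f3, rd]
          · rw [no x h1 h2 h3 h4, f1, f1, rn]
      · rcases hcase y with rfl | rfl | ⟨x, rfl⟩
        · rw [fp, f2, f3]
        · rw [fq, f2, f3]
        · rw [fl, f1, f1, rf]
    · intro x; rw [f1]
    · intro y
      rcases hcase y with rfl | rfl | ⟨x, rfl⟩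
      · rw [f2]; exact sa
      · rw [f3]; exact sa.trans sq.symm
      · rw [f1]
  refine ⟨hC, fun hp => ?_⟩
  have hV : orbitCount Γ'.next = orbitCount Γ.next := by
    obtain ⟨f, f1, f2, f3⟩ := hfun (fun x => if x = a ∨ x = b then a else if x = c ∨ x = d then b
      else x) a b
    have fa : f (ι a) = a := by simp [f1]
    have fb : f (ι b) = a := by simp [f1]
    have fc : f (ι c) = b := by simp [f1, nac.symm, nbc.symm]
    have fd : f (ι d) = b := by simp [f1, nad.symm, ndb]
    have fo : ∀ x, x ≠ a → x ≠ b → x ≠ c → x ≠ d → f (ι x) = x := by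
      intro x h1 h2 h3 h4; simp [f1, h1, h2, h3, h4]
    obtain ⟨g, ga, gd, gb, gc, go⟩ : ∃ g : Γ.Dart → Γ'.Dart, g a = p ∧ g d = p ∧ g b = q ∧
        g c = q ∧ ∀ x, x ≠ a → x ≠ b → x ≠ c → x ≠ d → g x = ι x := by
      refine ⟨fun x => if x = a ∨ x = d then p else if x = b ∨ x = c then q else ι x,
        by simp, by simp, by simp [nab.symm, ndb.symm], by simp [nac.symm, ndc.symm], ?_⟩
      intro x h1 h2 h3 h4; simp [h1, h2, h3, h4]
    have hpres : ∀ x, (x ≠ a ∧ x ≠ b ∧ x ≠ c ∧ x ≠ d) →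
        (Γ.next x ≠ a ∧ Γ.next x ≠ b ∧ Γ.next x ≠ c ∧ Γ.next x ≠ d) := by
      have hi := Γ.next_injective
      rintro x ⟨h1, h2, h3, h4⟩
      exact ⟨fun h => h4 (hi (h.trans od.symm)), fun h => h3 (hi (h.trans oc.symm)),
        fun h => h2 (hi (h.trans ob.symm)), fun h => h1 (hi (h.trans oa.symm))⟩
    have sa : orb Γ'.next (ι a) = orb Γ'.next p := by rw [← np, orb_apply]
    have sb : orb Γ'.next (ι b) = orb Γ'.next p := by rw [← na, orb_apply, sa]
    have sc : orb Γ'.next (ι c) = orb Γ'.next q := by rw [← nq, orb_apply]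
    have sd : orb Γ'.next (ι d) = orb Γ'.next q := by rw [← nc, orb_apply, sc]
    refine orbitCount_congr f g ?_ ?_ ?_ ?_
    · intro y
      rcases hcase y with rfl | rfl | ⟨x, rfl⟩
      · rw [np, fa, f2]
      · rw [nq, fc, f3]
      · rcases hxcase x with rfl | rfl | rfl | rfl | hx
        · rw [na, fa, fb]
        · rw [nb, fb, f2]
        · rw [nc, fc, fd]
        · rw [nd, fd, f3]
        · obtain ⟨k1, k2, k3, k4⟩ := hpres x hx
          obtain ⟨h1, h2, h3, h4⟩ := hx
          rw [no x h1 h2 h3 h4, fo x h1 h2 h3 h4, fo _ k1 k2 k3 k4, orb_apply]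
    · intro x
      rcases hxcase x with rfl | rfl | rfl | rfl | hx
      · rw [oa, ga, gd]
      · rw [ob, gb, gc]
      · rw [oc, gb, gc]
      · rw [od, ga, gd]
      · obtain ⟨k1, k2, k3, k4⟩ := hpres x hx
        obtain ⟨h1, h2, h3, h4⟩ := hx
        rw [go x h1 h2 h3 h4, go _ k1 k2 k3 k4, ← no x h1 h2 h3 h4, orb_apply]
    · intro y
      rcases hcase y with rfl | rfl | ⟨x, rfl⟩
      · rw [f2, ga]
      · rw [f3, gb]
      · rcases hxcase x with rfl | rfl | rfl | rfl | ⟨h1, h2, h3, h4⟩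
        · rw [fa, ga, sa]
        · rw [fb, ga, sb]
        · rw [fc, gb, sc]
        · rw [fd, gb, sd]
        · rw [fo x h1 h2 h3 h4, go x h1 h2 h3 h4]
    · intro x
      rcases hxcase x with rfl | rfl | rfl | rfl | ⟨h1, h2, h3, h4⟩
      · rw [ga, f2]
      · rw [gb, f3]
      · rw [gc, f3, ← ob, orb_apply]
      · rw [gd, f2, ← oa, orb_apply]
      · rw [go x h1 h2 h3 h4, fo x h1 h2 h3 h4]
  have hF : orbitCount Γ.face = orbitCount Γ'.face + 1 := by
    have fA : ∀ u, Γ.flip u = a → Γ.face u = d ∧ Γ'.face (ι u) = ι b := fun u h =>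
      ⟨by rw [face, h, oa], by rw [face, fl, h, na]⟩
    have fB : ∀ u, Γ.flip u = b → Γ.face u = c ∧ Γ'.face (ι u) = p := fun u h =>
      ⟨by rw [face, h, ob], by rw [face, fl, h, nb]⟩
    have fC : ∀ u, Γ.flip u = c → Γ.face u = b ∧ Γ'.face (ι u) = ι d := fun u h =>
      ⟨by rw [face, h, oc], by rw [face, fl, h, nc]⟩
    have fD : ∀ u, Γ.flip u = d → Γ.face u = a ∧ Γ'.face (ι u) = q := fun u h =>
      ⟨by rw [face, h, od], by rw [face, fl, h, nd]⟩
    have fO : ∀ u, Γ.flip u ≠ a → Γ.flip u ≠ b → Γ.flip u ≠ c → Γ.flip u ≠ d →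
        Γ'.face (ι u) = ι (Γ.face u) := fun u h1 h2 h3 h4 => by rw [face, fl, no _ h1 h2 h3 h4, face]
    have fP : Γ'.face p = ι c := by rw [face, fp, nq]
    have fQ : Γ'.face q = ι a := by rw [face, fq, np]
    -- the faces of `d` and `b` are different, since they lie in different components
    have horb : ∀ x y, orb Γ.face x = orb Γ.face y →
        comp Γ.next Γ.flip x = comp Γ.next Γ.flip y := by
      intro x y hxy
      have hl : ∀ u v, Γ.face u = v → comp Γ.next Γ.flip u = comp Γ.next Γ.flip v := by
        rintro u _ rfl
        rw [face, comp_left, comp_right]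
      exact congrArg (Quot.lift (comp Γ.next Γ.flip) hl) hxy
    have hdb : orb Γ.face d ≠ orb Γ.face b := fun h => hab (by rw [← cda, horb _ _ h])
    -- the walk around the face of `d` stays in one face of `Γ'` until it comes to `flip a`, where it
    -- passes to `b`; so the two faces are merged
    have hstep : ∀ u, Γ.flip u ≠ a → Γ.flip u ≠ c →
        orb Γ'.face (ι (Γ.face u)) = orb Γ'.face (ι u) := by
      intro u h1 h2
      by_cases h3 : Γ.flip u = b
      · rw [(fB u h3).1, ← fP, orb_apply, ← (fB u h3).2, orb_apply]
      by_cases h4 : Γ.flip u = d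
      · rw [(fD u h4).1, ← fQ, orb_apply, ← (fD u h4).2, orb_apply]
      rw [← fO u h1 h3 h2 h4, orb_apply]
    have hwalk : ∀ k : ℕ, orb Γ'.face (ι (Γ.face^[k] d)) = orb Γ'.face (ι d) ∧
        orb Γ.face (Γ.face^[k] d) = orb Γ.face d := by
      intro k
      induction k with
      | zero => exact ⟨rfl, rfl⟩
      | succ k ih =>
        rw [Function.iterate_succ_apply']
        refine ⟨?_, by rw [orb_apply, ih.2]⟩
        by_cases h1 : Γ.flip (Γ.face^[k] d) = a
        · rw [(fA _ h1).1]
        by_cases h2 : Γ.flip (Γ.face^[k] d) = c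
        · have := orb_apply Γ.face (Γ.face^[k] d)
          rw [(fC _ h2).1, ih.2] at this
          exact absurd this.symm hdb
        rw [hstep _ h1 h2, ih.1]
    have key : orb Γ'.face (ι d) = orb Γ'.face (ι b) := by
      obtain ⟨m, hm, hper⟩ := Γ.face_injective.mem_periodicPts d
      obtain ⟨k, rfl⟩ := Nat.exists_eq_succ_of_ne_zero hm.ne'
      have hk : Γ.face^[k] d = Γ.flip a := by
        apply Γ.face_injective
        rw [← Function.iterate_succ_apply' Γ.face, (fA (Γ.flip a) (hff a)).1]
        exact hper
      rw [← (hwalk k).1, hk, ← (fA (Γ.flip a) (hff a)).2, orb_apply]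
    refine (card_quot_merge _ d b hdb).trans (congrArg (· + 1) ?_)
    obtain ⟨f, f1, f2, f3⟩ := hfun id c a
    simp only [id] at f1
    set r : Γ.Dart → Γ.Dart → Prop := fun x y => Γ.face x = y ∨ (x = d ∧ y = b) with hr
    have rn : ∀ x, Quot.mk r (Γ.face x) = Quot.mk r x := fun x => by
      symm; exact Quot.sound (Or.inl rfl)
    have rb : Quot.mk r b = Quot.mk r d := by
      symm; exact Quot.sound (Or.inr ⟨rfl, rfl⟩)
    refine card_quot_congr ι f ?_ ?_ ?_ ?_
    · rintro x _ (rfl | ⟨rfl, rfl⟩)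
      · by_cases h1 : Γ.flip x = a
        · rw [(fA x h1).1]
          exact (orb_apply Γ'.face (ι x)).symm.trans (by rw [(fA x h1).2]; exact key.symm)
        by_cases h2 : Γ.flip x = c
        · rw [(fC x h2).1]
          exact (orb_apply Γ'.face (ι x)).symm.trans (by rw [(fC x h2).2]; exact key)
        exact (hstep x h1 h2).symm
      · exact key
    · rintro y _ rfl
      rcases hcase y with rfl | rfl | ⟨x, rfl⟩
      · rw [fP, f1, f2]
      · rw [fQ, f1, f3]
      · by_cases h1 : Γ.flip x = a
        · rw [(fA x h1).2, f1, f1, ← rn x, (fA x h1).1, rb]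
        by_cases h2 : Γ.flip x = b
        · rw [(fB x h2).2, f1, f2, ← rn x, (fB x h2).1]
        by_cases h3 : Γ.flip x = c
        · rw [(fC x h3).2, f1, f1, ← rn x, (fC x h3).1, rb]
        by_cases h4 : Γ.flip x = d
        · rw [(fD x h4).2, f1, f3, ← rn x, (fD x h4).1]
        rw [fO x h1 h2 h3 h4, f1, f1, rn]
    · intro x; rw [f1]
    · intro y
      rcases hcase y with rfl | rfl | ⟨x, rfl⟩
      · rw [f2, ← fP]; exact orb_apply _ _
      · rw [f3, ← fQ]; exact orb_apply _ _
      · rw [f1]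
  rw [KTG.planar_iff] at hp ⊢
  omega

end KTG

namespace KTG

/-! ### From cubic connected graphs to all planar graphs -/

/-- The planar graph with two loops of color `k` joined by an edge of color `2 * n`.  The second
component of a dart is the vertex, and the first is `0` for the joining edge. -/
def dumbbell (n k : ℕ) (h : AdmissibleTriple (2 * n) k k) : KTG where
  Dart := Fin 3 × Bool
  finite_dart := inferInstance
  next d := (d.1 + 1, d.2)
  flip d := (![0, 2, 1] d.1, if d.1 = 0 then !d.2 else d.2)
  color d := ![2 * n, k, k] d.1
  flip_flip := by decide
  flip_ne := by decide
  next_ne := by decide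
  valence := by decide
  color_flip := by
    rintro ⟨i, u⟩
    fin_cases i <;> rfl
  color_bivalent d hd := absurd hd (by revert d; decide)
  admissible d _ := by
    rcases d with ⟨i, u⟩
    fin_cases i
    exacts [h, h.rotate, h.rotate.rotate]

theorem dumbbell_regular {n k : ℕ} (hk : n ≤ k ∧ k ≤ 2 * n)
    (h : AdmissibleTriple (2 * n) k k) : Regular n (dumbbell n k h) := by
  have hC : (dumbbell n k h).components = 1 := by
    refine (card_quot_eq (X := Unit) (fun _ => ()) (fun _ => Quot.mk _ ((0, true) : Fin 3 × Bool))
      (fun _ _ _ => rfl) ?_ (fun _ => rfl)).trans (by simp)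
    have key : ∀ y : Fin 3 × Bool, comp (dumbbell n k h).next (dumbbell n k h).flip (0, true) =
        comp (dumbbell n k h).next (dumbbell n k h).flip y := by
      have h1 : ∀ y : Fin 3 × Bool, comp (dumbbell n k h).next (dumbbell n k h).flip (y.1 + 1, y.2) =
        comp (dumbbell n k h).next (dumbbell n k h).flip y := fun y =>
          comp_left (dumbbell n k h).next (dumbbell n k h).flip y
      have h2 : comp (dumbbell n k h).next (dumbbell n k h).flip (0, true) =
        comp (dumbbell n k h).next (dumbbell n k h).flip (0, false) :=
          comp_right (dumbbell n k h).next (dumbbell n k h).flip (0, false)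
      rintro ⟨i, u⟩
      fin_cases i <;> cases u
      · exact h2
      · rfl
      · exact h2.trans (h1 (0, false)).symm
      · exact (h1 (0, true)).symm
      · exact h2.trans (h1 (2, false))
      · exact h1 (2, true)
    exact key
  refine ⟨?_, ?_, ?_, hC⟩
  · show ∀ d : Fin 3 × Bool, (d.1 + 1 + 1 + 1, d.2) = d
    decide
  · rintro ⟨i, u⟩
    fin_cases i
    exacts [⟨by show n ≤ 2 * n; omega, le_refl (2 * n)⟩, hk, hk]
  · have hE : 2 * orbitCount (dumbbell n k h).flip = 6 := by
      rw [two_mul_edges]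
      exact (Nat.card_eq_fintype_card (α := Fin 3 × Bool)).trans rfl
    have hV : orbitCount (dumbbell n k h).next = 2 := by
      refine (orbitCount_eq (X := Bool) (fun y : Fin 3 × Bool => y.2)
        (fun u => orb (dumbbell n k h).next (0, u)) (fun _ => rfl) ?_
        (fun u => ⟨(0, u), rfl, rfl⟩)).trans (by simp)
      have h1 : ∀ y : Fin 3 × Bool, orb (dumbbell n k h).next (y.1 + 1, y.2) =
        orb (dumbbell n k h).next y := fun y => orb_apply (dumbbell n k h).next y
      rintro ⟨i, u⟩
      fin_cases i
      · rfl
      · exact (h1 (0, u)).symm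
      · exact (h1 (2, u))
    have hF : orbitCount (dumbbell n k h).face = 3 := by
      have h1 : ∀ y z : Fin 3 × Bool, (dumbbell n k h).face y = z →
          orb (dumbbell n k h).face z = orb (dumbbell n k h).face y := by
        rintro y _ rfl; exact orb_apply _ _
      have h2 : ((2 : Fin 3) + 1, false) = ((0 : Fin 3), false) := by decide
      refine (orbitCount_eq (X := Option Bool)
        (fun y : Fin 3 × Bool => if y.1 = 2 then some y.2 else none)
        (fun z => Option.casesOn z (orb (dumbbell n k h).face (0, false))
          fun u => orb (dumbbell n k h).face (2, u)) ?_ ?_ ?_).trans (by simp)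
      · show ∀ y : Fin 3 × Bool,
          (if ![0, 2, 1] y.1 + 1 = (2 : Fin 3) then some (if y.1 = 0 then !y.2 else y.2) else none) =
            if y.1 = 2 then some y.2 else none
        decide
      · rintro ⟨i, u⟩
        fin_cases i <;> cases u
        · rfl
        · exact (h1 (1, false) (0, false) h2).trans (h1 (0, true) (1, false) rfl)
        · exact h1 (1, false) (0, false) h2
        · exact (h1 (0, false) (1, true) rfl).symm
        · rfl
        · rfl
      · rintro (_ | u)
        · exact ⟨(0, false), rfl, rfl⟩
        · exact ⟨(2, u), rfl, rfl⟩
    rw [planar_iff, hC]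
    omega

/-- A circle is obtained from a dumbbell by the inverse of a fusion. -/
theorem generated_of_circle {n : ℕ} (hn : 1 ≤ n) {Γ : KTG} (hp : Γ.Planar) (hb : Γ.Banded n)
    (hC : Γ.components = 1) {p : Γ.Dart} (hnp : Γ.next (Γ.next p) = p) (hfp : Γ.flip p = Γ.next p) :
    Generated Γ := by
  have hff := Γ.flip_flip
  have hpq : Γ.next p ≠ p := Γ.next_ne p
  have hall : ∀ y, y = p ∨ y = Γ.next p := by
    refine forall_of_componentCount_eq_one hC (P := fun y => y = p ∨ y = Γ.next p)
      (fun d => ⟨?_, ?_⟩) (fun d => ⟨?_, ?_⟩) (Or.inl rfl)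
    · rintro (h | h)
      · exact Or.inr (Γ.next_injective (h.trans hnp.symm))
      · exact Or.inl (Γ.next_injective h)
    · rintro (h | h)
      · exact Or.inr (by rw [h])
      · exact Or.inl (by rw [h, hnp])
    · rintro (h | h)
      · exact Or.inr (by rw [← hfp, ← h, hff])
      · exact Or.inl (Γ.flip_injective (by rw [h, hfp]))
    · rintro (h | h)
      · exact Or.inr (by rw [h, hfp])
      · exact Or.inl (by rw [h, ← hfp, hff])
  have hadm : AdmissibleTriple (2 * n) (Γ.color p) (Γ.color p) := by
    have := hb p
    exact ⟨⟨n + Γ.color p, by ring⟩, by omega, by omega, by omega⟩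
  have hreg := dumbbell_regular (hb p) hadm
  obtain ⟨Γ₁, j, P, Q, hs⟩ := exists_isSubdivision Γ p
  have hp₁ : Γ₁.Planar := hs.subdivision.planar_iff.mpr hp
  refine ((hreg.generated hn).step ⟨hreg.planar, hp₁, Or.inr (Or.inr ?_)⟩).step
    ⟨hp₁, hp, Or.inl (Or.inr (Or.inr hs.subdivision))⟩
  have hcase : ∀ y, y = P ∨ y = Q ∨ y = j p ∨ y = j (Γ.next p) := by
    intro y
    rcases hs.cases y with h | h | ⟨d, rfl⟩
    · exact Or.inl h
    · exact Or.inr (Or.inl h)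
    · rcases hall d with h | h <;> simp [h]
  have hfq : Γ.flip (Γ.next p) = p := by rw [← hfp, hff]
  have hjQ : Γ₁.flip (j (Γ.next p)) = Q := by rw [← hfp, hs.flip_x']
  have hQj : Γ₁.flip Q = j (Γ.next p) := by rw [← hjQ, Γ₁.flip_flip]
  have hcol : Γ.color (Γ.next p) = Γ.color p := Γ.color_bivalent p hnp
  obtain ⟨f, f1, f2, f3⟩ := by
    classical
    exact hs.exists_lift (X := Fin 3 × Bool) (fun d => if d = p then (1, true) else (2, false))
      (2, true) (1, false)
  have fp := f1 p
  have fq := f1 (Γ.next p)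
  simp only [if_true, hpq, if_false] at fp fq
  have hinj : Function.Injective f := by
    intro y z h
    rcases hcase y with rfl | rfl | rfl | rfl <;> rcases hcase z with rfl | rfl | rfl | rfl <;>
      first
      | rfl
      | (simp only [f2, f3, fp, fq] at h; exact absurd h (by decide))
  refine ⟨f, j p, P, Q, j (Γ.next p), ((0 : Fin 3), true), ((0 : Fin 3), false), hinj, ?_,
    hs.next_eq p, by rw [hs.next_eq, hnp], hs.next_p, hs.next_q, ?_, ?_, ?_, ?_, ?_, ?_, rfl, ?_, ?_,
    ?_⟩
  · rintro ⟨i, u⟩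
    constructor
    · rintro ⟨y, hy⟩
      rw [← hy]
      rcases hcase y with rfl | rfl | rfl | rfl <;> simp only [f2, f3, fp, fq] <;> constructor <;>
        · intro h
          have := congrArg (fun z : Fin 3 × Bool => z.1) h
          revert this
          decide
    · rintro ⟨h1, h2⟩
      fin_cases i <;> cases u
      exacts [absurd rfl h2, absurd rfl h1, ⟨_, f3⟩, ⟨_, fp⟩, ⟨_, fq⟩, ⟨_, f2⟩]
  · rw [fp]; rfl
  · rw [fp, f2]; rfl
  · rw [f2]; rfl
  · rw [f3]; rfl
  · rw [f3, fq]; rfl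
  · rw [fq]; rfl
  · intro y
    rcases hcase y with rfl | rfl | rfl | rfl
    · rw [hs.flip_p, fp, f2]; rfl
    · rw [hQj, fq, f3]; rfl
    · rw [hs.flip_x, fp, f2]; rfl
    · rw [hjQ, fq, f3]; rfl
  · intro y h1 h2 h3 h4
    rcases hcase y with h | h | h | h
    exacts [absurd h h2, absurd h h3, absurd h h1, absurd h h4]
  · intro y
    rcases hcase y with rfl | rfl | rfl | rfl
    · rw [f2, hs.color_p]; rfl
    · rw [f3, hs.color_q]; rfl
    · rw [fp, hs.color_eq]; rfl
    · rw [fq, hs.color_eq, hcol]; rfl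

/-- Marked points are erased until the graph is cubic or a circle. -/
theorem generated_of_connected {n : ℕ} (hn : 1 ≤ n) {Γ : KTG} (hp : Γ.Planar) (hb : Γ.Banded n)
    (hC : Γ.components = 1) : Generated Γ := by
  suffices ∀ N : ℕ, ∀ Γ : KTG, Γ.Planar → Γ.Banded n → Γ.components = 1 → Nat.card Γ.Dart = N →
      Generated Γ from this _ Γ hp hb hC rfl
  clear hp hb hC Γ
  intro N
  induction N using Nat.strong_induction_on with
  | _ N ih =>
  intro Γ hp hb hC hN
  by_cases hbi : ∃ p, Γ.next (Γ.next p) = p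
  · obtain ⟨p, hnp⟩ := hbi
    by_cases hfp : Γ.flip p = Γ.next p
    · exact generated_of_circle hn hp hb hC hnp hfp
    · obtain ⟨Γ₀, hs, hcol, hcard⟩ := Γ.exists_subdivision p hnp hfp
      have hp₀ := hs.planar_iff.mp hp
      exact (ih _ (hN ▸ hcard) Γ₀ hp₀ (fun d => by
          obtain ⟨d', hd⟩ := hcol d
          exact hd ▸ hb d')
        (hs.components_eq.symm.trans hC) rfl).step ⟨hp₀, hp, Or.inl (Or.inr (Or.inl hs))⟩
  · push Not at hbi
    exact Regular.generated hn ⟨fun d => (Γ.valence d).resolve_left (hbi d), hb, hp, hC⟩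

/-- Two components can be connected by fusing a strand of one with a strand of the other. -/
theorem exists_fusion_of_components {n : ℕ} (hn : 1 ≤ n) {Γ : KTG} (hp : Γ.Planar)
    (hb : Γ.Banded n) (hC : 2 ≤ Γ.components) :
    ∃ Γ' : KTG, Γ'.Planar ∧ Γ'.Banded n ∧ Γ.components = Γ'.components + 1 ∧ Generates Γ' Γ := by
  have : Nontrivial (Component Γ.next Γ.flip) := Finite.one_lt_card_iff_nontrivial.mp hC
  obtain ⟨x, y, hxy⟩ := exists_pair_ne (Component Γ.next Γ.flip)
  rcases x with ⟨x⟩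
  rcases y with ⟨y⟩
  obtain ⟨Γ₁, j₁, p₁, q₁, hs₁⟩ := exists_isSubdivision Γ x
  obtain ⟨Γ₂, j₂, p₂, q₂, hs₂⟩ := exists_isSubdivision Γ₁ (j₁ y)
  have hp₁ : Γ₁.Planar := hs₁.subdivision.planar_iff.mpr hp
  have hp₂ : Γ₂.Planar := hs₂.subdivision.planar_iff.mpr hp₁
  have hb₁ : Γ₁.Banded n := by
    intro d
    rcases hs₁.cases d with rfl | rfl | ⟨d, rfl⟩
    · rw [hs₁.color_p]; exact hb _
    · rw [hs₁.color_q]; exact hb _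
    · rw [hs₁.color_eq]; exact hb _
  have hb₂ : Γ₂.Banded n := by
    intro d
    rcases hs₂.cases d with rfl | rfl | ⟨d, rfl⟩
    · rw [hs₂.color_p]; exact hb₁ _
    · rw [hs₂.color_q]; exact hb₁ _
    · rw [hs₂.color_eq]; exact hb₁ _
  have hcomp : comp Γ₂.next Γ₂.flip (j₂ p₁) ≠ comp Γ₂.next Γ₂.flip p₂ := by
    intro h
    obtain ⟨f₁, a1, a2, -, a3⟩ := hs₁.exists_comp_lift
    obtain ⟨f₂, b1, b2, -, b3⟩ := hs₂.exists_comp_lift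
    have h1 := b3 _ _ h
    rw [b1, b2] at h1
    have h2 := a3 _ _ h1
    rw [a1, a2] at h2
    exact hxy h2
  obtain ⟨e, he, hpar⟩ : ∃ e, (n ≤ e ∧ e ≤ 2 * n) ∧ Even (e + Γ₂.color (j₂ p₁) + Γ₂.color p₂) := by
    rcases Nat.even_or_odd (n + Γ₂.color (j₂ p₁) + Γ₂.color p₂) with h | h
    · exact ⟨n, by omega, h⟩
    · refine ⟨n + 1, by omega, ?_⟩
      rw [Nat.odd_iff] at h
      rw [Nat.even_iff]
      omega
  obtain ⟨Γ₃, ι, p, q, hf, hcp⟩ := Γ₂.exists_isFusion (a := j₂ p₁) (b := p₂)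
    (by rw [hs₂.next_eq, hs₁.next_p, hs₂.next_eq, hs₁.next_q]) (by rw [hs₂.next_p, hs₂.next_q])
    (hs₂.ne_p _) (by rw [hs₂.next_eq]; exact hs₂.ne_p _) e
    (admissible_of_band he (hb₂ _) (hb₂ _) hpar)
  obtain ⟨i1, i2⟩ := hf.invariants hcomp
  have hp₃ := i2 hp₂
  refine ⟨Γ₃, hp₃, ?_, ?_, ?_⟩
  · intro d
    by_cases h1 : d = p
    · rw [h1, hcp]; exact he
    by_cases h2 : d = q
    · rw [h2, ← hf.flip_p, Γ₃.color_flip, hcp]; exact he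
    obtain ⟨d, rfl⟩ := (hf.mem_range d).mpr ⟨h1, h2⟩
    rw [hf.color_eq]
    exact hb₂ _
  · rw [← i1, hs₂.subdivision.components_eq, hs₁.subdivision.components_eq]
  · have s₁ : Step Γ₃ Γ₂ := ⟨hp₃, hp₂, Or.inr (Or.inr hf.fusionMove)⟩
    have s₂ : Step Γ₂ Γ₁ := ⟨hp₂, hp₁, Or.inl (Or.inr (Or.inr hs₂.subdivision))⟩
    have s₃ : Step Γ₁ Γ := ⟨hp₁, hp, Or.inl (Or.inr (Or.inr hs₁.subdivision))⟩
    exact .tail (.tail (.single s₁) s₂) s₃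

/-- Every non-empty planar graph with colors between `n` and `2 * n` is generated from a theta
graph. -/
theorem generated_of_planar {n : ℕ} (hn : 1 ≤ n) {Γ : KTG} (hp : Γ.Planar) (hb : Γ.Banded n)
    (hne : Nonempty Γ.Dart) : Generated Γ := by
  have hpos : 1 ≤ Γ.components := by
    have : Nonempty (Component Γ.next Γ.flip) := hne.map (Quot.mk _)
    exact Nat.card_pos
  obtain ⟨m, hm⟩ : ∃ m, Γ.components = m + 1 := ⟨_, (Nat.sub_add_cancel hpos).symm⟩
  clear hne hpos
  induction m generalizing Γ with
  | zero => exact generated_of_connected hn hp hb hm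
  | succ m ih =>
    obtain ⟨Γ', hp', hb', hC, hg⟩ := exists_fusion_of_components hn hp hb (by omega)
    exact (ih hp' hb' (by omega)).trans hg

end KTG

/-! ### The Euler characteristic of the limit graph -/

namespace LinkDiagram.TwistRegions

variable {L : LinkDiagram} {T : L.TwistRegions}

theorem outer_of_not_atCrossing {d : L.Dart} (h : ¬ L.AtCrossing d) : T.Outer d :=
  ⟨fun hj => h (T.joined_crossing _ hj),
    fun hj => h (by rw [← L.valence d]; exact atCrossing_next (T.joined_crossing _ hj))⟩

theorem not_atCrossing_next {d : L.Dart} (h : ¬ L.AtCrossing d) : ¬ L.AtCrossing (L.next d) :=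
  fun h' => h (atCrossing_of_next h')

theorem not_outer_next {e : L.Dart} (h : T.joined e) : ¬ T.Outer (L.next e) :=
  fun h' => h'.2 (by rw [L.valence]; exact h)

theorem next_injective : Function.Injective L.next := fun a b h => by
  rw [← L.valence a, h, L.valence]

variable (T) in
open Classical in
/-- The end of a crossing to which the dart `d` belongs, named by its first dart. -/
noncomputable def endOf (d : L.Dart) (hc : L.AtCrossing d) : {e // T.IsEnd e} :=
  if h : T.IsEnd d then ⟨d, h⟩ else ⟨_, isEnd_prev hc h⟩

theorem endOf_first {d : L.Dart} (h : T.IsEnd d) : T.endOf d h.1 = ⟨d, h⟩ := dif_pos h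

theorem endOf_second {d : L.Dart} (hc : L.AtCrossing d) (h : ¬ T.IsEnd d) :
    T.endOf d hc = ⟨_, isEnd_prev hc h⟩ := dif_neg h

variable (T) in
open Classical in
/-- Of the two opposite ends at a crossing, the one on the side `true`. -/
noncomputable def trueEnd (e : {e // T.IsEnd e}) : {e // T.IsEnd e ∧ T.side e = true} :=
  if h : T.side e.1 = true then ⟨e.1, e.2, h⟩
  else ⟨_, isEnd_opp e.2, by rw [T.side_opposite _ e.2.1]; simpa using h⟩

theorem trueEnd_of_side {e : {e // T.IsEnd e}} (h : T.side e.1 = true) :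
    T.trueEnd e = ⟨e.1, e.2, h⟩ := dif_pos h

theorem trueEnd_cases (e : {e // T.IsEnd e}) :
    (T.trueEnd e).1 = e.1 ∨ (T.trueEnd e).1 = L.next (L.next e.1) := by
  unfold trueEnd
  split_ifs
  exacts [Or.inl rfl, Or.inr rfl]

theorem trueEnd_opp (e : {e // T.IsEnd e}) : T.trueEnd ⟨_, isEnd_opp e.2⟩ = T.trueEnd e := by
  have hs := T.side_opposite _ e.2.1
  apply Subtype.ext
  unfold trueEnd
  by_cases h : T.side e.1 = true
  · have h' : ¬ T.side (L.next (L.next e.1)) = true := by rw [hs, h]; simp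
    simp only [dif_pos h, dif_neg h', L.valence]
  · have h' : T.side (L.next (L.next e.1)) = true := by rw [hs]; simpa using h
    simp only [dif_neg h, dif_pos h']

theorem trueEnd_endOf_next {d : L.Dart} (hc : L.AtCrossing d) :
    T.trueEnd (T.endOf (L.next d) (atCrossing_next hc)) = T.trueEnd (T.endOf d hc) := by
  by_cases h : T.IsEnd d
  · rw [endOf_second _ (not_isEnd_next h), endOf_first h]
    congr 1
    exact Subtype.ext (L.valence d)
  · have h' := isEnd_opp (isEnd_prev hc h)
    rw [L.valence] at h'
    rw [endOf_first h', endOf_second _ h, ← trueEnd_opp]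

variable (T) in
open Classical in
/-- Two joined ends that bound a common bigon are represented by the one on the side `true`. -/
noncomputable def trueJoint (e : {e // T.joined e}) : {e // T.joined e ∧ T.side e = true} :=
  if h : T.side e.1 = true then ⟨e.1, e.2, h⟩
  else ⟨_, T.joined_symm _ e.2, by rw [T.joined_side _ e.2]; simpa using h⟩

theorem trueJoint_of_side {e : {e // T.joined e}} (h : T.side e.1 = true) :
    T.trueJoint e = ⟨e.1, e.2, h⟩ := dif_pos h

theorem trueJoint_cases (e : {e // T.joined e}) :
    (T.trueJoint e).1 = e.1 ∨ (T.trueJoint e).1 = L.flip (L.next e.1) := by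
  unfold trueJoint
  split_ifs
  exacts [Or.inl rfl, Or.inr rfl]

theorem trueJoint_symm (e : {e // T.joined e}) :
    T.trueJoint ⟨_, T.joined_symm _ e.2⟩ = T.trueJoint e := by
  have hs := T.joined_side _ e.2
  apply Subtype.ext
  unfold trueJoint
  by_cases h : T.side e.1 = true
  · have h' : ¬ T.side (L.flip (L.next e.1)) = true := by rw [hs, h]; simp
    simp only [dif_pos h, dif_neg h', T.joined_bigon _ e.2, L.flip_flip]
  · have h' : T.side (L.flip (L.next e.1)) = true := by rw [hs]; simpa using h
    simp only [dif_neg h, dif_pos h']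

/-- The rotation of a link diagram at its marked points. -/
def markedNext (L : LinkDiagram) (d : {d // ¬ L.AtCrossing d}) : {d // ¬ L.AtCrossing d} :=
  ⟨L.next d.1, not_atCrossing_next d.2⟩

variable (T) in
/-- The vertices of a diagram are the marked points and the crossings; a crossing is counted by its end
on the side `true`. -/
theorem orbitCount_next : orbitCount L.next =
    orbitCount (markedNext L) + Nat.card {e // T.IsEnd e ∧ T.side e = true} := by
  classical
  have := L.finite_dart
  have hmk : ∀ a : {d // ¬ L.AtCrossing d}, orb L.next (markedNext L a).1 = orb L.next a.1 :=
    fun a => orb_apply _ _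
  refine (orbitCount_eq (X := Orbit (markedNext L) ⊕ {e // T.IsEnd e ∧ T.side e = true})
    (fun d => if h : L.AtCrossing d then Sum.inr (T.trueEnd (T.endOf d h))
      else Sum.inl (orb _ ⟨d, h⟩))
    (Sum.elim (Quot.lift (fun d => orb L.next d.1) (by rintro a _ rfl; exact (hmk a).symm))
      fun e => orb L.next e.1) ?_ ?_ ?_).trans Nat.card_sum
  · intro d
    by_cases h : L.AtCrossing d
    · simp only [dif_pos h, dif_pos (atCrossing_next h), trueEnd_endOf_next h]
    · simp only [dif_neg h, dif_neg (not_atCrossing_next h)]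
      exact congrArg Sum.inl (orb_apply (markedNext L) ⟨d, h⟩)
  · intro d
    by_cases h : L.AtCrossing d
    · simp only [dif_pos h, Sum.elim_inr]
      have h1 : orb L.next (T.endOf d h).1 = orb L.next d := by
        by_cases he : T.IsEnd d
        · rw [endOf_first he]
        · rw [endOf_second h he, orb_apply, orb_apply, orb_apply]
      rcases trueEnd_cases (T.endOf d h) with h2 | h2
      · rw [h2, h1]
      · rw [h2, orb_apply, orb_apply, h1]
    · simp only [dif_neg h, Sum.elim_inl]
  · rintro (⟨⟨d⟩⟩ | e)
    · exact ⟨d.1, rfl, dif_neg d.2⟩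
    · refine ⟨e.1, rfl, ?_⟩
      rw [dif_pos e.2.1.1, endOf_first e.2.1, trueEnd_of_side e.2.2]

theorem not_joined_endOf {d : L.Dart} (hd : T.Outer d) (hc : L.AtCrossing d) :
    ¬ T.joined (T.endOf d hc).1 := by
  by_cases he : T.IsEnd d
  · rw [endOf_first he]; exact hd.1
  · rw [endOf_second hc he]; exact hd.2

variable (T) in
/-- The vertices of the limit graph are the marked points of the diagram, a trivalent one for each free
end, and a bivalent one for each pair of joined ends. -/
theorem orbitCount_limitNext : orbitCount T.limitNext =
    orbitCount (markedNext L) + (Nat.card {e // T.IsEnd e ∧ ¬ T.joined e} +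
      Nat.card {e // T.joined e ∧ T.side e = true}) := by
  classical
  have := L.finite_dart
  have hmk : ∀ a : {d // ¬ L.AtCrossing d},
      orb T.limitNext (Sum.inl ⟨(markedNext L a).1, outer_of_not_atCrossing (markedNext L a).2⟩) =
      orb T.limitNext (Sum.inl ⟨a.1, outer_of_not_atCrossing a.2⟩) := fun a => by
    rw [← orb_apply T.limitNext (Sum.inl ⟨a.1, _⟩),
      limitNext_outer (d := ⟨a.1, _⟩) (fun h => a.2 h.1)]
    rfl
  refine (orbitCount_eq (X := Orbit (markedNext L) ⊕ ({e // T.IsEnd e ∧ ¬ T.joined e} ⊕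
      {e // T.joined e ∧ T.side e = true}))
    (fun m => match m with
      | Sum.inl d => if h : L.AtCrossing d.1 then
          Sum.inr (Sum.inl ⟨(T.endOf d.1 h).1, (T.endOf d.1 h).2, not_joined_endOf d.2 h⟩)
          else Sum.inl (orb _ ⟨d.1, h⟩)
      | Sum.inr e => if h : T.joined e.1 then Sum.inr (Sum.inr (T.trueJoint ⟨e.1, h⟩))
          else Sum.inr (Sum.inl ⟨e.1, e.2, h⟩))
    (Sum.elim (Quot.lift
        (fun d => orb T.limitNext (Sum.inl ⟨d.1, outer_of_not_atCrossing d.2⟩))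
        (by rintro a _ rfl; exact (hmk a).symm))
      (Sum.elim (fun e => orb T.limitNext (Sum.inr ⟨e.1, e.2.1⟩))
        fun e => orb T.limitNext (Sum.inr ⟨e.1, joined_isEnd e.2.1⟩))) ?_ ?_ ?_).trans
    (Nat.card_sum.trans (congrArg _ Nat.card_sum))
  · rintro (d | e)
    · by_cases h : L.AtCrossing d.1
      · by_cases he : T.IsEnd d.1
        · rw [limitNext_outer (fun h => h.2 he)]
          simp only [dif_pos h, dif_pos (atCrossing_next h)]
          congr 3
          rw [endOf_second _ (not_isEnd_next he), endOf_first he]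
          exact L.valence _
        · rw [limitNext_second ⟨h, he⟩]
          simp only [dif_pos h, dif_neg d.2.2]
          congr 3
          rw [endOf_second h he]
      · rw [limitNext_outer (fun h' => h h'.1)]
        simp only [dif_neg h, dif_neg (not_atCrossing_next h)]
        exact congrArg Sum.inl (orb_apply (markedNext L) ⟨d.1, h⟩)
    · by_cases h : T.joined e.1
      · rw [limitNext_joined h]
        simp only [dif_pos h, dif_pos (T.joined_symm _ h)]
        rw [← trueJoint_symm ⟨e.1, h⟩]
      · rw [limitNext_free h]
        simp only [dif_neg h, dif_pos e.2.1, endOf_first e.2]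
  · rintro (d | e)
    · by_cases h : L.AtCrossing d.1
      · simp only [dif_pos h, Sum.elim_inr, Sum.elim_inl]
        by_cases he : T.IsEnd d.1
        · rw [← orb_apply]
          have : T.limitNext (Sum.inr ⟨(T.endOf d.1 h).1, (T.endOf d.1 h).2⟩) = Sum.inl d := by
            rw [limitNext_free (not_joined_endOf d.2 h)]
            congr 1
            exact Subtype.ext (show (T.endOf d.1 h).1 = d.1 by rw [endOf_first he])
          rw [this]
        · rw [← orb_apply T.limitNext (Sum.inl d), limitNext_second ⟨h, he⟩]
          congr 3
          rw [endOf_second h he]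
      · simp only [dif_neg h, Sum.elim_inl]
    · by_cases h : T.joined e.1
      · simp only [dif_pos h, Sum.elim_inr]
        rcases trueJoint_cases ⟨e.1, h⟩ with h2 | h2
        · congr 3
        · rw [← orb_apply T.limitNext (Sum.inr e), limitNext_joined h]
          congr 3
      · simp only [dif_neg h, Sum.elim_inr, Sum.elim_inl]
  · rintro (⟨⟨d⟩⟩ | e | e)
    · exact ⟨Sum.inl ⟨d.1, _⟩, rfl, dif_neg d.2⟩
    · exact ⟨Sum.inr ⟨e.1, e.2.1⟩, rfl, dif_neg e.2.2⟩
    · refine ⟨Sum.inr ⟨e.1, joined_isEnd e.2.1⟩, rfl, ?_⟩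
      simp only [dif_pos e.2.1]
      rw [trueJoint_of_side e.2.2]


variable (T) in
/-- The edge involution of `limitGraph`. -/
def limitFlip : {d // T.Outer d} ⊕ {e // T.IsEnd e} → {d // T.Outer d} ⊕ {e // T.IsEnd e}
  | Sum.inl d => Sum.inl ⟨L.flip d.1, outer_flip d.2⟩
  | Sum.inr e => Sum.inr ⟨L.next (L.next e.1), isEnd_opp e.2⟩

/-- A dart of the diagram in the face that corresponds to the face of the given dart of `limitGraph`.
For the half `Sum.inr e` of an edge of color `2 * n`, this is the face at the opposite end of the
crossing, since the edge is followed in the direction of that end. -/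
def faceDart : {d // T.Outer d} ⊕ {e // T.IsEnd e} → L.Dart
  | Sum.inl d => d.1
  | Sum.inr e => L.next (L.next e.1)

theorem orb_faceDart (m : {d // T.Outer d} ⊕ {e // T.IsEnd e}) :
    orb (L.next ∘ L.flip) (faceDart ((T.limitNext ∘ T.limitFlip) m)) =
      orb (L.next ∘ L.flip) (faceDart m) := by
  rcases m with d | e
  · rw [← orb_apply _ (faceDart (Sum.inl d))]
    congr 1
    by_cases h : L.AtCrossing (L.flip d.1) ∧ ¬ T.IsEnd (L.flip d.1)
    · show faceDart (T.limitNext (Sum.inl ⟨L.flip d.1, outer_flip d.2⟩)) = L.next (L.flip d.1)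
      rw [limitNext_second h]
      exact congrArg L.next (L.valence _)
    · show faceDart (T.limitNext (Sum.inl ⟨L.flip d.1, outer_flip d.2⟩)) = L.next (L.flip d.1)
      rw [limitNext_outer h]
      rfl
  · by_cases h : T.joined (L.next (L.next e.1))
    · rw [← orb_apply _ (faceDart (Sum.inr e))]
      congr 1
      show faceDart (T.limitNext (Sum.inr ⟨_, isEnd_opp e.2⟩)) = L.next (L.flip _)
      rw [limitNext_joined h]
      exact congrArg L.next (T.joined_bigon _ h)
    · congr 1
      show faceDart (T.limitNext (Sum.inr ⟨_, isEnd_opp e.2⟩)) = _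
      rw [limitNext_free h]
      rfl

theorem joined_or_joined_prev {d : L.Dart} (hd : ¬ T.Outer d) (h : ¬ T.joined d) :
    T.joined (L.next (L.next (L.next d))) := by
  by_contra h'
  exact hd ⟨h, h'⟩

/-- The faces of the diagram are the faces of the limit graph and the bigons in the twist
regions. -/
theorem orbitCount_face : orbitCount (L.next ∘ L.flip) =
    orbitCount (T.limitNext ∘ T.limitFlip) + Nat.card {e // T.joined e ∧ T.side e = true} := by
  classical
  have := L.finite_dart
  set φ := L.next ∘ L.flip with hφ
  set φ' := T.limitNext ∘ T.limitFlip with hφ'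
  let f : L.Dart → Orbit φ' ⊕ {e // T.joined e ∧ T.side e = true} := fun d =>
    if h : T.Outer d then Sum.inl (orb φ' (Sum.inl ⟨d, h⟩))
    else if h' : T.joined d then
      Sum.inl (orb φ' (Sum.inr ⟨_, isEnd_opp (joined_isEnd h')⟩))
    else Sum.inr (T.trueJoint ⟨_, joined_or_joined_prev h h'⟩)
  have f_outer : ∀ d (h : T.Outer d), f d = Sum.inl (orb φ' (Sum.inl ⟨d, h⟩)) :=
    fun d h => dif_pos h
  have f_joined : ∀ d (h : T.joined d),
      f d = Sum.inl (orb φ' (Sum.inr ⟨_, isEnd_opp (joined_isEnd h)⟩)) :=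
    fun d h => (dif_neg fun h' => h'.1 h).trans (dif_pos h)
  have f_next : ∀ e (h : T.joined e), f (L.next e) = Sum.inr (T.trueJoint ⟨e, h⟩) := by
    intro e h
    refine (dif_neg (not_outer_next h)).trans ((dif_neg fun h' =>
      not_isEnd_next (joined_isEnd h) (joined_isEnd h')).trans ?_)
    congr 3
    exact L.valence e
  have f_opp : ∀ e : {e // T.IsEnd e}, f (L.next (L.next e.1)) = Sum.inl (orb φ' (Sum.inr e)) := by
    intro e
    by_cases h : T.joined (L.next (L.next e.1))
    · rw [f_joined _ h]
      congr 3
      exact Subtype.ext (L.valence e.1)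
    · rw [f_outer _ (outer_of_isEnd (isEnd_opp e.2) h), ← orb_apply φ' (Sum.inr e)]
      congr 2
      exact (limitNext_free (e := ⟨_, isEnd_opp e.2⟩) h).symm
  have g_joint : ∀ e (h : T.joined e), orb φ (L.next (L.flip (L.next e))) = orb φ (L.next e) :=
    fun e h => orb_apply φ (L.next e)
  refine (orbitCount_eq (X := Orbit φ' ⊕ {e // T.joined e ∧ T.side e = true}) f
    (Sum.elim (Quot.lift (fun m => orb φ (faceDart m))
        (by rintro a _ rfl; exact (orb_faceDart a).symm))
      fun e => orb φ (L.next e.1)) ?_ ?_ ?_).trans Nat.card_sum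
  · intro d
    by_cases hd : T.Outer d
    · rw [f_outer d hd, ← orb_apply φ' (Sum.inl ⟨d, hd⟩)]
      by_cases h : L.AtCrossing (L.flip d) ∧ ¬ T.IsEnd (L.flip d)
      · have h1 : φ' (Sum.inl ⟨d, hd⟩) = _ := limitNext_second (d := ⟨_, outer_flip hd⟩) h
        rw [h1, ← f_opp]
        exact congrArg f (congrArg L.next (L.valence _)).symm
      · have h1 : φ' (Sum.inl ⟨d, hd⟩) = _ := limitNext_outer (d := ⟨_, outer_flip hd⟩) h
        rw [h1]
        exact f_outer _ _
    · by_cases h : T.joined d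
      · have h1 : φ d = L.next (L.next (L.flip (L.next d))) :=
          congrArg L.next (T.joined_bigon _ h).symm
        rw [h1, f_opp ⟨_, joined_isEnd (T.joined_symm _ h)⟩, f_joined d h,
          ← orb_apply φ' (Sum.inr ⟨L.next (L.next d), _⟩)]
        congr 2
        refine (limitNext_joined (e := ⟨d, joined_isEnd h⟩) h).symm.trans ?_
        congr 3
        exact (L.valence d).symm
      · have h' := joined_or_joined_prev hd h
        obtain ⟨e, he, rfl⟩ : ∃ e, T.joined e ∧ L.next e = d := ⟨_, h', L.valence d⟩
        have h1 : φ (L.next e) = L.next (L.flip (L.next e)) := rfl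
        rw [h1, f_next _ (T.joined_symm _ he), f_next _ he, ← trueJoint_symm ⟨e, he⟩]
  · intro d
    by_cases hd : T.Outer d
    · rw [f_outer d hd]
      rfl
    · by_cases h : T.joined d
      · rw [f_joined d h]
        exact congrArg (orb φ) (L.valence d)
      · have h' := joined_or_joined_prev hd h
        obtain ⟨e, he, rfl⟩ : ∃ e, T.joined e ∧ L.next e = d := ⟨_, h', L.valence d⟩
        rw [f_next e he, Sum.elim_inr]
        rcases trueJoint_cases ⟨e, he⟩ with h2 | h2
        · rw [h2]
        · rw [h2, g_joint e he]
  · rintro (⟨⟨d | e⟩⟩ | e)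
    · exact ⟨d.1, rfl, f_outer _ d.2⟩
    · exact ⟨_, rfl, f_opp e⟩
    · exact ⟨L.next e.1, rfl, by rw [f_next _ e.2.1, trueJoint_of_side e.2.2]⟩

theorem componentCount_limit : componentCount T.limitNext T.limitFlip =
    componentCount L.next L.flip := by
  classical
  set cM := comp T.limitNext T.limitFlip with hcM
  set cL := comp L.next L.flip with hcL
  have ml : ∀ m, cM (T.limitNext m) = cM m := comp_left _ _
  have mr : ∀ m, cM (T.limitFlip m) = cM m := comp_right _ _
  have ll : ∀ d, cL (L.next d) = cL d := comp_left _ _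
  have lr : ∀ d, cL (L.flip d) = cL d := comp_right _ _
  let f : {d // T.Outer d} ⊕ {e // T.IsEnd e} → L.Dart := Sum.elim (fun d => d.1) fun e => e.1
  let g : L.Dart → {d // T.Outer d} ⊕ {e // T.IsEnd e} := fun d =>
    if h : L.AtCrossing d then Sum.inr (T.endOf d h) else Sum.inl ⟨d, outer_of_not_atCrossing h⟩
  have g_end : ∀ e (h : T.IsEnd e), g e = Sum.inr ⟨e, h⟩ := fun e h =>
    (dif_pos h.1).trans (congrArg Sum.inr (endOf_first h))
  have g_second : ∀ d (hc : L.AtCrossing d) (h : ¬ T.IsEnd d), g d = Sum.inr ⟨_, isEnd_prev hc h⟩ :=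
    fun d hc h => (dif_pos hc).trans (congrArg Sum.inr (endOf_second hc h))
  have g_next_end : ∀ e (h : T.IsEnd e), g (L.next e) = Sum.inr ⟨e, h⟩ := fun e h => by
    rw [g_second _ (atCrossing_next h.1) (not_isEnd_next h)]
    congr 1
    exact Subtype.ext (L.valence e)
  have g_marked : ∀ d (h : ¬ L.AtCrossing d), g d = Sum.inl ⟨d, outer_of_not_atCrossing h⟩ :=
    fun d h => dif_neg h
  have g_outer : ∀ d (h : T.Outer d), cM (g d) = cM (Sum.inl ⟨d, h⟩) := by
    intro d h
    by_cases hc : L.AtCrossing d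
    · by_cases he : T.IsEnd d
      · rw [g_end d he, ← ml, limitNext_free (e := ⟨d, he⟩) h.1]
      · rw [g_second d hc he, ← ml (Sum.inl ⟨d, h⟩), limitNext_second (d := ⟨d, h⟩) ⟨hc, he⟩]
    · rw [g_marked d hc]
  refine componentCount_congr f g ?_ ?_ ?_ ?_ ?_ ?_
  · rintro (d | e)
    · by_cases h : L.AtCrossing d.1 ∧ ¬ T.IsEnd d.1
      · rw [limitNext_second h]
        exact (ll _).trans ((ll _).trans (ll _))
      · rw [limitNext_outer h]
        exact ll _
    · by_cases h : T.joined e.1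
      · rw [limitNext_joined h]
        exact (lr _).trans (ll _)
      · rw [limitNext_free h]
        rfl
  · rintro (d | e)
    · exact lr _
    · exact (ll _).trans (ll _)
  · intro d
    by_cases hc : L.AtCrossing d
    · by_cases he : T.IsEnd d
      · rw [g_next_end d he, g_end d he]
      · have he' := isEnd_opp (isEnd_prev hc he)
        rw [L.valence] at he'
        rw [g_second d hc he, g_end _ he']
        have h1 := mr (Sum.inr ⟨_, isEnd_prev hc he⟩)
        rw [← hcM, ← h1]
        congr 2
        exact Subtype.ext (congrArg L.next (L.valence d)).symm
    · rw [g_marked d hc, g_marked _ (not_atCrossing_next hc),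
        ← limitNext_outer (d := ⟨d, outer_of_not_atCrossing hc⟩) (fun h => hc h.1)]
      exact ml _
  · intro d
    by_cases hd : T.Outer d
    · exact (g_outer _ (outer_flip hd)).trans ((mr (Sum.inl ⟨d, hd⟩)).trans (g_outer d hd).symm)
    · have key : ∀ e (h : T.joined e), cM (g (L.flip (L.next e))) = cM (g e) := by
        intro e h
        rw [g_end _ (joined_isEnd (T.joined_symm _ h)), g_end e (joined_isEnd h),
          ← limitNext_joined (e := ⟨e, joined_isEnd h⟩) h]
        exact ml _
      by_cases h : T.joined d
      · have h2 := joined_isEnd (T.joined_symm _ h)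
        have h1 : g (L.flip d) = g (L.flip (L.next d)) := by
          rw [← T.joined_bigon d h, g_next_end _ h2, g_end _ h2]
        rw [h1]
        exact key d h
      · have h' := joined_or_joined_prev hd h
        obtain ⟨e, he, rfl⟩ : ∃ e, T.joined e ∧ L.next e = d := ⟨_, h', L.valence d⟩
        rw [g_next_end e (joined_isEnd he), ← g_end e (joined_isEnd he)]
        exact key e he
  · rintro (d | e)
    · exact g_outer d.1 d.2
    · exact congrArg cM (g_end e.1 e.2)
  · intro d
    by_cases hc : L.AtCrossing d
    · by_cases he : T.IsEnd d
      · rw [g_end d he]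
        rfl
      · rw [g_second d hc he]
        exact (ll _).trans ((ll _).trans (ll _))
    · rw [g_marked d hc]
      rfl

variable (T) in
theorem card_isEnd : Nat.card {e // T.IsEnd e} = 2 * Nat.card {e // T.IsEnd e ∧ T.side e = true} := by
  have := L.finite_dart
  rw [two_mul, ← Nat.card_sum]
  symm
  refine Nat.card_congr (Equiv.ofBijective (Sum.elim (fun e => ⟨e.1, e.2.1⟩)
    fun e => ⟨L.next (L.next e.1), isEnd_opp e.2.1⟩) ⟨?_, ?_⟩)
  · rintro (a | a) (b | b) h <;> have h' := congrArg Subtype.val h <;>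
      simp only [Sum.elim_inl, Sum.elim_inr] at h'
    · rw [Subtype.ext h']
    · have := T.side_opposite _ b.2.1.1
      rw [← h', a.2.2, b.2.2] at this
      cases this
    · have := T.side_opposite _ a.2.1.1
      rw [h', a.2.2, b.2.2] at this
      cases this
    · rw [Subtype.ext (next_injective (next_injective h'))]
  · intro e
    by_cases h : T.side e.1 = true
    · exact ⟨Sum.inl ⟨e.1, e.2, h⟩, rfl⟩
    · exact ⟨Sum.inr ⟨_, isEnd_opp e.2, by rw [T.side_opposite _ e.2.1]; simpa using h⟩,
        Subtype.ext (L.valence e.1)⟩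

variable (T) in
theorem card_joined : Nat.card {e // T.joined e} =
    2 * Nat.card {e // T.joined e ∧ T.side e = true} := by
  have := L.finite_dart
  rw [two_mul, ← Nat.card_sum]
  symm
  refine Nat.card_congr (Equiv.ofBijective (Sum.elim (fun e => ⟨e.1, e.2.1⟩)
    fun e => ⟨L.flip (L.next e.1), T.joined_symm _ e.2.1⟩) ⟨?_, ?_⟩)
  · rintro (a | a) (b | b) h <;> have h' := congrArg Subtype.val h <;>
      simp only [Sum.elim_inl, Sum.elim_inr] at h'
    · rw [Subtype.ext h']
    · have := T.joined_side _ b.2.1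
      rw [← h', a.2.2, b.2.2] at this
      cases this
    · have := T.joined_side _ a.2.1
      rw [h', a.2.2, b.2.2] at this
      cases this
    · have := congrArg L.flip h'
      rw [L.flip_flip, L.flip_flip] at this
      rw [Subtype.ext (next_injective this)]
  · intro e
    by_cases h : T.side e.1 = true
    · exact ⟨Sum.inl ⟨e.1, e.2, h⟩, rfl⟩
    · refine ⟨Sum.inr ⟨_, T.joined_symm _ e.2, by rw [T.joined_side _ e.2]; simpa using h⟩,
        Subtype.ext ?_⟩
      show L.flip (L.next (L.flip (L.next e.1))) = e.1
      rw [T.joined_bigon _ e.2, L.flip_flip]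

variable (T) in
theorem card_isEnd_eq_add : Nat.card {e // T.IsEnd e} =
    Nat.card {e // T.IsEnd e ∧ ¬ T.joined e} + Nat.card {e // T.joined e} := by
  have := L.finite_dart
  rw [← Nat.card_sum]
  symm
  refine Nat.card_congr (Equiv.ofBijective (Sum.elim (fun e => ⟨e.1, e.2.1⟩)
    fun e => ⟨e.1, joined_isEnd e.2⟩) ⟨?_, ?_⟩)
  · rintro (a | a) (b | b) h <;> have h' := congrArg Subtype.val h <;>
      simp only [Sum.elim_inl, Sum.elim_inr] at h'
    · rw [Subtype.ext h']
    · exact absurd b.2 (h' ▸ a.2.2)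
    · exact absurd a.2 (h' ▸ b.2.2)
    · rw [Subtype.ext h']
  · intro e
    by_cases h : T.joined e.1
    · exact ⟨Sum.inr ⟨e.1, h⟩, rfl⟩
    · exact ⟨Sum.inl ⟨e.1, e.2, h⟩, rfl⟩

variable (T) in
/-- The darts that are not outer are the first and the second darts of the joined ends. -/
theorem card_dart : Nat.card L.Dart =
    Nat.card {d // T.Outer d} + 2 * Nat.card {e // T.joined e} := by
  have := L.finite_dart
  rw [two_mul, ← Nat.card_sum, ← Nat.card_sum]
  symm
  refine Nat.card_congr (Equiv.ofBijective (Sum.elim (fun e => e.1)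
    (Sum.elim (fun e => e.1) fun e => L.next e.1)) ⟨?_, ?_⟩)
  · rintro (a | a | a) (b | b | b) h <;> simp only [Sum.elim_inl, Sum.elim_inr] at h
    · rw [Subtype.ext h]
    · exact absurd b.2 (h ▸ a.2.1)
    · exact absurd (h ▸ a.2) (not_outer_next b.2)
    · exact absurd a.2 (h ▸ b.2.1)
    · rw [Subtype.ext h]
    · exact absurd (h ▸ joined_isEnd a.2) (not_isEnd_next (joined_isEnd b.2))
    · exact absurd (h ▸ b.2) (not_outer_next a.2)
    · exact absurd (h ▸ joined_isEnd b.2) (not_isEnd_next (joined_isEnd a.2))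
    · rw [Subtype.ext (next_injective h)]
  · intro d
    by_cases hd : T.Outer d
    · exact ⟨Sum.inl ⟨d, hd⟩, rfl⟩
    · by_cases h : T.joined d
      · exact ⟨Sum.inr (Sum.inl ⟨d, h⟩), rfl⟩
      · exact ⟨Sum.inr (Sum.inr ⟨_, joined_or_joined_prev hd h⟩), L.valence d⟩

/-- Passing from the diagram to the limit graph changes the numbers of vertices, edges and faces by
the numbers of crossings and of bigons, and the Euler characteristic is unchanged. -/
theorem limitGraph_planar (n : ℕ) : (T.limitGraph n).Planar := by
  have := L.finite_dart
  have hflip : (T.limitGraph n).flip = T.limitFlip := by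
    funext m
    rcases m with d | e <;> rfl
  show IsPlanarMap T.limitNext (T.limitGraph n).flip
  rw [hflip]
  have hE : 2 * orbitCount T.limitFlip = Nat.card ({d // T.Outer d} ⊕ {e // T.IsEnd e}) := by
    rw [← hflip]
    exact two_mul_orbitCount_involution (T.limitGraph n).flip_ne (T.limitGraph n).flip_flip
  have hE' : 2 * orbitCount L.flip = Nat.card L.Dart :=
    two_mul_orbitCount_involution L.flip_ne L.flip_flip
  have hp := L.planar
  have h1 := orbitCount_next T
  have h2 := orbitCount_limitNext T
  have h3 := orbitCount_face (T := T)
  have h4 := componentCount_limit (T := T)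
  have h5 := card_isEnd T
  have h6 := card_joined T
  have h7 := card_isEnd_eq_add T
  have h8 := card_dart T
  rw [Nat.card_sum] at hE
  unfold IsPlanarMap at hp ⊢
  omega

theorem limitGraph_banded (n : ℕ) : (T.limitGraph n).Banded n := by
  rintro (d | e)
  · exact ⟨le_refl n, show n ≤ 2 * n by omega⟩
  · exact ⟨show n ≤ 2 * n by omega, le_refl (2 * n)⟩

theorem limitGraph_nonempty (n : ℕ) (hL : Nonempty L.Dart) : Nonempty (T.limitGraph n).Dart := by
  obtain ⟨d⟩ := hL
  by_cases h : L.AtCrossing d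
  · exact ⟨Sum.inr (T.endOf d h)⟩
  · exact ⟨Sum.inl ⟨d, outer_of_not_atCrossing h⟩⟩

end LinkDiagram.TwistRegions

/-! ### Readings of the limit graph -/

namespace KTG

theorem Iso.banded {n : ℕ} {Γ Γ' : KTG} (h : Iso Γ Γ') (hb : Γ.Banded n) : Γ'.Banded n := by
  obtain ⟨e, -, -, hc⟩ := h
  intro d
  obtain ⟨d, rfl⟩ := e.surjective d
  rw [hc]
  exact hb d

theorem Subdivision.banded_iff {n : ℕ} {Γ Γ' : KTG} (h : Subdivision Γ Γ') :
    Γ'.Banded n ↔ Γ.Banded n := by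
  obtain ⟨ι, x, p, q, -, hr, hx, hp, hq, -, -, -, hc⟩ := h
  refine ⟨fun hb d => hc d ▸ hb (ι d), fun hb y => ?_⟩
  have hcp : Γ'.color p = Γ.color x := by rw [← hx, Γ'.color_flip, hc]
  by_cases h1 : y = p
  · rw [h1, hcp]
    exact hb x
  by_cases h2 : y = q
  · rw [h2, ← hp, Γ'.color_bivalent p (by rw [hp, hq]), hcp]
    exact hb x
  obtain ⟨d, rfl⟩ := (hr y).mpr ⟨h1, h2⟩
  rw [hc]
  exact hb d

end KTG

/-- Every reading is a non-empty planar graph with colors `n` and `2 * n`: the vertices of color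
`2 * n` that it may contain are triangles contracted to a point. -/
theorem LinkDiagram.TwistRegions.LimitReading.planar_banded_nonempty {n : ℕ} {L : LinkDiagram}
    {T : L.TwistRegions} {Γ : KTG} (hΓ : T.LimitReading n Γ) (hL : Nonempty L.Dart) :
    Γ.Planar ∧ Γ.Banded n ∧ Nonempty Γ.Dart := by
  refine Relation.ReflTransGen.rec (motive := fun Γ _ => Γ.Planar ∧ Γ.Banded n ∧ Nonempty Γ.Dart)
    ⟨limitGraph_planar n, limitGraph_banded n, limitGraph_nonempty n hL⟩ ?_ hΓ
  rintro Γ₁ Γ₂ - h ⟨hp, hb, hne⟩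
  rcases h with (h | h | h) | ⟨ι, x, s, t, h, -, -⟩
  · refine ⟨h.planar hp, h.banded hb, ?_⟩
    obtain ⟨e, -⟩ := h
    exact hne.map e
  · refine ⟨h.planar_iff.mpr hp, h.banded_iff.mpr hb, ?_⟩
    obtain ⟨ι, -⟩ := h
    exact hne.map ι
  · refine ⟨h.planar_iff.mp hp, h.banded_iff.mp hb, ?_⟩
    obtain ⟨-, x, -⟩ := h
    exact ⟨x⟩
  · refine ⟨h.invariants.2.1.mp hp, fun d => ?_, ⟨x⟩⟩
    rw [← h.2.2.2.2.2 d]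
    exact hb (ι d)

theorem lemma4p1 (n : ℕ) (hn : 1 ≤ n) (L : LinkDiagram) (hL : Nonempty L.Dart)
    (T : L.TwistRegions) (Γ : KTG) (hΓ : T.LimitReading n Γ) :
    ∃ (a b c : ℕ) (h : AdmissibleTriple a b c), KTG.Generates (KTG.theta a b c h) Γ := by
  obtain ⟨hp, hb, hne⟩ := hΓ.planar_banded_nonempty hL
  exact KTG.generated_of_planar hn hp hb hne
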